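/- **Theorem 3.1 (Sobolev embeddings).** Let $\mathcal G$ be a compact Lie algebra, i.e. a finite-dimensional real Lie algebra with a positive definite inner product satisfying $(X,[Y,Z])=-([Y,X],Z)$, and let $|\cdot|$ be the induced norm. Let $0<\sigma\le 1$, let $n\ge 2$ be an integer, put $w(x)=(1+|x|^2)^{1/2}$ on $\mathbb R^3$, let $A_k:\mathbb R^3\to\mathcal G$ ($k=1,2,3$), and write $\nabla_k=\partial_k+[A_k,\cdot\,]$, $G_{kl}=\partial_lA_k-\partial_kA_l-[A_k,A_l]$, $|\nabla^p\Phi|^2=\sum_{k_1,\dots,k_p=1}^3|\nabla_{k_1}\cdots\nabla_{k_p}\Phi|^2$, where derivatives are weak where necessary. Assume, for all $k,l$: - if $n=2$: $A_k\in C(\mathbb R^3,\mathcal G)$, $\partial^1A_k\in L^3_{loc}$, $\partial^2A_k\in L^1_{loc}$ and $G_{kl}\in C(\mathbb R^3,\mathcal G)$; - if $n\ge 3$: $A_k\in C^{n-3}(\mathbb R^3,\mathcal G)$, $\partial^{n-2}A_k\in L^q_{loc}$ for some $q>3$, $\partial^{n-1}A_k\in L^2_{loc}$ and $G_{kl}\in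 C^{n-3}(\mathbb R^3,\mathcal G)$. Then $$\|\Phi\|_{n,2}=\Bigl(\sum_{p=1}^n\int_{\mathbb R^3} w^{(2p-3)(1-\sigma)}|\nabla^p\Phi|^2\,d^3x\Bigr)^{1/2}$$ is defined and finite for every $\Phi\in C^n_c(\mathbb R^3,\mathcal G)$. Let $H_n(\mathbb R^3,\mathcal G)$ be the completion of $C^n_c(\mathbb R^3,\mathcal G)$ in this norm, and let $C_B^{n-2}(\mathbb R^3,\mathcal G)$ be the space of all $\Phi\in C^{n-2}(\mathbb R^3,\mathcal G)$ for which $$\|\Phi\|_{n-2,\infty}=\max_{0\le p\le n-2}\ \sup_{x\in\mathbb R^3} w(x)^{p(1-\sigma)}|\nabla^p\Phi(x)|$$ is finite. Then $H_n(\mathbb R^3,\mathcal G)$ is continuously embedded in $C_B^{n-2}(\mathbb R^3,\mathcal G)$: the identity on $C^n_c(\mathbb R^3,\mathcal G)$ extends to an injective linear map $J:H_n(\mathbb R^3,\mathcal G)\to C_B^{n-2}(\mathbb R^3,\mathcal G)$, and there is a constant $C$ with $\|JZ\|_{n-2,\infty}\le C\,\|Z\|_{n,2}$ for all $Z\in H_n(\mathbb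 R^3,\mathcal G)$. -/

import Mathlib

open MeasureTheory
open scoped ContDiff ENNReal NNReal

noncomputable section

namespace CovSobolev

/-- The Euclidean space `ℝ³`. -/
abbrev E3 : Type := EuclideanSpace ℝ (Fin 3)

/-- The `k`-th unit vector of `ℝ³`. -/
def unitVec (k : Fin 3) : E3 := EuclideanSpace.single k (1 : ℝ)

/-- A Lie ring and a normed group with the same addition (the bracket and the norm are
not related here). -/
class LieRingWithNorm (𝒢 : Type*) extends NormedAddCommGroup 𝒢, LieRing 𝒢

/-- A compact Lie algebra with a chosen invariant inner product: a finite-dimensional real Lie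
algebra `𝒢` with a positive definite inner product such that
`(X, [Y, Z]) = - ([Y, X], Z)` for all `X`, `Y`, `Z`. Its norm is the one induced by the inner
product. -/
class CompactLieAlgebra (𝒢 : Type*) [LieRingWithNorm 𝒢] extends
    InnerProductSpace ℝ 𝒢, LieAlgebra ℝ 𝒢 where
  finiteDimensional : Module.Finite ℝ 𝒢
  inner_invariant : ∀ X Y Z : 𝒢, Inner.inner ℝ X ⁅Y, Z⁆ = - Inner.inner ℝ ⁅Y, X⁆ Z

variable {𝒢 : Type*} [LieRingWithNorm 𝒢] [CompactLieAlgebra 𝒢]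

/-- The weight `w(x) = (1 + |x|²)^{1/2}`. -/
def weight (x : E3) : ℝ := Real.sqrt (1 + ‖x‖ ^ 2)

/-! ### Weak derivatives -/

/-- `g = ∂_k f` in the sense of distributions, both functions being locally integrable. -/
structure IsWeakDeriv (k : Fin 3) (f g : E3 → 𝒢) : Prop where
  locallyIntegrable : LocallyIntegrable f
  locallyIntegrable_deriv : LocallyIntegrable g
  integral_eq : ∀ φ : E3 → ℝ, ContDiff ℝ ∞ φ → HasCompactSupport φ →
    ∫ x, fderiv ℝ φ x (unitVec k) • f x = - ∫ x, φ x • g x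

/-- `D` lists weak derivatives of `f` up to order `m`:
`D [k₁, …, k_p] = ∂_{k₁} ⋯ ∂_{k_p} f` for `p ≤ m`. -/
structure IsWeakJet (m : ℕ) (f : E3 → 𝒢) (D : List (Fin 3) → E3 → 𝒢) : Prop where
  nil : D [] = f
  cons : ∀ (k : Fin 3) (α : List (Fin 3)), α.length < m → IsWeakDeriv k (D α) (D (k :: α))

/-- The space `L^q_loc(ℝ³, 𝒢)`. -/
def MemLpLoc (f : E3 → 𝒢) (q : ℝ≥0∞) : Prop :=
  ∀ K : Set E3, IsCompact K → MemLp f q (volume.restrict K)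

/-- `∂^m f ∈ L^q_loc(ℝ³, 𝒢)`: all weak derivatives of `f` of order `m` exist and lie in
`L^q_loc`. -/
def DerivMemLpLoc (m : ℕ) (q : ℝ≥0∞) (f : E3 → 𝒢) : Prop :=
  ∃ D : List (Fin 3) → E3 → 𝒢, IsWeakJet m f D ∧
    ∀ α : List (Fin 3), α.length = m → MemLpLoc (D α) q

/-- `G` is (a version of) the curvature component
`G_{kl} = ∂_l A_k - ∂_k A_l - [A_k, A_l]`, with weak derivatives. -/
def IsCurvature (A : Fin 3 → E3 → 𝒢) (k l : Fin 3) (G : E3 → 𝒢) : Prop :=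
  ∃ u v : E3 → 𝒢, IsWeakDeriv l (A k) u ∧ IsWeakDeriv k (A l) v ∧
    ∀ᵐ x, G x = u x - v x - ⁅A k x, A l x⁆

/-- The local regularity assumptions on the gauge potential when `n = 2`. -/
structure LocalAssumptionsTwo (A : Fin 3 → E3 → 𝒢) : Prop where
  potential : ∀ k, Continuous (A k)
  deriv_one : ∀ k, DerivMemLpLoc 1 3 (A k)
  deriv_two : ∀ k, DerivMemLpLoc 2 1 (A k)
  curvature : ∀ k l, ∃ G : E3 → 𝒢, IsCurvature A k l G ∧ Continuous G

/-- The local regularity assumptions on the gauge potential when `n ≥ 3`. -/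
structure LocalAssumptionsGeThree (A : Fin 3 → E3 → 𝒢) (n : ℕ) : Prop where
  potential : ∀ k, ContDiff ℝ (n - 3 : ℕ) (A k)
  deriv_sub_two : ∃ q : ℝ≥0∞, 3 < q ∧ ∀ k, DerivMemLpLoc (n - 2) q (A k)
  deriv_sub_one : ∀ k, DerivMemLpLoc (n - 1) 2 (A k)
  curvature : ∀ k l, ∃ G : E3 → 𝒢, IsCurvature A k l G ∧ ContDiff ℝ (n - 3 : ℕ) G

/-- The local regularity assumptions on the gauge potential, for `n ≥ 2`. -/
def LocalAssumptions (A : Fin 3 → E3 → 𝒢) (n : ℕ) : Prop :=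
  (n = 2 → LocalAssumptionsTwo A) ∧ (3 ≤ n → LocalAssumptionsGeThree A n)

/-! ### Weak covariant derivatives and the Sobolev norm -/

/-- `Ψ = ∇_k Φ = ∂_k Φ + [A_k, Φ]` in the sense of distributions, where `Φ`, `[A_k, Φ]` and `Ψ`
are locally integrable. -/
structure IsWeakCovDeriv (A : Fin 3 → E3 → 𝒢) (k : Fin 3) (Φ Ψ : E3 → 𝒢) : Prop where
  bracket : LocallyIntegrable fun x => ⁅A k x, Φ x⁆
  weakDeriv : IsWeakDeriv k Φ fun x => Ψ x - ⁅A k x, Φ x⁆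

/-- `D` lists the weak covariant derivatives of `Φ` up to order `n`:
`D [k₁, …, k_p] = ∇_{k₁} ⋯ ∇_{k_p} Φ` for `p ≤ n`. -/
structure IsCovJet (A : Fin 3 → E3 → 𝒢) (n : ℕ) (Φ : E3 → 𝒢)
    (D : List (Fin 3) → E3 → 𝒢) : Prop where
  nil : D [] = Φ
  cons : ∀ (k : Fin 3) (α : List (Fin 3)), α.length < n → IsWeakCovDeriv A k (D α) (D (k :: α))

/-- `(∑_{p=1}^n ∑_{k₁,…,k_p} ‖w^{(p-3/2)(1-σ)} D [k₁,…,k_p]‖₂²)^{1/2}`. -/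
def jetNorm (σ : ℝ) (n : ℕ) (D : List (Fin 3) → E3 → 𝒢) : ℝ≥0∞ :=
  (∑ p ∈ Finset.Icc 1 n, ∑ α : Fin p → Fin 3,
    eLpNorm (fun x => weight x ^ (((p : ℝ) - 3 / 2) * (1 - σ)) • D (List.ofFn α) x) 2 volume ^ (2 : ℝ))
    ^ (1 / 2 : ℝ)

/-- The norm `‖Φ‖_{n,2}`: the value of `jetNorm` at the weak covariant derivatives of `Φ`, which
are unique almost everywhere (see `sobNorm_eq`), and `∞` if they do not exist. -/
def sobNorm (A : Fin 3 → E3 → 𝒢) (σ : ℝ) (n : ℕ) (Φ : E3 → 𝒢) : ℝ≥0∞ :=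
  ⨅ (D : List (Fin 3) → E3 → 𝒢) (_ : IsCovJet A n Φ D), jetNorm σ n D

/-! ### Basic facts: the norm is a seminorm -/

lemma IsWeakDeriv.ae_eq {k : Fin 3} {f f' g g' : E3 → 𝒢} (h : IsWeakDeriv k f g)
    (h' : IsWeakDeriv k f' g') (hf : f =ᵐ[volume] f') : g =ᵐ[volume] g' := by
  have : FiniteDimensional ℝ 𝒢 := CompactLieAlgebra.finiteDimensional
  have : CompleteSpace 𝒢 := FiniteDimensional.complete ℝ 𝒢
  refine ae_eq_of_integral_contDiff_smul_eq h.2 h'.2 fun φ h1 h2 => ?_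
  have e1 := h.3 φ h1 h2
  have e2 := h'.3 φ h1 h2
  have : ∫ x, fderiv ℝ φ x (unitVec k) • f x = ∫ x, fderiv ℝ φ x (unitVec k) • f' x :=
    integral_congr_ae (hf.mono fun x hx => by simp only [hx])
  rw [e1, e2] at this
  exact neg_inj.mp this

/-- Weak covariant derivatives are unique almost everywhere. -/
lemma IsCovJet.ae_eq {A : Fin 3 → E3 → 𝒢} {n : ℕ} {Φ : E3 → 𝒢}
    {D D' : List (Fin 3) → E3 → 𝒢} (h : IsCovJet A n Φ D) (h' : IsCovJet A n Φ D') :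
    ∀ α : List (Fin 3), α.length ≤ n → D α =ᵐ[volume] D' α := by
  intro α
  induction α with
  | nil => intro _; rw [h.nil, h'.nil]
  | cons k α ih =>
    intro hα
    have hα' : α.length < n := by simpa using hα
    have ih' := ih hα'.le
    have := (h.cons k α hα').weakDeriv.ae_eq (h'.cons k α hα').weakDeriv ih'
    filter_upwards [this, ih'] with x h1 h2
    rw [h2] at h1
    exact sub_left_inj.mp h1

/-- The norm can be computed from any choice of the weak covariant derivatives. -/
lemma sobNorm_eq {A : Fin 3 → E3 → 𝒢} {σ : ℝ} {n : ℕ} {Φ : E3 → 𝒢}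
    {D : List (Fin 3) → E3 → 𝒢} (h : IsCovJet A n Φ D) : sobNorm A σ n Φ = jetNorm σ n D := by
  refine le_antisymm (iInf₂_le D h) (le_iInf₂ fun D' h' => le_of_eq ?_)
  unfold jetNorm
  congr 1
  refine Finset.sum_congr rfl fun p hp => Finset.sum_congr rfl fun α _ => ?_
  congr 1
  refine eLpNorm_congr_ae ?_
  filter_upwards [h.ae_eq h' (List.ofFn α) (by simpa using (Finset.mem_Icc.mp hp).2)] with x hx
  rw [hx]

lemma IsWeakDeriv.add {k : Fin 3} {f f' g g' : E3 → 𝒢} (h : IsWeakDeriv k f g)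
    (h' : IsWeakDeriv k f' g') : IsWeakDeriv k (f + f') (g + g') where
  locallyIntegrable := h.1.add h'.1
  locallyIntegrable_deriv := h.2.add h'.2
  integral_eq φ h1 h2 := by
    have c1 : Continuous fun x => fderiv ℝ φ x (unitVec k) :=
      (h1.continuous_fderiv (by simp)).clm_apply continuous_const
    have c2 : HasCompactSupport fun x => fderiv ℝ φ x (unitVec k) := h2.fderiv_apply ℝ _
    simp only [Pi.add_apply, smul_add]
    rw [integral_add (h.1.integrable_smul_left_of_hasCompactSupport c1 c2)
        (h'.1.integrable_smul_left_of_hasCompactSupport c1 c2),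
      integral_add (h.2.integrable_smul_left_of_hasCompactSupport h1.continuous h2)
        (h'.2.integrable_smul_left_of_hasCompactSupport h1.continuous h2),
      h.3 φ h1 h2, h'.3 φ h1 h2]
    abel

lemma IsWeakDeriv.smul {k : Fin 3} {f g : E3 → 𝒢} (c : ℝ) (h : IsWeakDeriv k f g) :
    IsWeakDeriv k (c • f) (c • g) where
  locallyIntegrable := h.1.smul c
  locallyIntegrable_deriv := h.2.smul c
  integral_eq φ h1 h2 := by
    have := congrArg (fun z => c • z) (h.3 φ h1 h2)
    simp only [Pi.smul_apply, smul_comm _ c, integral_smul, smul_neg] at this ⊢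
    exact this

lemma IsCovJet.add {A : Fin 3 → E3 → 𝒢} {n : ℕ} {Φ Φ' : E3 → 𝒢}
    {D D' : List (Fin 3) → E3 → 𝒢} (h : IsCovJet A n Φ D) (h' : IsCovJet A n Φ' D') :
    IsCovJet A n (Φ + Φ') (D + D') where
  nil := by simp [h.nil, h'.nil]
  cons k α hα := by
    have a := h.cons k α hα
    have b := h'.cons k α hα
    refine ⟨?_, ?_⟩
    · have := a.bracket.add b.bracket
      simpa [Pi.add_def, lie_add] using this
    · have := a.weakDeriv.add b.weakDeriv
      refine Eq.mp (congrArg _ ?_) this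
      symm
      funext x
      change D (k :: α) x + D' (k :: α) x - ⁅A k x, D α x + D' α x⁆ =
        (D (k :: α) x - ⁅A k x, D α x⁆) + (D' (k :: α) x - ⁅A k x, D' α x⁆)
      rw [lie_add]
      abel

lemma IsCovJet.smul {A : Fin 3 → E3 → 𝒢} {n : ℕ} {Φ : E3 → 𝒢}
    {D : List (Fin 3) → E3 → 𝒢} (c : ℝ) (h : IsCovJet A n Φ D) :
    IsCovJet A n (c • Φ) (c • D) where
  nil := by simp [h.nil]
  cons k α hα := by
    have a := h.cons k α hα
    refine ⟨?_, ?_⟩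
    · have := a.bracket.smul c
      simpa [Pi.smul_def, lie_smul] using this
    · have := a.weakDeriv.smul c
      refine Eq.mp (congrArg _ ?_) this
      symm
      funext x
      change c • D (k :: α) x - ⁅A k x, c • D α x⁆ = c • (D (k :: α) x - ⁅A k x, D α x⁆)
      rw [lie_smul, smul_sub]

lemma continuous_weight_rpow (r : ℝ) : Continuous fun x : E3 => weight x ^ r := by
  have hw : Continuous weight := by unfold weight; fun_prop
  refine hw.rpow_const fun x => Or.inl (ne_of_gt ?_)
  unfold weight
  positivity

lemma IsCovJet.aestronglyMeasurable {A : Fin 3 → E3 → 𝒢} {n : ℕ} {Φ : E3 → 𝒢}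
    {D : List (Fin 3) → E3 → 𝒢} (h : IsCovJet A n Φ D) {α : List (Fin 3)} (hα : α ≠ [])
    (hn : α.length ≤ n) : AEStronglyMeasurable (D α) volume := by
  cases α with
  | nil => exact absurd rfl hα
  | cons k α =>
    have a := h.cons k α (by simpa using hn)
    have := (a.weakDeriv.locallyIntegrable_deriv.add a.bracket).aestronglyMeasurable
    simpa [Pi.add_def] using this

lemma jetNorm_add_le {A : Fin 3 → E3 → 𝒢} {n : ℕ} (σ : ℝ) {Φ Φ' : E3 → 𝒢}
    {D D' : List (Fin 3) → E3 → 𝒢} (h : IsCovJet A n Φ D) (h' : IsCovJet A n Φ' D') :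
    jetNorm σ n (D + D') ≤ jetNorm σ n D + jetNorm σ n D' := by
  unfold jetNorm
  simp only [Finset.sum_sigma']
  refine le_trans ?_ (ENNReal.Lp_add_le _ _ _ (by norm_num : (1 : ℝ) ≤ 2))
  gcongr with i hi
  obtain ⟨p, α⟩ := i
  have hp := Finset.mem_Icc.mp (Finset.mem_sigma.mp hi).1
  simp only at hp
  have hne : List.ofFn α ≠ [] := by
    intro h0
    have := congrArg List.length h0
    simp at this
    omega
  have hl : (List.ofFn α).length ≤ n := by simpa using hp.2
  have m (D : List (Fin 3) → E3 → 𝒢) (hD : AEStronglyMeasurable (D (List.ofFn α)) volume) :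
      AEStronglyMeasurable
        (fun x => weight x ^ (((p : ℝ) - 3 / 2) * (1 - σ)) • D (List.ofFn α) x) volume :=
    (continuous_weight_rpow _).aestronglyMeasurable.smul hD
  have := eLpNorm_add_le (m D (h.aestronglyMeasurable hne hl))
    (m D' (h'.aestronglyMeasurable hne hl)) (by norm_num : (1 : ℝ≥0∞) ≤ 2)
  simpa [Pi.add_def, smul_add] using this

lemma jetNorm_smul (σ : ℝ) (n : ℕ) (c : ℝ) (D : List (Fin 3) → E3 → 𝒢) :
    jetNorm σ n (c • D) = ‖c‖ₑ * jetNorm σ n D := by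
  unfold jetNorm
  have key (p : ℕ) (α : Fin p → Fin 3) :
      eLpNorm (fun x => weight x ^ (((p : ℝ) - 3 / 2) * (1 - σ)) • (c • D) (List.ofFn α) x)
        2 volume ^ (2 : ℝ) = ‖c‖ₑ ^ (2 : ℝ) *
      eLpNorm (fun x => weight x ^ (((p : ℝ) - 3 / 2) * (1 - σ)) • D (List.ofFn α) x)
        2 volume ^ (2 : ℝ) := by
    rw [← ENNReal.mul_rpow_of_nonneg _ _ (by norm_num), ← eLpNorm_const_smul]
    congr 2
    funext x
    simp only [Pi.smul_apply]
    rw [smul_comm]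
  simp only [key, ← Finset.mul_sum]
  rw [ENNReal.mul_rpow_of_nonneg _ _ (by norm_num), ← ENNReal.rpow_mul]
  norm_num

lemma sobNorm_add_le (A : Fin 3 → E3 → 𝒢) (σ : ℝ) (n : ℕ) (Φ Φ' : E3 → 𝒢) :
    sobNorm A σ n (Φ + Φ') ≤ sobNorm A σ n Φ + sobNorm A σ n Φ' := by
  by_cases h : ∃ D, IsCovJet A n Φ D
  · by_cases h' : ∃ D, IsCovJet A n Φ' D
    · obtain ⟨D, hD⟩ := h
      obtain ⟨D', hD'⟩ := h'
      rw [sobNorm_eq hD, sobNorm_eq hD', sobNorm_eq (hD.add hD')]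
      exact jetNorm_add_le σ hD hD'
    · have : sobNorm A σ n Φ' = ⊤ := iInf₂_eq_top.mpr fun D hD => absurd ⟨D, hD⟩ h'
      simp [this]
  · have : sobNorm A σ n Φ = ⊤ := iInf₂_eq_top.mpr fun D hD => absurd ⟨D, hD⟩ h
    simp [this]

lemma isCovJet_zero {A : Fin 3 → E3 → 𝒢} {n : ℕ} : IsCovJet A n 0 0 := by
  have z : LocallyIntegrable (fun _ : E3 => (0 : 𝒢)) volume := locallyIntegrable_zero
  refine ⟨rfl, fun k α _ => ⟨by simpa using z, ?_⟩⟩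
  exact ⟨z, by simpa using z, fun φ _ _ => by simp⟩

lemma sobNorm_zero (A : Fin 3 → E3 → 𝒢) (σ : ℝ) (n : ℕ) : sobNorm A σ n (0 : E3 → 𝒢) = 0 := by
  rw [sobNorm_eq isCovJet_zero]
  have := jetNorm_smul σ n 0 (0 : List (Fin 3) → E3 → 𝒢)
  simpa using this

lemma sobNorm_smul (A : Fin 3 → E3 → 𝒢) (σ : ℝ) (n : ℕ) (c : ℝ) {Φ : E3 → 𝒢}
    (h : sobNorm A σ n Φ < ⊤) : sobNorm A σ n (c • Φ) = ‖c‖ₑ * sobNorm A σ n Φ := by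
  have : ∃ D, IsCovJet A n Φ D := by
    by_contra h'
    exact h.ne (iInf₂_eq_top.mpr fun D hD => absurd ⟨D, hD⟩ h')
  obtain ⟨D, hD⟩ := this
  rw [sobNorm_eq hD, sobNorm_eq (hD.smul c), jetNorm_smul]

/-! ### The Sobolev space -/

/-- The maps of class `C^n_c(ℝ³, 𝒢)` with `‖Φ‖_{n,2} < ∞`. -/
def ccSubmodule (A : Fin 3 → E3 → 𝒢) (σ : ℝ) (n : ℕ) : Submodule ℝ (E3 → 𝒢) where
  carrier := {Φ | ContDiff ℝ n Φ ∧ HasCompactSupport Φ ∧ sobNorm A σ n Φ < ⊤}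
  add_mem' := fun ha hb => ⟨ha.1.add hb.1, ha.2.1.add hb.2.1,
    (sobNorm_add_le A σ n _ _).trans_lt (ENNReal.add_lt_top.mpr ⟨ha.2.2, hb.2.2⟩)⟩
  zero_mem' := ⟨contDiff_const, HasCompactSupport.zero, by simp [sobNorm_zero]⟩
  smul_mem' := fun c Φ h => ⟨contDiff_const.smul h.1, h.2.1.smul_left (f := fun _ => c), by
    rw [sobNorm_smul A σ n c h.2.2]
    exact ENNReal.mul_lt_top enorm_lt_top h.2.2⟩

/-- The space `ccSubmodule A σ n`, as a type that carries the norm `‖·‖_{n,2}` (and not the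
topology of pointwise convergence). -/
def CcSpace (A : Fin 3 → E3 → 𝒢) (σ : ℝ) (n : ℕ) := ↥(ccSubmodule A σ n)

instance (A : Fin 3 → E3 → 𝒢) (σ : ℝ) (n : ℕ) : AddCommGroup (CcSpace A σ n) :=
  inferInstanceAs (AddCommGroup ↥(ccSubmodule A σ n))

instance (A : Fin 3 → E3 → 𝒢) (σ : ℝ) (n : ℕ) : Module ℝ (CcSpace A σ n) :=
  inferInstanceAs (Module ℝ ↥(ccSubmodule A σ n))

/-- The map `ℝ³ → 𝒢` underlying an element of `CcSpace A σ n`. -/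
def CcSpace.toFun {A : Fin 3 → E3 → 𝒢} {σ : ℝ} {n : ℕ} (Φ : CcSpace A σ n) : E3 → 𝒢 :=
  Subtype.val Φ

/-- `‖·‖_{n,2}` as a seminorm. -/
def sobSeminorm (A : Fin 3 → E3 → 𝒢) (σ : ℝ) (n : ℕ) : Seminorm ℝ (CcSpace A σ n) :=
  Seminorm.of (fun Φ => (sobNorm A σ n Φ.toFun).toReal)
    (fun Φ Ψ => by
      have h1 : sobNorm A σ n Φ.toFun < ⊤ := (Subtype.prop Φ).2.2
      have h2 : sobNorm A σ n Ψ.toFun < ⊤ := (Subtype.prop Ψ).2.2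
      rw [← ENNReal.toReal_add h1.ne h2.ne]
      exact ENNReal.toReal_mono (ENNReal.add_lt_top.mpr ⟨h1, h2⟩).ne (sobNorm_add_le A σ n _ _))
    (fun c Φ => by
      have h1 : sobNorm A σ n Φ.toFun < ⊤ := (Subtype.prop Φ).2.2
      have := sobNorm_smul A σ n c h1
      change (sobNorm A σ n (c • Φ.toFun)).toReal = _
      rw [this, ENNReal.toReal_mul, toReal_enorm])

instance (A : Fin 3 → E3 → 𝒢) (σ : ℝ) (n : ℕ) : SeminormedAddCommGroup (CcSpace A σ n) :=
  (sobSeminorm A σ n).toAddGroupSeminorm.toSeminormedAddCommGroup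

instance (A : Fin 3 → E3 → 𝒢) (σ : ℝ) (n : ℕ) : NormedSpace ℝ (CcSpace A σ n) where
  norm_smul_le c Φ := le_of_eq (map_smul_eq_mul (sobSeminorm A σ n) c Φ)

/-- The weighted covariant Sobolev space `H_n(ℝ³, 𝒢)`: the completion of `C^n_c(ℝ³, 𝒢)` in the
norm `‖·‖_{n,2}`. -/
abbrev HSpace (A : Fin 3 → E3 → 𝒢) (σ : ℝ) (n : ℕ) :=
  UniformSpace.Completion (CcSpace A σ n)

/-! ### The target space -/

/-- The classical covariant derivative `∇_k Φ = ∂_k Φ + [A_k, Φ]`. -/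
def covDeriv (A : Fin 3 → E3 → 𝒢) (k : Fin 3) (Φ : E3 → 𝒢) : E3 → 𝒢 :=
  fun x => fderiv ℝ Φ x (unitVec k) + ⁅A k x, Φ x⁆

/-- `∇_{k₁} ⋯ ∇_{k_p} Φ` for `[k₁, …, k_p]`. -/
def covDerivs (A : Fin 3 → E3 → 𝒢) : List (Fin 3) → (E3 → 𝒢) → E3 → 𝒢
  | [], Φ => Φ
  | k :: α, Φ => covDeriv A k (covDerivs A α Φ)

/-- `|∇^p Φ(x)|`. -/
def covDerivNorm (A : Fin 3 → E3 → 𝒢) (p : ℕ) (Φ : E3 → 𝒢) (x : E3) : ℝ :=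
  Real.sqrt (∑ α : Fin p → Fin 3, ‖covDerivs A (List.ofFn α) Φ x‖ ^ 2)

/-- `‖Φ‖_{m,∞} = max_{0 ≤ p ≤ m} sup_x w(x)^{p(1-σ)} |∇^p Φ(x)|`, possibly infinite. -/
def cbNorm (A : Fin 3 → E3 → 𝒢) (σ : ℝ) (m : ℕ) (Φ : E3 → 𝒢) : ℝ≥0∞ :=
  ⨆ (p : ℕ) (_ : p ≤ m) (x : E3),
    ENNReal.ofReal (weight x ^ ((p : ℝ) * (1 - σ)) * covDerivNorm A p Φ x)

/-- The space `C_B^m(ℝ³, 𝒢)`. -/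
def MemCB (A : Fin 3 → E3 → 𝒢) (σ : ℝ) (m : ℕ) (Φ : E3 → 𝒢) : Prop :=
  ContDiff ℝ m Φ ∧ cbNorm A σ m Φ < ⊤

end CovSobolev

end

/-!
The proof reduces the embedding to a pointwise estimate on `C^n_c` with the exponents of the theorem
and then passes to the completion.

*The norm is finite.* The class `LocReg m` asks for `m` weak derivatives, the two highest orders in
`L²_loc` and the lower ones in `L^∞_loc`. The potential belongs to `LocReg (n - 1)`, and `[A_k, ·]`
maps `LocReg (m + 1)` to `LocReg m`, because in each term of the Leibniz rule at most one factor
fails to be locally bounded (`LocReg.bracket_aux`). Hence a map of class `C^n` has `n` weak covariant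
derivatives, all of them in `L²_loc` (`weakCovJet_spec`).

*The estimate.* Since the inner product is invariant, the bracket drops out of the derivative of
`|Φ|`, and Kato's inequality `|∂|Φ|| ≤ |∇Φ|` holds (`norm_fderiv_regNorm_le`). With it the Sobolev
inequality `‖u‖₆ ≤ C ‖∇u‖₂` and the representation of a function by the integrals of its gradient
along rays become estimates with covariant derivatives, and with constants that do not depend on `A`
(`eLpNorm_six_le`, `ballVolume_mul_enorm_le_rayIntegral`). Mollification extends them to weak
derivatives. The natural length at `x` is `ρ = w(x)^{1-σ} ≤ w(x)`: on the ball of radius `ρ / 4`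
about `x` the weight is comparable to `w(x)`, so the norm controls the scaled `L²` norms of the
derivatives there. For a derivative of order `1 ≤ p ≤ n - 2` a cutoff at this scale gives first
the scaled `L⁶` norms of the derivatives up to order `p + 1`, and then the value at `x`. For `p = 0`
the local `L²` norm of `Φ` is not controlled, and no cutoff is available; instead the whole rays
are used. The part beyond the length `ρ / 8` is estimated by the weighted `L²` norm of `∇Φ`, and
the integral `∫ t^{-1-σ/2} dt` that appears converges at infinity because `σ > 0`
(`lintegral_far_weight_le`).

*The completion.* By the estimate, the covariant derivatives of order at most `n - 2` extend to
`H_n`. A Cauchy sequence converges uniformly together with these derivatives, so the limits are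
the covariant derivatives of a map of class `C^{n-2}`
(`contDiff_and_covDerivs_of_tendstoUniformly`). If this map is zero, then the weighted `L²` limits
of all derivatives up to order `n` are weak covariant derivatives of zero, hence vanish, and the
element of `H_n` is zero (`eq_zero_of_tendsto`).
-/

set_option linter.unusedSectionVars false

namespace CovSobolev

open Filter Topology
open scoped Convolution

variable {𝒢 : Type*} [LieRingWithNorm 𝒢] [CompactLieAlgebra 𝒢]

/-! ### Mollification -/

section Mollify

variable {F : Type*} [NormedAddCommGroup F] [NormedSpace ℝ F]

/-- The mollification `φ * f` of `f` by the normalization of the bump function `φ`. -/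
noncomputable def mollify (φ : ContDiffBump (0 : E3)) (f : E3 → F) : E3 → F :=
  φ.normed volume ⋆[ContinuousLinearMap.lsmul ℝ ℝ, volume] f

lemma mollify_apply (φ : ContDiffBump (0 : E3)) (f : E3 → F) (x : E3) :
    mollify φ f x = ∫ t, φ.normed volume t • f (x - t) := rfl

lemma mollify_apply' (φ : ContDiffBump (0 : E3)) (f : E3 → F) (x : E3) :
    mollify φ f x = ∫ y, φ.normed volume (x - y) • f y :=
  convolution_lsmul_swap

lemma mollify_congr_ae (φ : ContDiffBump (0 : E3)) {f g : E3 → F} (h : f =ᵐ[volume] g) :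
    mollify φ f = mollify φ g :=
  convolution_congr _ EventuallyEq.rfl h

lemma mollify_sub (φ : ContDiffBump (0 : E3)) {f g : E3 → F} (hf : LocallyIntegrable f)
    (hg : LocallyIntegrable g) : mollify φ (f - g) = mollify φ f - mollify φ g := by
  have ex {h : E3 → F} (hh : LocallyIntegrable h) : ∀ x, ConvolutionExistsAt
      (φ.normed volume) h x (ContinuousLinearMap.lsmul ℝ ℝ) volume := fun x =>
    φ.hasCompactSupport_normed.convolutionExists_left _ φ.continuous_normed hh x
  funext x
  simp only [Pi.sub_apply, mollify_apply, smul_sub]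
  exact integral_sub (ex hf x) (ex hg x)

/-- Mollification does not increase the `L^p` norm (Jensen's inequality). -/
lemma eLpNorm_mollify_le (φ : ContDiffBump (0 : E3)) {f : E3 → F} {p : ℝ≥0∞} (hp : 1 ≤ p)
    (hp' : p ≠ ⊤) (hf : AEStronglyMeasurable f) :
    eLpNorm (mollify φ f) p ≤ eLpNorm f p := by
  wlog hm : StronglyMeasurable f generalizing f
  · have := this hf.stronglyMeasurable_mk.aestronglyMeasurable hf.stronglyMeasurable_mk
    rwa [← mollify_congr_ae φ hf.ae_eq_mk, ← eLpNorm_congr_ae hf.ae_eq_mk] at this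
  have hp0 : p ≠ 0 := (zero_lt_one.trans_le hp).ne'
  have hpt : 0 < p.toReal := ENNReal.toReal_pos hp0 hp'
  set ν : Measure E3 := volume.withDensity fun t => ENNReal.ofReal (φ.normed volume t) with hν
  have hd : Measurable fun t => ENNReal.ofReal (φ.normed volume t) :=
    φ.continuous_normed.measurable.ennreal_ofReal
  have hprob : IsProbabilityMeasure ν := by
    constructor
    rw [hν, withDensity_apply _ MeasurableSet.univ, Measure.restrict_univ,
      ← ofReal_integral_eq_lintegral_ofReal φ.integrable_normed
        (Eventually.of_forall φ.nonneg_normed), φ.integral_normed, ENNReal.ofReal_one]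
  have hpt1 (x : E3) : ‖mollify φ f x‖ₑ ^ p.toReal ≤ ∫⁻ t, ‖f (x - t)‖ₑ ^ p.toReal ∂ν := by
    have hmx : StronglyMeasurable fun t => f (x - t) :=
      hm.comp_measurable (measurable_const.sub measurable_id)
    have h1 : ‖mollify φ f x‖ₑ ≤ eLpNorm (fun t => f (x - t)) 1 ν := by
      rw [eLpNorm_one_eq_lintegral_enorm, hν,
        lintegral_withDensity_eq_lintegral_mul _ hd hmx.enorm, mollify_apply]
      refine (enorm_integral_le_lintegral_enorm _).trans (le_of_eq ?_)
      refine lintegral_congr fun t => ?_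
      rw [enorm_smul, Pi.mul_apply, Real.enorm_of_nonneg (φ.nonneg_normed t)]
    have h2 := h1.trans (eLpNorm_le_eLpNorm_of_exponent_le hp hmx.aestronglyMeasurable)
    rw [eLpNorm_eq_lintegral_rpow_enorm_toReal hp0 hp'] at h2
    calc _ ≤ _ := ENNReal.rpow_le_rpow h2 hpt.le
      _ = _ := by rw [← ENNReal.rpow_mul, one_div, inv_mul_cancel₀ hpt.ne', ENNReal.rpow_one]
  rw [eLpNorm_eq_lintegral_rpow_enorm_toReal hp0 hp', eLpNorm_eq_lintegral_rpow_enorm_toReal hp0 hp']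
  refine ENNReal.rpow_le_rpow ?_ (by positivity)
  calc ∫⁻ x, ‖mollify φ f x‖ₑ ^ p.toReal
      ≤ ∫⁻ x, (∫⁻ t, ‖f (x - t)‖ₑ ^ p.toReal ∂ν) ∂volume := lintegral_mono hpt1
    _ = ∫⁻ t, (∫⁻ x, ‖f (x - t)‖ₑ ^ p.toReal ∂volume) ∂ν := by
        refine lintegral_lintegral_swap (Measurable.aemeasurable ?_)
        exact ((hm.comp_measurable (measurable_fst.sub measurable_snd)).enorm).pow_const _
    _ = ∫⁻ _ : E3, (∫⁻ x, ‖f x‖ₑ ^ p.toReal ∂volume) ∂ν := by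
        refine lintegral_congr fun t => ?_
        exact lintegral_sub_right_eq_self (fun x => ‖f x‖ₑ ^ p.toReal) t
    _ = ∫⁻ x, ‖f x‖ₑ ^ p.toReal := by simp

lemma hasCompactSupport_mollify (φ : ContDiffBump (0 : E3)) {f : E3 → F}
    (hf : HasCompactSupport f) : HasCompactSupport (mollify φ f) :=
  φ.hasCompactSupport_normed.convolution (ContinuousLinearMap.lsmul ℝ ℝ) hf

lemma contDiff_mollify (φ : ContDiffBump (0 : E3)) {f : E3 → F} (hf : LocallyIntegrable f) :
    ContDiff ℝ ∞ (mollify φ f) :=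
  φ.hasCompactSupport_normed.contDiff_convolution_left (n := ⊤) _ φ.contDiff_normed hf

lemma support_mollify_subset (φ : ContDiffBump (0 : E3)) {f : E3 → F} {r : ℝ}
    (hr : φ.rOut ≤ r) :
    Function.support (mollify φ f) ⊆ Metric.cthickening r (tsupport f) := by
  intro x hx
  obtain ⟨y, hy, z, hz, rfl⟩ := support_convolution_subset _ hx
  refine Metric.mem_cthickening_of_dist_le _ z _ _ (subset_tsupport _ hz) ?_
  rw [φ.support_normed_eq] at hy
  have : dist y 0 < φ.rOut := hy
  simp only [dist_eq_norm, sub_zero, add_sub_cancel_right] at this ⊢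
  exact this.le.trans hr

/-- The standard mollifiers, supported in the ball of radius `1 / (j + 1)`. -/
noncomputable def stdBump (j : ℕ) : ContDiffBump (0 : E3) where
  rIn := 1 / (2 * ((j : ℝ) + 1))
  rOut := 1 / ((j : ℝ) + 1)
  rIn_pos := by positivity
  rIn_lt_rOut := by
    apply one_div_lt_one_div_of_lt <;> linarith [(Nat.cast_nonneg j : (0 : ℝ) ≤ j)]

lemma tendsto_stdBump_rOut : Tendsto (fun j => (stdBump j).rOut) atTop (𝓝 0) :=
  tendsto_one_div_add_atTop_nhds_zero_nat

lemma stdBump_rOut_le_one (j : ℕ) : (stdBump j).rOut ≤ 1 := by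
  change 1 / ((j : ℝ) + 1) ≤ 1
  rw [div_le_one (by positivity)]
  linarith [(Nat.cast_nonneg j : (0 : ℝ) ≤ j)]

/-- Mollifications of an `L^p` function converge to it in `L^p`, for `p < ∞`. -/
lemma tendsto_eLpNorm_mollify_sub [CompleteSpace F] {f : E3 → F} {p : ℝ≥0∞} (hp : 1 ≤ p)
    (hp' : p ≠ ⊤) (hf : MemLp f p) :
    Tendsto (fun j => eLpNorm (mollify (stdBump j) f - f) p) atTop (𝓝 0) := by
  rw [ENNReal.tendsto_nhds_zero]
  intro ε hε
  obtain ⟨δ, hδ, hδε⟩ : ∃ δ : ℝ≥0∞, 0 < δ ∧ δ + (δ + δ) ≤ ε := by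
    refine ⟨ε / 3, ENNReal.div_pos hε.ne' (by simp), ?_⟩
    rw [← add_assoc, ENNReal.add_thirds]
  obtain ⟨g, gc, hfg, gcont, gm⟩ := hf.exists_hasCompactSupport_eLpNorm_sub_le hp' hδ.ne'
  set K := Metric.cthickening 1 (tsupport g) with hK
  have Kc : IsCompact K := gc.isCompact.cthickening
  have hgu := gcont.uniformContinuous_of_tendsto_cocompact gc.is_zero_at_infty
  obtain ⟨η, hη, hηδ⟩ : ∃ η : ℝ, 0 < η ∧ ENNReal.ofReal η * volume K ^ (1 / p.toReal) ≤ δ := by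
    have h1 : volume K ^ (1 / p.toReal) ≠ ⊤ :=
      ENNReal.rpow_ne_top_of_nonneg (by positivity) Kc.measure_lt_top.ne
    have h2 : Tendsto (fun η : ℝ => ENNReal.ofReal η * volume K ^ (1 / p.toReal)) (𝓝[>] 0)
        (𝓝 (ENNReal.ofReal 0 * volume K ^ (1 / p.toReal))) :=
      ENNReal.Tendsto.mul_const (ENNReal.tendsto_ofReal nhdsWithin_le_nhds) (Or.inr h1)
    rw [ENNReal.ofReal_zero, zero_mul] at h2
    obtain ⟨η, h3, h4⟩ := ((h2.eventually (ge_mem_nhds hδ)).and self_mem_nhdsWithin).exists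
    exact ⟨η, h4, h3⟩
  obtain ⟨r, hr, hru⟩ := Metric.uniformContinuous_iff.mp hgu η hη
  have hfl : LocallyIntegrable f := hf.locallyIntegrable hp
  have hgl : LocallyIntegrable g := gcont.locallyIntegrable
  filter_upwards [tendsto_stdBump_rOut.eventually (gt_mem_nhds hr)] with j hj
  have e1 : mollify (stdBump j) f - f =
      mollify (stdBump j) (f - g) + ((mollify (stdBump j) g - g) - (f - g)) := by
    rw [mollify_sub _ hfl hgl]
    abel
  have mm {h : E3 → F} (hh : LocallyIntegrable h) :
      AEStronglyMeasurable (mollify (stdBump j) h) volume :=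
    (contDiff_mollify _ hh).continuous.aestronglyMeasurable
  have hfgm : AEStronglyMeasurable (f - g) volume := hf.1.sub gcont.aestronglyMeasurable
  rw [e1]
  refine (eLpNorm_add_le (mm (hfl.sub hgl)) (((mm hgl).sub gcont.aestronglyMeasurable).sub hfgm)
    hp).trans (le_trans (add_le_add ?_ ?_) hδε)
  · exact (eLpNorm_mollify_le _ hp hp' hfgm).trans hfg
  · refine (eLpNorm_sub_le ((mm hgl).sub gcont.aestronglyMeasurable) hfgm hp).trans
      (add_le_add ?_ hfg)
    refine (eLpNorm_sub_le_of_dist_bdd volume hp' Kc.measurableSet hη.le (fun x => ?_)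
      (support_mollify_subset _ (stdBump_rOut_le_one j))
      ((subset_tsupport g).trans (Metric.self_subset_cthickening _))).trans hηδ
    refine (stdBump j).dist_normed_convolution_le gcont.aestronglyMeasurable fun y hy => ?_
    exact (hru ((Metric.mem_ball.mp hy).trans hj)).le

end Mollify

instance : FiniteDimensional ℝ 𝒢 := CompactLieAlgebra.finiteDimensional

instance : CompleteSpace 𝒢 := FiniteDimensional.complete ℝ 𝒢

/-- The Lie bracket as a continuous bilinear map. -/
noncomputable def bracketL : 𝒢 →L[ℝ] 𝒢 →L[ℝ] 𝒢 :=
  (LinearMap.mk₂ ℝ (fun X Y : 𝒢 => ⁅X, Y⁆) add_lie smul_lie lie_add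
    (fun c X Y => lie_smul c X Y)).toContinuousBilinearMap

/-! ### Local Lebesgue spaces -/

lemma _root_.Continuous.memLpLoc {f : E3 → 𝒢} (hf : Continuous f) (p : ℝ≥0∞) : MemLpLoc f p := by
  intro K hK
  obtain ⟨C, hC⟩ := hK.exists_bound_of_continuousOn hf.continuousOn
  have : IsFiniteMeasure (volume.restrict K) := ⟨by simpa using hK.measure_lt_top⟩
  refine MemLp.of_bound hf.aestronglyMeasurable C ?_
  exact (ae_restrict_iff' hK.measurableSet).mpr (Eventually.of_forall hC)

lemma MemLpLoc.mono {f : E3 → 𝒢} {p q : ℝ≥0∞} (hf : MemLpLoc f q) (hpq : p ≤ q) :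
    MemLpLoc f p := by
  intro K hK
  have : IsFiniteMeasure (volume.restrict K) := ⟨by simpa using hK.measure_lt_top⟩
  exact (hf K hK).mono_exponent hpq

lemma MemLpLoc.locallyIntegrable {f : E3 → 𝒢} {p : ℝ≥0∞} (hf : MemLpLoc f p) (hp : 1 ≤ p) :
    LocallyIntegrable f := by
  refine locallyIntegrable_iff.mpr fun K hK => ?_
  exact memLp_one_iff_integrable.mp (hf.mono hp K hK)

lemma MemLpLoc.congr_ae {f g : E3 → 𝒢} {p : ℝ≥0∞} (hf : MemLpLoc f p) (h : f =ᵐ[volume] g) :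
    MemLpLoc g p :=
  fun K hK => (hf K hK).ae_eq (ae_restrict_of_ae h)

lemma MemLpLoc.add {f g : E3 → 𝒢} {p : ℝ≥0∞} (hf : MemLpLoc f p) (hg : MemLpLoc g p) :
    MemLpLoc (fun x => f x + g x) p :=
  fun K hK => (hf K hK).add (hg K hK)

lemma MemLpLoc.bracket {f g : E3 → 𝒢} {p q r : ℝ≥0∞} [ENNReal.HolderTriple p q r]
    (hf : MemLpLoc f p) (hg : MemLpLoc g q) : MemLpLoc (fun x => ⁅f x, g x⁆) r :=
  fun K hK => bracketL.memLp_of_bilin r (hf K hK) (hg K hK)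

lemma MemLpLoc.memLp_smul {f : E3 → 𝒢} {p : ℝ≥0∞} (hf : MemLpLoc f p) {χ : E3 → ℝ}
    (hχ : Continuous χ) (hc : HasCompactSupport χ) : MemLp (fun x => χ x • f x) p := by
  have h1 : MemLp (fun x => χ x • f x) p (volume.restrict (tsupport χ)) := by
    have := (hf _ hc).smul (p := ⊤) (r := p)
      (hχ.memLp_of_hasCompactSupport hc (p := ⊤) (μ := volume.restrict (tsupport χ)))
    exact this
  have h2 := (memLp_indicator_iff_restrict (isClosed_tsupport χ).measurableSet).mpr h1
  have h3 : (tsupport χ).indicator (fun x => χ x • f x) = fun x => χ x • f x :=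
    Set.indicator_eq_self.mpr fun x hx => subset_tsupport χ fun h0 => hx (by simp [h0])
  rwa [h3] at h2

/-! ### Calculus of weak derivatives -/

lemma IsWeakDeriv.congr_ae {k : Fin 3} {f f' g g' : E3 → 𝒢} (h : IsWeakDeriv k f g)
    (hf : f =ᵐ[volume] f') (hg : g =ᵐ[volume] g') : IsWeakDeriv k f' g' where
  locallyIntegrable := h.1.congr hf
  locallyIntegrable_deriv := h.2.congr hg
  integral_eq φ h1 h2 := by
    have e1 : ∫ x, fderiv ℝ φ x (unitVec k) • f x = ∫ x, fderiv ℝ φ x (unitVec k) • f' x :=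
      integral_congr_ae (hf.mono fun x hx => by simp only [hx])
    have e2 : ∫ x, φ x • g x = ∫ x, φ x • g' x :=
      integral_congr_ae (hg.mono fun x hx => by simp only [hx])
    rw [← e1, ← e2, h.3 φ h1 h2]

lemma continuous_fderiv_apply {F : Type*} [NormedAddCommGroup F] [NormedSpace ℝ F] {f : E3 → F}
    (hf : ContDiff ℝ 1 f) (v : E3) : Continuous fun x => fderiv ℝ f x v :=
  (hf.continuous_fderiv (by simp)).clm_apply continuous_const

/-- Classical derivatives are weak derivatives. -/
lemma isWeakDeriv_of_contDiff {f : E3 → 𝒢} (hf : ContDiff ℝ 1 f) (k : Fin 3) :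
    IsWeakDeriv k f fun x => fderiv ℝ f x (unitVec k) where
  locallyIntegrable := hf.continuous.locallyIntegrable
  locallyIntegrable_deriv := (continuous_fderiv_apply hf _).locallyIntegrable
  integral_eq φ h1 h2 := by
    have i1 := hf.continuous.locallyIntegrable.integrable_smul_left_of_hasCompactSupport
      (μ := volume) (continuous_fderiv_apply (h1.of_le (by simp)) (unitVec k)) (h2.fderiv_apply ℝ _)
    have i2 := (continuous_fderiv_apply hf (unitVec k)).locallyIntegrable
      |>.integrable_smul_left_of_hasCompactSupport (μ := volume) h1.continuous h2
    have i3 := hf.continuous.locallyIntegrable.integrable_smul_left_of_hasCompactSupport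
      (μ := volume) h1.continuous h2
    rw [integral_smul_fderiv_eq_neg_fderiv_smul_of_integrable i1 i2 i3
      (fun x _ => (h1.differentiable (by simp)).differentiableAt)
      (fun x _ => (hf.differentiable (by simp)).differentiableAt), neg_neg]

lemma locallyIntegrable_smul {χ : E3 → ℝ} (hχ : Continuous χ) {f : E3 → 𝒢}
    (hf : LocallyIntegrable f) : LocallyIntegrable fun x => χ x • f x :=
  locallyIntegrableOn_univ.mp
    ((locallyIntegrableOn_univ.mpr hf).continuousOn_smul isOpen_univ.isLocallyClosed hχ.continuousOn)

/-- The Leibniz rule for the product with a smooth scalar function. -/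
lemma IsWeakDeriv.smooth_smul {k : Fin 3} {f g : E3 → 𝒢} (h : IsWeakDeriv k f g) {χ : E3 → ℝ}
    (hχ : ContDiff ℝ ∞ χ) :
    IsWeakDeriv k (fun x => χ x • f x)
      (fun x => χ x • g x + fderiv ℝ χ x (unitVec k) • f x) := by
  have hd : Continuous fun x => fderiv ℝ χ x (unitVec k) :=
    continuous_fderiv_apply (hχ.of_le (by simp)) _
  refine ⟨locallyIntegrable_smul hχ.continuous h.1,
    (locallyIntegrable_smul hχ.continuous h.2).add (locallyIntegrable_smul hd h.1),
    fun φ h1 h2 => ?_⟩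
  have hφd : Continuous fun x => fderiv ℝ φ x (unitVec k) :=
    continuous_fderiv_apply (h1.of_le (by simp)) _
  have key := h.3 (fun x => χ x * φ x) (hχ.mul h1) h2.mul_left
  have hf' (x : E3) : fderiv ℝ (fun x => χ x * φ x) x (unitVec k) =
      χ x * fderiv ℝ φ x (unitVec k) + fderiv ℝ χ x (unitVec k) * φ x := by
    rw [fderiv_fun_mul (hχ.differentiable (by simp) x) (h1.differentiable (by simp) x)]
    simp [mul_comm]
  have i1 : Integrable fun x => (χ x * fderiv ℝ φ x (unitVec k)) • f x :=
    h.1.integrable_smul_left_of_hasCompactSupport (hχ.continuous.mul hφd)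
      (h2.fderiv_apply ℝ _).mul_left
  have i2 : Integrable fun x => (fderiv ℝ χ x (unitVec k) * φ x) • f x :=
    h.1.integrable_smul_left_of_hasCompactSupport (hd.mul h1.continuous) h2.mul_left
  have i3 : Integrable fun x => (χ x * φ x) • g x :=
    h.2.integrable_smul_left_of_hasCompactSupport (hχ.continuous.mul h1.continuous) h2.mul_left
  simp only [hf', add_smul] at key
  rw [integral_add i1 i2] at key
  have e1 : ∫ x, fderiv ℝ φ x (unitVec k) • χ x • f x =
      ∫ x, (χ x * fderiv ℝ φ x (unitVec k)) • f x :=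
    integral_congr_ae (Eventually.of_forall fun x => by
      change _ • _ • _ = _
      rw [smul_smul, mul_comm])
  have e2 : ∫ x, φ x • (χ x • g x + fderiv ℝ χ x (unitVec k) • f x) =
      ∫ x, ((χ x * φ x) • g x + (fderiv ℝ χ x (unitVec k) * φ x) • f x) :=
    integral_congr_ae (Eventually.of_forall fun x => by
      change φ x • (_ + _) = _ • _ + _ • _
      rw [smul_add, smul_smul, smul_smul, mul_comm, mul_comm (φ x)])
  rw [e1, e2, integral_add i3 i2, eq_sub_of_add_eq key]
  abel

lemma tendsto_integral_smul_of_eLpNorm {ψ : E3 → ℝ} (hψ : Continuous ψ)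
    (hc : HasCompactSupport ψ) {u : ℕ → E3 → 𝒢} {v : E3 → 𝒢} (hu : ∀ j, LocallyIntegrable (u j))
    (hv : LocallyIntegrable v)
    (h : Tendsto (fun j => eLpNorm (u j - v) 1 (volume.restrict (tsupport ψ))) atTop (𝓝 0)) :
    Tendsto (fun j => ∫ x, ψ x • u j x) atTop (𝓝 (∫ x, ψ x • v x)) := by
  obtain ⟨C, hC⟩ := hc.exists_bound_of_continuous hψ
  refine tendsto_integral_of_L1 _ (hv.integrable_smul_left_of_hasCompactSupport hψ hc).1
    (Eventually.of_forall fun j => (hu j).integrable_smul_left_of_hasCompactSupport hψ hc) ?_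
  have h2 := ENNReal.Tendsto.const_mul h (Or.inr (ENNReal.ofReal_ne_top (r := C)))
  rw [mul_zero] at h2
  refine tendsto_of_tendsto_of_tendsto_of_le_of_le tendsto_const_nhds h2 (fun _ => zero_le)
    fun j => ?_
  simp only [eLpNorm_one_eq_lintegral_enorm]
  rw [← lintegral_const_mul' _ _ ENNReal.ofReal_ne_top]
  have hs : (fun x => ‖ψ x • u j x - ψ x • v x‖ₑ) =
      (tsupport ψ).indicator fun x => ‖ψ x • u j x - ψ x • v x‖ₑ :=
    (Set.indicator_eq_self.mpr fun x hx => subset_tsupport ψ fun h0 => hx (by simp [h0])).symm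
  rw [hs, lintegral_indicator (isClosed_tsupport ψ).measurableSet]
  refine lintegral_mono fun x => ?_
  rw [← smul_sub, enorm_smul, Pi.sub_apply]
  gcongr
  rw [← ofReal_norm]
  exact ENNReal.ofReal_le_ofReal (hC x)

/-- Weak derivatives are stable under convergence in `L¹_loc`. -/
lemma isWeakDeriv_of_tendsto {k : Fin 3} {u v : ℕ → E3 → 𝒢} {f g : E3 → 𝒢}
    (h : ∀ j, IsWeakDeriv k (u j) (v j)) (hf : LocallyIntegrable f) (hg : LocallyIntegrable g)
    (hu : ∀ K : Set E3, IsCompact K →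
      Tendsto (fun j => eLpNorm (u j - f) 1 (volume.restrict K)) atTop (𝓝 0))
    (hv : ∀ K : Set E3, IsCompact K →
      Tendsto (fun j => eLpNorm (v j - g) 1 (volume.restrict K)) atTop (𝓝 0)) :
    IsWeakDeriv k f g := by
  refine ⟨hf, hg, fun φ h1 h2 => ?_⟩
  have h3 : HasCompactSupport fun x => fderiv ℝ φ x (unitVec k) := h2.fderiv_apply ℝ _
  have t1 := tendsto_integral_smul_of_eLpNorm
    (continuous_fderiv_apply (h1.of_le (by simp)) (unitVec k)) h3
    (fun j => (h j).1) hf (hu _ h3)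
  have t2 := (tendsto_integral_smul_of_eLpNorm h1.continuous h2 (fun j => (h j).2) hg
    (hv _ h2)).neg
  refine tendsto_nhds_unique t1 (t2.congr fun j => ?_)
  rw [(h j).3 φ h1 h2]

lemma tendsto_eLpNorm_restrict {u : ℕ → E3 → 𝒢} {p : ℝ≥0∞}
    (h : Tendsto (fun j => eLpNorm (u j) p) atTop (𝓝 0)) (K : Set E3) :
    Tendsto (fun j => eLpNorm (u j) p (volume.restrict K)) atTop (𝓝 0) :=
  tendsto_of_tendsto_of_tendsto_of_le_of_le tendsto_const_nhds h (fun _ => zero_le)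
    fun _ => eLpNorm_mono_measure _ Measure.restrict_le_self

/-- The derivative of a mollification is the mollification of the weak derivative. -/
lemma IsWeakDeriv.fderiv_mollify {k : Fin 3} {f g : E3 → 𝒢} (h : IsWeakDeriv k f g)
    (φ : ContDiffBump (0 : E3)) (x : E3) :
    fderiv ℝ (mollify φ f) x (unitVec k) = mollify φ g x := by
  have hφ : ContDiff ℝ ∞ (φ.normed volume) := φ.contDiff_normed
  have h1 := φ.hasCompactSupport_normed.hasFDerivAt_convolution_left (μ := volume)
    (ContinuousLinearMap.lsmul ℝ ℝ) (hφ.of_le (by simp)) h.1 x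
  have h2 : fderiv ℝ (mollify φ f) x (unitVec k) =
      ∫ t, fderiv ℝ (φ.normed volume) t (unitVec k) • f (x - t) := by
    rw [show fderiv ℝ (mollify φ f) x = _ from h1.fderiv, convolution_def,
      ContinuousLinearMap.integral_apply]
    · rfl
    · exact (φ.hasCompactSupport_normed.fderiv ℝ).convolutionExists_left _
        (hφ.continuous_fderiv (by simp)) h.1 x
  have h3 : ∫ t, fderiv ℝ (φ.normed volume) t (unitVec k) • f (x - t) =
      ∫ y, fderiv ℝ (φ.normed volume) (x - y) (unitVec k) • f y := by
    rw [← integral_sub_left_eq_self _ volume x]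
    simp
  have h4 := h.3 (fun y => φ.normed volume (x - y)) (hφ.comp (contDiff_const.sub contDiff_id))
    (φ.hasCompactSupport_normed.comp_homeomorph (Homeomorph.subLeft x))
  have h5 (y : E3) : fderiv ℝ (fun y => φ.normed volume (x - y)) y (unitVec k) =
      - fderiv ℝ (φ.normed volume) (x - y) (unitVec k) := by
    have := ((hφ.differentiable (by simp)) (x - y)).hasFDerivAt.comp y
      ((hasFDerivAt_const x y).sub (hasFDerivAt_id y))
    rw [show fderiv ℝ (fun y => φ.normed volume (x - y)) y = _ from this.fderiv]
    simp
  simp only [h5, neg_smul, integral_neg, neg_inj] at h4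
  rw [h2, h3, h4, mollify_apply']

/-- A weak derivative vanishes on every open set on which the function vanishes. -/
lemma IsWeakDeriv.ae_eq_zero {k : Fin 3} {f g : E3 → 𝒢} (h : IsWeakDeriv k f g) {U : Set E3}
    (hU : IsOpen U) (hf : ∀ᵐ x, x ∈ U → f x = 0) : ∀ᵐ x, x ∈ U → g x = 0 := by
  refine hU.ae_eq_zero_of_integral_contDiff_smul_eq_zero (h.2.locallyIntegrableOn U)
    fun φ h1 h2 h3 => ?_
  have e := h.3 φ h1 h2
  have z : ∫ x, fderiv ℝ φ x (unitVec k) • f x = 0 := by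
    refine integral_eq_zero_of_ae (hf.mono fun x hx => ?_)
    by_cases hxU : x ∈ U
    · simp [hx hxU]
    · have : fderiv ℝ φ x = 0 := by
        by_contra h0
        exact hxU (h3 (support_fderiv_subset ℝ h0))
      simp [this]
  rw [z, eq_comm, neg_eq_zero] at e
  exact e

/-! ### The Leibniz rule for the bracket -/

lemma exists_eLpNorm_bracket_le : ∃ c : ℝ≥0, ∀ a b : E3 → 𝒢, MemLp a 2 → MemLp b 2 →
    eLpNorm (fun x => ⁅a x, b x⁆) 1 ≤ c * eLpNorm a 2 * eLpNorm b 2 := by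
  refine ⟨‖(bracketL : 𝒢 →L[ℝ] 𝒢 →L[ℝ] 𝒢)‖₊, fun a b ha hb => ?_⟩
  have h : ∀ᵐ x : E3, ‖bracketL (a x) (b x)‖₊ ≤ ‖(bracketL : 𝒢 →L[ℝ] 𝒢 →L[ℝ] 𝒢)‖₊ * ‖a x‖₊ * ‖b x‖₊ :=
    Eventually.of_forall fun x => bracketL.le_opNorm₂ (a x) (b x)
  exact eLpNorm_le_eLpNorm_mul_eLpNorm_of_nnnorm ha.1 hb.1 (fun X Y => bracketL X Y) _ h

lemma tendsto_eLpNorm_bracket_sub {u v : ℕ → E3 → 𝒢} {f g : E3 → 𝒢} (hu : ∀ j, MemLp (u j) 2)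
    (hv : ∀ j, MemLp (v j) 2) (hf : MemLp f 2) (hg : MemLp g 2)
    (huf : Tendsto (fun j => eLpNorm (u j - f) 2) atTop (𝓝 0))
    (hvg : Tendsto (fun j => eLpNorm (v j - g) 2) atTop (𝓝 0)) :
    Tendsto (fun j => eLpNorm ((fun x => ⁅u j x, v j x⁆) - fun x => ⁅f x, g x⁆) 1)
      atTop (𝓝 0) := by
  obtain ⟨c, holder⟩ := exists_eLpNorm_bracket_le (𝒢 := 𝒢)
  have hbound (j : ℕ) : eLpNorm ((fun x => ⁅u j x, v j x⁆) - fun x => ⁅f x, g x⁆) 1 ≤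
      c * eLpNorm (u j - f) 2 * (eLpNorm (v j - g) 2 + eLpNorm g 2) +
        c * eLpNorm f 2 * eLpNorm (v j - g) 2 := by
    have e : ((fun x => ⁅u j x, v j x⁆) - fun x => ⁅f x, g x⁆) =
        (fun x => ⁅(u j - f) x, v j x⁆) + fun x => ⁅f x, (v j - g) x⁆ := by
      funext x
      simp
    have m1 : MemLp (fun x => ⁅(u j - f) x, v j x⁆) 1 :=
      bracketL.memLp_of_bilin 1 ((hu j).sub hf) (hv j)
    have m2 : MemLp (fun x => ⁅f x, (v j - g) x⁆) 1 :=
      bracketL.memLp_of_bilin 1 hf ((hv j).sub hg)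
    rw [e]
    refine (eLpNorm_add_le m1.1 m2.1 le_rfl).trans
      (add_le_add ((holder _ _ ((hu j).sub hf) (hv j)).trans ?_) (holder _ _ hf ((hv j).sub hg)))
    gcongr
    have h2 := eLpNorm_add_le (p := 2) ((hv j).sub hg).1 hg.1 (by norm_num)
    rwa [sub_add_cancel] at h2
  refine tendsto_of_tendsto_of_tendsto_of_le_of_le tendsto_const_nhds ?_ (fun _ => zero_le) hbound
  have t1 : Tendsto (fun j => c * eLpNorm (u j - f) 2) atTop (𝓝 0) := by
    simpa using ENNReal.Tendsto.const_mul huf (Or.inr (ENNReal.coe_ne_top (r := c)))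
  have t2 : Tendsto (fun j => eLpNorm (v j - g) 2 + eLpNorm g 2) atTop (𝓝 (0 + eLpNorm g 2)) :=
    hvg.add tendsto_const_nhds
  have t3 := ENNReal.Tendsto.mul t1 (Or.inr (by simpa using hg.eLpNorm_ne_top)) t2
    (Or.inr ENNReal.zero_ne_top)
  have t4 : Tendsto (fun j => c * eLpNorm f 2 * eLpNorm (v j - g) 2) atTop (𝓝 0) := by
    simpa using ENNReal.Tendsto.const_mul hvg
      (Or.inr (ENNReal.mul_ne_top (ENNReal.coe_ne_top (r := c)) hf.eLpNorm_ne_top))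
  simpa using t3.add t4

lemma memLp_mollify (φ : ContDiffBump (0 : E3)) {f : E3 → 𝒢} {p : ℝ≥0∞} (hp : 1 ≤ p)
    (hp' : p ≠ ⊤) (hf : MemLp f p) : MemLp (mollify φ f) p :=
  ⟨(contDiff_mollify φ (hf.locallyIntegrable hp)).continuous.aestronglyMeasurable,
    (eLpNorm_mollify_le φ hp hp' hf.1).trans_lt hf.2⟩

lemma IsWeakDeriv.bracket_of_memLp {k : Fin 3} {a a' f f' : E3 → 𝒢} (ha : IsWeakDeriv k a a')
    (hf : IsWeakDeriv k f f') (ha2 : MemLp a 2) (ha2' : MemLp a' 2) (hf2 : MemLp f 2)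
    (hf2' : MemLp f' 2) :
    IsWeakDeriv k (fun x => ⁅a x, f x⁆) (fun x => ⁅a' x, f x⁆ + ⁅a x, f' x⁆) := by
  have one2 : (1 : ℝ≥0∞) ≤ 2 := by norm_num
  have li {b g : E3 → 𝒢} (hb : MemLp b 2) (hg : MemLp g 2) :
      Integrable fun x => ⁅b x, g x⁆ :=
    memLp_one_iff_integrable.mp (bracketL.memLp_of_bilin 1 hb hg)
  have sm {h : E3 → 𝒢} (hh : MemLp h 2) (j : ℕ) : ContDiff ℝ ∞ (mollify (stdBump j) h) :=
    contDiff_mollify _ (hh.locallyIntegrable one2)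
  have mm {h : E3 → 𝒢} (hh : MemLp h 2) (j : ℕ) : MemLp (mollify (stdBump j) h) 2 :=
    memLp_mollify _ one2 (by norm_num) hh
  have tt {h : E3 → 𝒢} (hh : MemLp h 2) :
      Tendsto (fun j => eLpNorm (mollify (stdBump j) h - h) 2) atTop (𝓝 0) :=
    tendsto_eLpNorm_mollify_sub one2 (by norm_num) hh
  refine isWeakDeriv_of_tendsto
    (u := fun j x => ⁅mollify (stdBump j) a x, mollify (stdBump j) f x⁆)
    (v := fun j x => ⁅mollify (stdBump j) a' x, mollify (stdBump j) f x⁆ +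
      ⁅mollify (stdBump j) a x, mollify (stdBump j) f' x⁆) (fun j => ?_)
    (li ha2 hf2).locallyIntegrable ((li ha2' hf2).add (li ha2 hf2')).locallyIntegrable
    (fun K _ => tendsto_eLpNorm_restrict
      (tendsto_eLpNorm_bracket_sub (mm ha2) (mm hf2) ha2 hf2 (tt ha2) (tt hf2)) K)
    (fun K _ => tendsto_eLpNorm_restrict ?_ K)
  · have hd : ContDiff ℝ 1 fun x => bracketL (mollify (stdBump j) a x) (mollify (stdBump j) f x) :=
      (bracketL.isBoundedBilinearMap.contDiff.comp ((sm ha2 j).prodMk (sm hf2 j))).of_le (by simp)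
    refine (isWeakDeriv_of_contDiff hd k).congr_ae EventuallyEq.rfl
      (Eventually.of_forall fun x => ?_)
    change fderiv ℝ (fun x => bracketL (mollify (stdBump j) a x) (mollify (stdBump j) f x)) x
      (unitVec k) = _
    rw [bracketL.fderiv_of_bilinear ((sm ha2 j).differentiable (by simp) x)
      ((sm hf2 j).differentiable (by simp) x)]
    change ⁅mollify (stdBump j) a x, fderiv ℝ (mollify (stdBump j) f) x (unitVec k)⁆ +
      ⁅fderiv ℝ (mollify (stdBump j) a) x (unitVec k), mollify (stdBump j) f x⁆ = _
    rw [ha.fderiv_mollify, hf.fderiv_mollify, add_comm]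
  · have t := (tendsto_eLpNorm_bracket_sub (mm ha2') (mm hf2) ha2' hf2 (tt ha2') (tt hf2)).add
      (tendsto_eLpNorm_bracket_sub (mm ha2) (mm hf2') ha2 hf2' (tt ha2) (tt hf2'))
    rw [add_zero] at t
    refine tendsto_of_tendsto_of_tendsto_of_le_of_le tendsto_const_nhds t (fun _ => zero_le)
      fun j => ?_
    refine le_trans (le_of_eq ?_) (eLpNorm_add_le
      ((li (mm ha2' j) (mm hf2 j)).1.sub (li ha2' hf2).1)
      ((li (mm ha2 j) (mm hf2' j)).1.sub (li ha2 hf2').1) le_rfl)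
    congr 1
    funext x
    simp only [Pi.sub_apply, Pi.add_apply]
    abel

/-- A smooth cutoff function equal to one near a given compact set. -/
lemma exists_cutoff {K : Set E3} (hK : IsCompact K) : ∃ χ : E3 → ℝ, ContDiff ℝ ∞ χ ∧
    HasCompactSupport χ ∧ (∀ x ∈ K, χ x = 1) ∧ ∀ x ∈ K, fderiv ℝ χ x = 0 := by
  obtain ⟨R, hR, hKR⟩ := hK.isBounded.subset_ball_lt 0 0
  let χ : ContDiffBump (0 : E3) := ⟨R, R + 1, hR, by linarith⟩
  have h1 (x : E3) (hx : x ∈ Metric.ball (0 : E3) R) : χ x = 1 :=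
    χ.one_of_mem_closedBall (Metric.ball_subset_closedBall hx)
  refine ⟨χ, χ.contDiff, χ.hasCompactSupport, fun x hx => h1 x (hKR hx), fun x hx => ?_⟩
  have : (χ : E3 → ℝ) =ᶠ[𝓝 x] fun _ => 1 :=
    eventually_of_mem (Metric.isOpen_ball.mem_nhds (hKR hx)) h1
  rw [this.fderiv_eq]
  simp

/-- The Leibniz rule for the bracket of two maps that are locally in `W^{1,2}`. -/
lemma IsWeakDeriv.bracket {k : Fin 3} {a a' f f' : E3 → 𝒢} (ha : IsWeakDeriv k a a')
    (hf : IsWeakDeriv k f f') (ha2 : MemLpLoc a 2) (ha2' : MemLpLoc a' 2) (hf2 : MemLpLoc f 2)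
    (hf2' : MemLpLoc f' 2) :
    IsWeakDeriv k (fun x => ⁅a x, f x⁆) (fun x => ⁅a' x, f x⁆ + ⁅a x, f' x⁆) := by
  have li {b g : E3 → 𝒢} (hb : MemLpLoc b 2) (hg : MemLpLoc g 2) :
      LocallyIntegrable fun x => ⁅b x, g x⁆ :=
    (hb.bracket (r := 1) hg).locallyIntegrable le_rfl
  refine ⟨li ha2 hf2, (li ha2' hf2).add (li ha2 hf2'), fun φ h1 h2 => ?_⟩
  obtain ⟨χ, χs, χc, χ1, χ0⟩ := exists_cutoff (K := tsupport φ) h2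
  have hd : Continuous fun x => fderiv ℝ χ x (unitVec k) :=
    continuous_fderiv_apply (χs.of_le (by simp)) _
  have hdc : HasCompactSupport fun x => fderiv ℝ χ x (unitVec k) := χc.fderiv_apply ℝ _
  have key := ((ha.smooth_smul χs).bracket_of_memLp (hf.smooth_smul χs)
    (ha2.memLp_smul χs.continuous χc)
    ((ha2'.memLp_smul χs.continuous χc).add (ha2.memLp_smul hd hdc))
    (hf2.memLp_smul χs.continuous χc)
    ((hf2'.memLp_smul χs.continuous χc).add (hf2.memLp_smul hd hdc))).3 φ h1 h2
  have off (x : E3) (hx : x ∉ tsupport φ) : φ x = 0 ∧ fderiv ℝ φ x = 0 :=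
    ⟨image_eq_zero_of_notMem_tsupport hx, by
      by_contra h0
      exact hx (support_fderiv_subset ℝ h0)⟩
  convert key using 1
  · refine integral_congr_ae (Eventually.of_forall fun x => ?_)
    by_cases hx : x ∈ tsupport φ
    · simp [χ1 x hx]
    · simp [(off x hx).2]
  · congr 1
    refine integral_congr_ae (Eventually.of_forall fun x => ?_)
    by_cases hx : x ∈ tsupport φ
    · simp [χ1 x hx, χ0 x hx]
    · simp [(off x hx).1]

/-! ### A scale of local regularity classes -/

/-- `LocReg m f`: the map `f` has `m` weak derivatives, those of order `m` and `m - 1` lie in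
`L²_loc`, and those of order at most `m - 2` in `L^∞_loc`. Unlike continuity of the lower order
derivatives, this does not depend on the representative of `f`. -/
def LocReg : ℕ → (E3 → 𝒢) → Prop
  | 0, f => MemLpLoc f 2
  | m + 1, f => MemLpLoc f (if m = 0 then 2 else ⊤) ∧
      ∀ k, ∃ g, IsWeakDeriv k f g ∧ LocReg m g

lemma LocReg.two {m : ℕ} {f : E3 → 𝒢} (hf : LocReg m f) : MemLpLoc f 2 := by
  cases m with
  | zero => exact hf
  | succ m => exact hf.1.mono (by split_ifs <;> simp)

lemma LocReg.top {m : ℕ} {f : E3 → 𝒢} (hf : LocReg (m + 2) f) : MemLpLoc f ⊤ := by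
  simpa using hf.1

lemma LocReg.of_succ {m : ℕ} {f : E3 → 𝒢} (hf : LocReg (m + 1) f) : LocReg m f := by
  induction m generalizing f with
  | zero => exact hf.two
  | succ m ih =>
    refine ⟨hf.top.mono le_top, fun k => ?_⟩
    obtain ⟨g, hg, hg'⟩ := hf.2 k
    exact ⟨g, hg, ih hg'⟩

lemma LocReg.mono {m n : ℕ} {f : E3 → 𝒢} (hf : LocReg n f) (h : m ≤ n) : LocReg m f := by
  induction n, h using Nat.le_induction with
  | base => exact hf
  | succ n _ ih => exact ih hf.of_succ

lemma LocReg.congr_ae {m : ℕ} {f g : E3 → 𝒢} (hf : LocReg m f) (h : f =ᵐ[volume] g) :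
    LocReg m g := by
  cases m with
  | zero => exact MemLpLoc.congr_ae hf h
  | succ m =>
    refine ⟨hf.1.congr_ae h, fun k => ?_⟩
    obtain ⟨d, hd, hd'⟩ := hf.2 k
    exact ⟨d, hd.congr_ae h EventuallyEq.rfl, hd'⟩

lemma LocReg.add {m : ℕ} {f g : E3 → 𝒢} (hf : LocReg m f) (hg : LocReg m g) :
    LocReg m (fun x => f x + g x) := by
  induction m generalizing f g with
  | zero => exact MemLpLoc.add hf hg
  | succ m ih =>
    refine ⟨hf.1.add hg.1, fun k => ?_⟩
    obtain ⟨d, hd, hd'⟩ := hf.2 k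
    obtain ⟨e, he, he'⟩ := hg.2 k
    exact ⟨_, hd.add he, ih hd' he'⟩

/-- The bracket with a map one order less regular. In every term of the Leibniz rule at most one
factor fails to be locally bounded. -/
lemma LocReg.bracket_aux (m : ℕ) {a f : E3 → 𝒢} :
    (MemLpLoc a ⊤ → LocReg m a → LocReg (m + 1) f → LocReg m fun x => ⁅a x, f x⁆) ∧
    (LocReg m a → LocReg (m + 2) f → LocReg m fun x => ⁅a x, f x⁆) := by
  induction m generalizing a f with
  | zero => exact ⟨fun h1 _ h3 => h1.bracket (r := 2) h3.two, fun h1 h2 => h1.bracket h2.top⟩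
  | succ m ih =>
    have first (h1 : MemLpLoc a ⊤) (h2 : LocReg (m + 1) a) (h3 : LocReg (m + 2) f) :
        LocReg (m + 1) fun x => ⁅a x, f x⁆ := by
      refine ⟨(h1.bracket (r := ⊤) h3.top).mono le_top, fun k => ?_⟩
      obtain ⟨a', ha, ha'⟩ := h2.2 k
      obtain ⟨f', hf, hf'⟩ := h3.2 k
      exact ⟨_, ha.bracket hf h2.two ha'.two h3.two hf'.two,
        (ih.2 ha' h3).add (ih.1 h1 h2.of_succ hf')⟩
    refine ⟨first, fun h1 h2 => ?_⟩
    cases m with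
    | zero =>
      refine ⟨by simpa using h1.two.bracket (q := ⊤) (r := 2) h2.top, fun k => ?_⟩
      obtain ⟨a', ha, ha'⟩ := h1.2 k
      obtain ⟨f', hf, hf'⟩ := h2.2 k
      exact ⟨_, ha.bracket hf h1.two ha'.two h2.two hf'.two,
        (ih.2 ha' h2.of_succ).add (h1.two.bracket (q := ⊤) hf'.top)⟩
    | succ m => exact first h1.top h1 h2.of_succ

lemma LocReg.bracket {m : ℕ} {a f : E3 → 𝒢} (h1 : MemLpLoc a ⊤) (h2 : LocReg m a)
    (h3 : LocReg (m + 1) f) : LocReg m fun x => ⁅a x, f x⁆ :=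
  (LocReg.bracket_aux m).1 h1 h2 h3

lemma contDiff_fderiv_apply {m : ℕ} {f : E3 → 𝒢} (hf : ContDiff ℝ (m + 1 : ℕ) f) (v : E3) :
    ContDiff ℝ m fun x => fderiv ℝ f x v :=
  (hf.fderiv_right (m := m) (by simp)).clm_apply contDiff_const

lemma locReg_of_contDiff {m : ℕ} {f : E3 → 𝒢} (hf : ContDiff ℝ m f) : LocReg m f := by
  induction m generalizing f with
  | zero => exact hf.continuous.memLpLoc 2
  | succ m ih =>
    exact ⟨hf.continuous.memLpLoc _, fun k => ⟨_, isWeakDeriv_of_contDiff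
      (hf.of_le (by exact_mod_cast Nat.le_add_left 1 m)) k, ih (contDiff_fderiv_apply hf _)⟩⟩

lemma locReg_of_isWeakJet {m : ℕ} {f : E3 → 𝒢} (hf : ContDiff ℝ m f)
    {D : List (Fin 3) → E3 → 𝒢} (hD : IsWeakJet (m + 2) f D)
    (h1 : ∀ α : List (Fin 3), α.length = m + 1 → MemLpLoc (D α) 2)
    (h2 : ∀ α : List (Fin 3), α.length = m + 2 → MemLpLoc (D α) 2) : LocReg (m + 2) f := by
  induction m generalizing f D with
  | zero =>
    have hD0 := hD.nil
    refine ⟨hf.continuous.memLpLoc _, fun k => ⟨D [k], ?_, h1 _ rfl, fun l => ⟨D [l, k], ?_, h2 _ rfl⟩⟩⟩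
    · simpa [hD.nil] using hD.cons k [] (by simp)
    · exact hD.cons l [k] (by simp)
  | succ m ih =>
    refine ⟨hf.continuous.memLpLoc _, fun k => ?_⟩
    have w := isWeakDeriv_of_contDiff (hf.of_le (by exact_mod_cast Nat.le_add_left 1 m)) k
    refine ⟨_, w, ih (D := fun α => if α = [] then fun x => fderiv ℝ f x (unitVec k)
      else D (α ++ [k])) (contDiff_fderiv_apply hf _) ⟨rfl, fun l α hα => ?_⟩
      (fun α hα => ?_) (fun α hα => ?_)⟩
    · have hc := hD.cons l (α ++ [k]) (by simpa using hα)
      by_cases h0 : α = []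
      · subst h0
        have w' := hD.cons k [] (by simp)
        rw [hD.nil] at w'
        exact hc.congr_ae (w'.ae_eq w EventuallyEq.rfl) EventuallyEq.rfl
      · simpa [h0] using hc
    · have h0 : α ≠ [] := by rintro rfl; simp at hα
      simpa [h0] using h1 (α ++ [k]) (by simpa using hα)
    · have h0 : α ≠ [] := by rintro rfl; simp at hα
      simpa [h0] using h2 (α ++ [k]) (by simpa using hα)

lemma IsWeakJet.ae_eq {m : ℕ} {f : E3 → 𝒢} {D D' : List (Fin 3) → E3 → 𝒢}
    (h : IsWeakJet m f D) {m' : ℕ} (h' : IsWeakJet m' f D') :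
    ∀ α : List (Fin 3), α.length ≤ m → α.length ≤ m' → D α =ᵐ[volume] D' α := by
  intro α
  induction α with
  | nil => intro _ _; rw [h.nil, h'.nil]
  | cons k α ih =>
    intro h1 h2
    simp only [List.length_cons] at h1 h2
    exact (h.cons k α h1).ae_eq (h'.cons k α h2) (ih (by omega) (by omega))

lemma LocalAssumptions.continuous {A : Fin 3 → E3 → 𝒢} {n : ℕ} (hn : 2 ≤ n)
    (hA : LocalAssumptions A n) (k : Fin 3) : Continuous (A k) := by
  rcases hn.eq_or_lt with h | h
  · exact (hA.1 h.symm).potential k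
  · exact ((hA.2 h).potential k).continuous

lemma LocalAssumptions.contDiff {A : Fin 3 → E3 → 𝒢} {n : ℕ} (hn : 2 ≤ n)
    (hA : LocalAssumptions A n) (k : Fin 3) : ContDiff ℝ (n - 3 : ℕ) (A k) := by
  rcases hn.eq_or_lt with h | h
  · subst h
    exact contDiff_zero.mpr (hA.continuous le_rfl k)
  · exact (hA.2 h).potential k

lemma LocalAssumptions.locReg {A : Fin 3 → E3 → 𝒢} {n : ℕ} (hn : 2 ≤ n)
    (hA : LocalAssumptions A n) (k : Fin 3) : LocReg (n - 1) (A k) := by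
  rcases hn.eq_or_lt with h | h
  · subst h
    obtain ⟨D, hD, hD'⟩ := (hA.1 rfl).deriv_one k
    refine ⟨(hA.continuous le_rfl k).memLpLoc _, fun l => ⟨D [l], ?_,
      (hD' [l] rfl).mono (by norm_num)⟩⟩
    simpa [hD.nil] using hD.cons l [] (by simp)
  · obtain ⟨m, rfl⟩ : ∃ m, n = m + 3 := ⟨n - 3, by omega⟩
    obtain ⟨q, hq, hq'⟩ := (hA.2 h).deriv_sub_two
    obtain ⟨D', hD', hDq⟩ := hq' k
    obtain ⟨D, hD, hD2⟩ := (hA.2 h).deriv_sub_one k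
    refine locReg_of_isWeakJet (m := m) ((hA.2 h).potential k) hD (fun α hα => ?_) hD2
    refine ((hDq α hα).mono (le_trans (by norm_num) hq.le)).congr_ae ?_
    exact hD'.ae_eq hD α hα.le (by simp only [hα]; omega)

/-! ### Existence of the weak covariant derivatives -/

open Classical in
/-- A weak covariant derivative of `F`; the classical one if that is a weak covariant derivative,
and zero if there is none. -/
noncomputable def weakCovDeriv (A : Fin 3 → E3 → 𝒢) (k : Fin 3) (F : E3 → 𝒢) : E3 → 𝒢 :=
  if IsWeakCovDeriv A k F (covDeriv A k F) then covDeriv A k F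
  else if h : ∃ Ψ, IsWeakCovDeriv A k F Ψ then h.choose else 0

lemma isWeakCovDeriv_weakCovDeriv {A : Fin 3 → E3 → 𝒢} {k : Fin 3} {F Ψ : E3 → 𝒢}
    (h : IsWeakCovDeriv A k F Ψ) : IsWeakCovDeriv A k F (weakCovDeriv A k F) := by
  unfold weakCovDeriv
  have h' : ∃ Ψ, IsWeakCovDeriv A k F Ψ := ⟨Ψ, h⟩
  split_ifs with h1
  · exact h1
  · exact h'.choose_spec

/-- Iterated weak covariant derivatives. -/
noncomputable def weakCovJet (A : Fin 3 → E3 → 𝒢) (Φ : E3 → 𝒢) : List (Fin 3) → E3 → 𝒢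
  | [] => Φ
  | k :: α => weakCovDeriv A k (weakCovJet A Φ α)

lemma IsWeakCovDeriv.ae_eq {A : Fin 3 → E3 → 𝒢} {k : Fin 3} {F Ψ Ψ' : E3 → 𝒢}
    (h : IsWeakCovDeriv A k F Ψ) (h' : IsWeakCovDeriv A k F Ψ') : Ψ =ᵐ[volume] Ψ' := by
  filter_upwards [h.weakDeriv.ae_eq h'.weakDeriv EventuallyEq.rfl] with x hx
  exact sub_left_inj.mp hx

lemma LocReg.weakCovDeriv {A : Fin 3 → E3 → 𝒢} {k : Fin 3} {F : E3 → 𝒢} {m : ℕ}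
    (hA : Continuous (A k)) (hA' : LocReg m (A k)) (hF : LocReg (m + 1) F) :
    IsWeakCovDeriv A k F (weakCovDeriv A k F) ∧ LocReg m (weakCovDeriv A k F) := by
  obtain ⟨g, hg, hg'⟩ := hF.2 k
  have hb : LocReg m fun x => ⁅A k x, F x⁆ := LocReg.bracket (hA.memLpLoc ⊤) hA' hF
  have h : IsWeakCovDeriv A k F fun x => g x + ⁅A k x, F x⁆ :=
    ⟨hb.two.locallyIntegrable (by norm_num), by simpa using hg⟩
  have h' := isWeakCovDeriv_weakCovDeriv h
  exact ⟨h', (hg'.add hb).congr_ae (h.ae_eq h')⟩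

lemma isWeakCovDeriv_covDeriv {A : Fin 3 → E3 → 𝒢} {k : Fin 3} {F : E3 → 𝒢}
    (hA : Continuous (A k)) (hF : ContDiff ℝ 1 F) : IsWeakCovDeriv A k F (covDeriv A k F) := by
  have hb : Continuous fun x => ⁅A k x, F x⁆ :=
    bracketL.continuous₂.comp (hA.prodMk hF.continuous)
  exact ⟨hb.locallyIntegrable, by simpa [covDeriv] using isWeakDeriv_of_contDiff hF k⟩

lemma contDiff_covDeriv {A : Fin 3 → E3 → 𝒢} {k : Fin 3} {F : E3 → 𝒢} {m : ℕ}
    (hA : ContDiff ℝ m (A k)) (hF : ContDiff ℝ (m + 1 : ℕ) F) :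
    ContDiff ℝ m (covDeriv A k F) :=
  (contDiff_fderiv_apply hF _).add (bracketL.isBoundedBilinearMap.contDiff.comp
    (hA.prodMk (hF.of_le (by exact_mod_cast Nat.le_succ m))))

section Jet

variable {A : Fin 3 → E3 → 𝒢} {n : ℕ} {Φ : E3 → 𝒢}

lemma contDiff_covDerivs (hn : 2 ≤ n) (hA : LocalAssumptions A n) (hΦ : ContDiff ℝ (n - 2 : ℕ) Φ)
    (α : List (Fin 3)) (hα : α.length ≤ n - 2) :
    ContDiff ℝ (n - 2 - α.length : ℕ) (covDerivs A α Φ) := by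
  induction α with
  | nil => simpa [covDerivs] using hΦ
  | cons k α ih =>
    simp only [List.length_cons] at hα ⊢
    have e : n - 2 - α.length = (n - 2 - (α.length + 1)) + 1 := by omega
    have ih' := ih (by omega)
    rw [e] at ih'
    refine contDiff_covDeriv ((hA.contDiff hn k).of_le ?_) ih'
    exact_mod_cast (by omega : n - 2 - (α.length + 1) ≤ n - 3)

lemma weakCovJet_eq_covDerivs (hn : 2 ≤ n) (hA : LocalAssumptions A n)
    (hΦ : ContDiff ℝ (n - 2 : ℕ) Φ) (α : List (Fin 3)) (hα : α.length ≤ n - 2) :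
    weakCovJet A Φ α = covDerivs A α Φ := by
  induction α with
  | nil => rfl
  | cons k α ih =>
    simp only [List.length_cons] at hα
    have ih' := ih (by omega)
    have h : IsWeakCovDeriv A k (covDerivs A α Φ) (covDeriv A k (covDerivs A α Φ)) := by
      refine isWeakCovDeriv_covDeriv (hA.continuous hn k)
        ((contDiff_covDerivs hn hA hΦ α (by omega)).of_le ?_)
      exact_mod_cast (by omega : 1 ≤ n - 2 - α.length)
    rw [weakCovJet, ih', weakCovDeriv, if_pos h, covDerivs]

lemma weakCovJet_spec (hn : 2 ≤ n) (hA : LocalAssumptions A n) (hΦ : ContDiff ℝ n Φ) :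
    IsCovJet A n Φ (weakCovJet A Φ) ∧
      ∀ α : List (Fin 3), α.length ≤ n → LocReg (n - α.length) (weakCovJet A Φ α) := by
  have step (k : Fin 3) (α : List (Fin 3)) (hα : α.length < n)
      (ih : LocReg (n - α.length) (weakCovJet A Φ α)) :
      IsWeakCovDeriv A k (weakCovJet A Φ α) (weakCovJet A Φ (k :: α)) ∧
        LocReg (n - (α.length + 1)) (weakCovJet A Φ (k :: α)) := by
    have e : n - α.length = (n - (α.length + 1)) + 1 := by omega
    rw [e] at ih
    exact LocReg.weakCovDeriv (hA.continuous hn k) ((hA.locReg hn k).mono (by omega)) ih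
  have reg (α : List (Fin 3)) (hα : α.length ≤ n) :
      LocReg (n - α.length) (weakCovJet A Φ α) := by
    induction α with
    | nil => exact locReg_of_contDiff hΦ
    | cons k α ih =>
      simp only [List.length_cons] at hα ⊢
      exact (step k α hα (ih (by omega))).2
  exact ⟨⟨rfl, fun k α hα => (step k α hα (reg α hα.le)).1⟩, reg⟩

lemma IsCovJet.ae_eq_zero {D : List (Fin 3) → E3 → 𝒢} (hD : IsCovJet A n Φ D) {U : Set E3}
    (hU : IsOpen U) (hΦ : ∀ x ∈ U, Φ x = 0) (α : List (Fin 3)) (hα : α.length ≤ n) :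
    ∀ᵐ x, x ∈ U → D α x = 0 := by
  induction α with
  | nil => rw [hD.nil]; exact Eventually.of_forall hΦ
  | cons k α ih =>
    simp only [List.length_cons] at hα
    have ih' := ih (by omega)
    filter_upwards [(hD.cons k α hα).weakDeriv.ae_eq_zero hU ih', ih'] with x h1 h2 hx
    simpa [h2 hx] using h1 hx

/-- The norm `‖Φ‖_{n,2}` is finite on `C^n_c`. -/
lemma sobNorm_lt_top (hn : 2 ≤ n) (hA : LocalAssumptions A n) (σ : ℝ) (hΦ : ContDiff ℝ n Φ)
    (hc : HasCompactSupport Φ) : sobNorm A σ n Φ < ⊤ := by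
  obtain ⟨hD, hreg⟩ := weakCovJet_spec hn hA hΦ
  rw [sobNorm_eq hD]
  refine ENNReal.rpow_lt_top_of_nonneg (by norm_num) (ENNReal.sum_lt_top.mpr fun p hp =>
    ENNReal.sum_lt_top.mpr fun α _ => ENNReal.rpow_lt_top_of_nonneg (by norm_num) ?_).ne
  have hl : (List.ofFn α).length ≤ n := by simpa using (Finset.mem_Icc.mp hp).2
  obtain ⟨χ, χs, χc, χ1, -⟩ := exists_cutoff hc
  have hm := (hreg _ hl).two.memLp_smul
    (χs.continuous.mul (continuous_weight_rpow (((p : ℝ) - 3 / 2) * (1 - σ)))) χc.mul_right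
  refine (hm.ae_eq ?_).eLpNorm_ne_top
  filter_upwards [hD.ae_eq_zero (isClosed_tsupport Φ).isOpen_compl
    (fun x hx => image_eq_zero_of_notMem_tsupport hx) (List.ofFn α) hl] with x hx
  by_cases h : x ∈ tsupport Φ
  · simp [χ1 x h]
  · simp [hx h]

end Jet

/-! ### Integration along rays -/

/-- The integral of `g` along all rays `t ↦ x + t θ`, with `θ` in the unit ball. Up to a constant
this is the Riesz potential of order one of `g`. -/
noncomputable def rayIntegral (g : E3 → ℝ≥0∞) (x : E3) : ℝ≥0∞ :=
  ∫⁻ t in Set.Ioi (0 : ℝ), ∫⁻ θ in Metric.ball (0 : E3) 1, g (x + t • θ)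

/-- The volume of the unit ball of `ℝ³`. -/
noncomputable def ballVolume : ℝ≥0∞ := volume (Metric.ball (0 : E3) 1)

lemma ballVolume_ne_zero : ballVolume ≠ 0 := (Metric.measure_ball_pos _ _ one_pos).ne'

lemma ballVolume_ne_top : ballVolume ≠ ⊤ := measure_ball_lt_top.ne

lemma measurableEmbedding_ray (x : E3) {t : ℝ} (ht : 0 < t) :
    MeasurableEmbedding fun θ : E3 => x + t • θ :=
  ((Homeomorph.smulOfNeZero t ht.ne').trans (Homeomorph.addLeft x)).measurableEmbedding

lemma map_restrict_ball (x : E3) {t : ℝ} (ht : 0 < t) :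
    (volume.restrict (Metric.ball (0 : E3) 1)).map (fun θ : E3 => x + t • θ) =
      ENNReal.ofReal (t ^ (-3 : ℝ)) • volume.restrict (Metric.ball x t) := by
  have h1 : (volume : Measure E3).map (fun θ : E3 => x + t • θ) =
      ENNReal.ofReal (t ^ (-3 : ℝ)) • volume := by
    have e : (fun θ : E3 => x + t • θ) = (fun y => x + y) ∘ fun θ => t • θ := rfl
    rw [e, ← Measure.map_map (by fun_prop) (by fun_prop), Measure.map_addHaar_smul _ ht.ne',
      Measure.map_smul, map_add_left_eq_self]
    congr 2
    rw [finrank_euclideanSpace_fin, abs_of_pos (by positivity), Real.rpow_neg ht.le]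
    norm_cast
  have h2 : (fun θ : E3 => x + t • θ) ⁻¹' Metric.ball x t = Metric.ball 0 1 := by
    ext θ
    simp only [Set.mem_preimage, Metric.mem_ball, dist_eq_norm, add_sub_cancel_left, sub_zero,
      norm_smul, Real.norm_of_nonneg ht.le]
    constructor
    · intro h
      by_contra h'
      nlinarith
    · intro h
      nlinarith
  rw [← h2, ← (measurableEmbedding_ray x ht).restrict_map, h1, Measure.restrict_smul]

/-- Hölder's inequality for one value of the ray parameter. -/
lemma lintegral_ray_le {F : Type*} [NormedAddCommGroup F] {f : E3 → F}
    (hf : AEStronglyMeasurable f) (x : E3) {t : ℝ} (ht : 0 < t) {p : ℝ≥0} (hp : 1 ≤ p) :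
    ∫⁻ θ in Metric.ball (0 : E3) 1, ‖f (x + t • θ)‖ₑ ≤
      ballVolume ^ (1 - 1 / (p : ℝ)) * (ENNReal.ofReal (t ^ (-3 / (p : ℝ))) *
        eLpNorm f p (volume.restrict (Metric.ball x t))) := by
  have hp1 : (1 : ℝ≥0∞) ≤ p := by exact_mod_cast hp
  have hp0 : (0 : ℝ) < p := lt_of_lt_of_le one_pos (by exact_mod_cast hp)
  have hme := measurableEmbedding_ray x ht
  have hfm : AEStronglyMeasurable (f ∘ fun θ : E3 => x + t • θ)
      (volume.restrict (Metric.ball (0 : E3) 1)) := by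
    refine AEStronglyMeasurable.comp_measurable ?_ hme.measurable
    rw [map_restrict_ball x ht]
    exact hf.restrict.smul_measure _
  have h1 := eLpNorm_le_eLpNorm_mul_rpow_measure_univ hp1 hfm
  rw [eLpNorm_one_eq_lintegral_enorm, ← hme.eLpNorm_map_measure, map_restrict_ball x ht,
    eLpNorm_smul_measure_of_ne_top ENNReal.coe_ne_top, Measure.restrict_apply_univ] at h1
  refine h1.trans (le_of_eq ?_)
  have e : (1 / (p : ℝ≥0∞)).toReal = 1 / (p : ℝ) := by simp
  rw [mul_comm, e, smul_eq_mul, ENNReal.ofReal_rpow_of_nonneg (by positivity) (by positivity),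
    ← Real.rpow_mul ht.le]
  simp only [ENNReal.toReal_one, ENNReal.coe_toReal, div_one]
  rw [ballVolume]
  congr 4
  ring

lemma rayIntegral_congr_ae {g g' : E3 → ℝ≥0∞} (h : g =ᵐ[volume] g') (x : E3) :
    rayIntegral g x = rayIntegral g' x := by
  refine setLIntegral_congr_fun measurableSet_Ioi fun t ht => lintegral_congr_ae ?_
  have hme := measurableEmbedding_ray x (Set.mem_Ioi.mp ht)
  refine (hme.ae_map_iff (μ := volume.restrict (Metric.ball (0 : E3) 1))
    (p := fun y => g y = g' y)).mp ?_
  rw [map_restrict_ball x (Set.mem_Ioi.mp ht)]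
  exact Measure.ae_smul_measure (ae_restrict_of_ae h) _

lemma rayIntegral_mono {g g' : E3 → ℝ≥0∞} (h : ∀ y, g y ≤ g' y) (x : E3) :
    rayIntegral g x ≤ rayIntegral g' x :=
  lintegral_mono fun _ => lintegral_mono fun _ => h _

lemma rayIntegral_add_le {g g' : E3 → ℝ≥0∞} (hg : AEMeasurable g) (x : E3) :
    rayIntegral (fun y => g y + g' y) x ≤ rayIntegral g x + rayIntegral g' x := by
  wlog hm : Measurable g generalizing g
  · have := this hg.measurable_mk.aemeasurable hg.measurable_mk
    rwa [← rayIntegral_congr_ae hg.ae_eq_mk, rayIntegral_congr_ae (g' := fun y => g y + g' y)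
      (hg.ae_eq_mk.mono fun y hy => by simp only [hy])] at this
  have m1 : Measurable fun q : ℝ × E3 => g (x + q.1 • q.2) := hm.comp (by fun_prop)
  unfold rayIntegral
  rw [← lintegral_add_left m1.lintegral_prod_right']
  refine lintegral_mono fun t => ?_
  exact (lintegral_add_left (m1.comp measurable_prodMk_left) _).le

lemma lintegral_Ioc_rpow {a R : ℝ} (ha : -1 < a) (hR : 0 ≤ R) :
    ∫⁻ t in Set.Ioc 0 R, ENNReal.ofReal (t ^ a) = ENNReal.ofReal (R ^ (a + 1) / (a + 1)) := by
  rw [← ofReal_integral_eq_lintegral_ofReal, ← intervalIntegral.integral_of_le hR,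
    integral_rpow (Or.inl ha), Real.zero_rpow (by linarith), sub_zero]
  · exact (intervalIntegral.intervalIntegrable_rpow' ha).1
  · exact (ae_restrict_iff' measurableSet_Ioc).mpr
      (Eventually.of_forall fun t ht => Real.rpow_nonneg ht.1.le _)

lemma lintegral_Ioi_rpow {a R : ℝ} (ha : a < -1) (hR : 0 < R) :
    ∫⁻ t in Set.Ioi R, ENNReal.ofReal (t ^ a) = ENNReal.ofReal (-R ^ (a + 1) / (a + 1)) := by
  rw [← ofReal_integral_eq_lintegral_ofReal (integrableOn_Ioi_rpow_of_lt ha hR),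
    integral_Ioi_rpow_of_lt ha hR]
  exact (ae_restrict_iff' measurableSet_Ioi).mpr
    (Eventually.of_forall fun t ht => Real.rpow_nonneg (hR.trans ht).le _)

/-- The part of the ray integral close to `x` is controlled by an `L⁶` norm. -/
lemma lintegral_near_le {F : Type*} [NormedAddCommGroup F] {f : E3 → F}
    (hf : AEStronglyMeasurable f) (x : E3) {R : ℝ} (hR : 0 ≤ R) :
    ∫⁻ t in Set.Ioc (0 : ℝ) R, ∫⁻ θ in Metric.ball (0 : E3) 1, ‖f (x + t • θ)‖ₑ ≤
      ballVolume ^ (5 / 6 : ℝ) * (ENNReal.ofReal (2 * R ^ (1 / 2 : ℝ)) *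
        eLpNorm f 6 (volume.restrict (Metric.ball x R))) := by
  calc _ ≤ ∫⁻ t in Set.Ioc (0 : ℝ) R, ballVolume ^ (5 / 6 : ℝ) *
        (ENNReal.ofReal (t ^ (-1 / 2 : ℝ)) *
          eLpNorm f 6 (volume.restrict (Metric.ball x R))) := by
        refine setLIntegral_mono' measurableSet_Ioc fun t ht => ?_
        refine (lintegral_ray_le hf x ht.1 (p := 6) (by norm_num)).trans ?_
        norm_num
        gcongr
        exact ht.2
    _ = _ := by
        have hm : Measurable fun t : ℝ => ENNReal.ofReal (t ^ (-1 / 2 : ℝ)) := by fun_prop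
        rw [lintegral_const_mul _ (hm.mul_const _), lintegral_mul_const _ hm,
          lintegral_Ioc_rpow (by norm_num) hR]
        congr 3
        norm_num
        ring

lemma lintegral_far_le {F : Type*} [NormedAddCommGroup F] {f : E3 → F}
    (hf : AEStronglyMeasurable f) (x : E3) {R : ℝ} (hR : 0 < R) {b : ℝ → ℝ≥0∞}
    (hb : ∀ t, R < t → eLpNorm f 2 (volume.restrict (Metric.ball x t)) ≤ b t) :
    ∫⁻ t in Set.Ioi R, ∫⁻ θ in Metric.ball (0 : E3) 1, ‖f (x + t • θ)‖ₑ ≤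
      ballVolume ^ (1 / 2 : ℝ) *
        ∫⁻ t in Set.Ioi R, ENNReal.ofReal (t ^ (-3 / 2 : ℝ)) * b t := by
  rw [← lintegral_const_mul' _ _ (ENNReal.rpow_ne_top_of_nonneg (by norm_num) ballVolume_ne_top)]
  refine setLIntegral_mono' measurableSet_Ioi fun t ht => ?_
  refine (lintegral_ray_le hf x (hR.trans ht) (p := 2) (by norm_num)).trans ?_
  norm_num
  gcongr
  exact hb t ht

lemma rayIntegral_eq_add (g : E3 → ℝ≥0∞) (x : E3) {R : ℝ} (hR : 0 ≤ R) :
    rayIntegral g x = (∫⁻ t in Set.Ioc (0 : ℝ) R, ∫⁻ θ in Metric.ball (0 : E3) 1, g (x + t • θ)) +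
      ∫⁻ t in Set.Ioi R, ∫⁻ θ in Metric.ball (0 : E3) 1, g (x + t • θ) := by
  rw [rayIntegral, ← Set.Ioc_union_Ioi_eq_Ioi hR]
  exact lintegral_union measurableSet_Ioi (Set.Ioc_disjoint_Ioi le_rfl)

/-- The constant in `rayIntegral_le`. -/
noncomputable def rayConst : ℝ≥0∞ := 2 * (ballVolume ^ (5 / 6 : ℝ) + ballVolume ^ (1 / 2 : ℝ))

lemma rayConst_ne_top : rayConst ≠ ⊤ :=
  ENNReal.mul_ne_top (by norm_num) (ENNReal.add_ne_top.mpr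
    ⟨ENNReal.rpow_ne_top_of_nonneg (by norm_num) ballVolume_ne_top,
      ENNReal.rpow_ne_top_of_nonneg (by norm_num) ballVolume_ne_top⟩)

lemma rayIntegral_le {F : Type*} [NormedAddCommGroup F] {f : E3 → F}
    (hf : AEStronglyMeasurable f) (x : E3) {R : ℝ} (hR : 0 < R) :
    rayIntegral (fun y => ‖f y‖ₑ) x ≤ rayConst * (ENNReal.ofReal (R ^ (1 / 2 : ℝ)) * eLpNorm f 6 +
      ENNReal.ofReal (R ^ (-1 / 2 : ℝ)) * eLpNorm f 2) := by
  have h1 := lintegral_near_le hf x hR.le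
  have h2 := lintegral_far_le hf x hR (b := fun _ => eLpNorm f 2)
    fun t _ => eLpNorm_mono_measure f Measure.restrict_le_self
  rw [lintegral_mul_const _ (by fun_prop), lintegral_Ioi_rpow (by norm_num) hR] at h2
  have e : -R ^ (-3 / 2 + 1 : ℝ) / (-3 / 2 + 1) = 2 * R ^ (-1 / 2 : ℝ) := by
    norm_num
    ring
  rw [e, ENNReal.ofReal_mul (by norm_num)] at h2
  rw [ENNReal.ofReal_mul (by norm_num)] at h1
  have h6 : eLpNorm f 6 (volume.restrict (Metric.ball x R)) ≤ eLpNorm f 6 :=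
    eLpNorm_mono_measure f Measure.restrict_le_self
  have aux (a b r s u u' v : ℝ≥0∞) (h : u' ≤ u) :
      a * (2 * r * u') + b * (2 * s * v) ≤ 2 * (a + b) * (r * u + s * v) := by
    calc a * (2 * r * u') + b * (2 * s * v)
        ≤ (a + b) * (2 * r * u) + (a + b) * (2 * s * v) := by
          gcongr
          · exact le_self_add
          · exact le_add_self
      _ = _ := by ring
  rw [rayIntegral_eq_add _ x hR.le]
  rw [ENNReal.ofReal_ofNat] at h1 h2
  exact (add_le_add h1 h2).trans (aux _ _ _ _ _ _ _ h6)

/-- A compactly supported function is bounded by the ray integral of its gradient: integrate the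
fundamental theorem of calculus along a ray over all directions. -/
lemma ballVolume_mul_enorm_le {v : E3 → ℝ} (hv : ContDiff ℝ 1 v) (hc : HasCompactSupport v)
    (x : E3) : ballVolume * ‖v x‖ₑ ≤ rayIntegral (fun y => ‖fderiv ℝ v y‖ₑ) x := by
  have hcd : Continuous (fderiv ℝ v) := hv.continuous_fderiv (by simp)
  have hray (θ : E3) (hθ : θ ∈ Metric.ball (0 : E3) 1) (h0 : θ ≠ 0) :
      ‖v x‖ₑ ≤ ∫⁻ t in Set.Ioi (0 : ℝ), ‖fderiv ℝ v (x + t • θ)‖ₑ := by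
    let f : ℝ → ℝ := fun s => v (x + (-s) • θ)
    have hl : ContDiff ℝ 1 fun s : ℝ => x + (-s) • θ := by fun_prop
    have hemb : IsClosedEmbedding fun s : ℝ => x + (-s) • θ :=
      (Homeomorph.addLeft x).isClosedEmbedding.comp
        ((isClosedEmbedding_smul_left h0).comp (Homeomorph.neg ℝ).isClosedEmbedding)
    have h1 := HasCompactSupport.enorm_le_lintegral_Ici_deriv (f := f) (hv.comp hl)
      (hc.comp_isClosedEmbedding hemb) 0
    have hd (s : ℝ) : ‖deriv f s‖ₑ ≤ ‖fderiv ℝ v (x + (-s) • θ)‖ₑ := by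
      have hs : HasDerivAt (fun s : ℝ => x + (-s) • θ) (-θ) s := by
        simpa using ((hasDerivAt_id s).neg.smul_const θ).const_add x
      have := ((hv.differentiable (by simp) (x + (-s) • θ)).hasFDerivAt).comp_hasDerivAt s hs
      rw [show deriv f s = _ from this.deriv, ← ofReal_norm, ← ofReal_norm]
      refine ENNReal.ofReal_le_ofReal ((ContinuousLinearMap.le_opNorm _ _).trans ?_)
      rw [norm_neg]
      exact mul_le_of_le_one_right (norm_nonneg _) (mem_ball_zero_iff.mp hθ).le
    have h2 : ∫⁻ s in Set.Iic (0 : ℝ), ‖fderiv ℝ v (x + (-s) • θ)‖ₑ =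
        ∫⁻ t in Set.Ioi (0 : ℝ), ‖fderiv ℝ v (x + t • θ)‖ₑ := by
      have := (Measure.measurePreserving_neg (volume : Measure ℝ)).setLIntegral_comp_preimage_emb
        (Homeomorph.neg ℝ).measurableEmbedding (fun t => ‖fderiv ℝ v (x + t • θ)‖ₑ) (Set.Ici 0)
      rw [Set.neg_preimage, Set.neg_Ici, neg_zero] at this
      rw [this, setLIntegral_congr Ioi_ae_eq_Ici]
    have h3 : f 0 = v x := by simp [f]
    rw [← h3, ← h2]
    exact h1.trans (lintegral_mono fun s => hd s)
  have hm : Measurable fun q : E3 × ℝ => ‖fderiv ℝ v (x + q.2 • q.1)‖ₑ :=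
    (hcd.comp (by fun_prop)).enorm.measurable
  calc ballVolume * ‖v x‖ₑ = ∫⁻ _ in Metric.ball (0 : E3) 1, ‖v x‖ₑ := by
        rw [setLIntegral_const, mul_comm, ballVolume]
    _ ≤ ∫⁻ θ in Metric.ball (0 : E3) 1, ∫⁻ t in Set.Ioi (0 : ℝ),
          ‖fderiv ℝ v (x + t • θ)‖ₑ := by
        refine lintegral_mono_ae ?_
        have h0 : ∀ᵐ θ : E3 ∂(volume.restrict (Metric.ball (0 : E3) 1)), θ ≠ 0 :=
          ae_restrict_of_ae (Measure.ae_ne volume 0)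
        filter_upwards [h0, ae_restrict_mem Metric.isOpen_ball.measurableSet] with θ h1 h2
        exact hray θ h2 h1
    _ = _ := lintegral_lintegral_swap hm.aemeasurable

/-! ### Kato's inequality -/

/-- The bracket is skew for the inner product. -/
lemma inner_bracket_self (X Y : 𝒢) : inner ℝ Y ⁅X, Y⁆ = 0 := by
  have h := CompactLieAlgebra.inner_invariant Y X Y
  rw [real_inner_comm Y ⁅X, Y⁆] at h
  linarith

lemma norm_clm_le_sum (L : E3 →L[ℝ] ℝ) : ‖L‖ ≤ ∑ k, |L (unitVec k)| := by
  refine L.opNorm_le_bound (Finset.sum_nonneg fun _ _ => abs_nonneg _) fun y => ?_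
  have hy : y = ∑ k, y k • unitVec k := by
    ext i
    simp [unitVec, Finset.sum_apply, Pi.single_apply]
  calc ‖L y‖ = |∑ k, y k * L (unitVec k)| := by
        conv_lhs => rw [hy, map_sum]
        simp
    _ ≤ ∑ k, |y k * L (unitVec k)| := Finset.abs_sum_le_sum_abs _ _
    _ ≤ ∑ k, |L (unitVec k)| * ‖y‖ := by
        refine Finset.sum_le_sum fun k _ => ?_
        rw [abs_mul, mul_comm]
        gcongr
        exact PiLp.norm_apply_le y k
    _ = _ := by rw [Finset.sum_mul]

/-- The length `∑_k |∇_k Φ|` of the covariant gradient. -/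
noncomputable def covGrad (A : Fin 3 → E3 → 𝒢) (Φ : E3 → 𝒢) (x : E3) : ℝ :=
  ∑ k, ‖covDeriv A k Φ x‖

/-- The regularization `(δ² + |Φ|²)^{1/2} - δ` of `|Φ|`. -/
noncomputable def regNorm (δ : ℝ) (Φ : E3 → 𝒢) (x : E3) : ℝ :=
  Real.sqrt (δ ^ 2 + ‖Φ x‖ ^ 2) - δ

lemma contDiff_regNorm {δ : ℝ} (hδ : 0 < δ) {Φ : E3 → 𝒢} (hΦ : ContDiff ℝ 1 Φ) :
    ContDiff ℝ 1 (regNorm δ Φ) :=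
  ((contDiff_const.add (hΦ.norm_sq ℝ)).sqrt fun x => by positivity).sub contDiff_const

lemma hasCompactSupport_regNorm {δ : ℝ} (hδ : 0 < δ) {Φ : E3 → 𝒢} (hc : HasCompactSupport Φ) :
    HasCompactSupport (regNorm δ Φ) :=
  hc.comp_left (g := fun X : 𝒢 => Real.sqrt (δ ^ 2 + ‖X‖ ^ 2) - δ)
    (by simp [Real.sqrt_sq hδ.le])

/-- Kato's inequality for the regularized norm. -/
lemma norm_fderiv_regNorm_le {δ : ℝ} (hδ : 0 < δ) (A : Fin 3 → E3 → 𝒢) {Φ : E3 → 𝒢}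
    (hΦ : ContDiff ℝ 1 Φ) (x : E3) : ‖fderiv ℝ (regNorm δ Φ) x‖ ≤ covGrad A Φ x := by
  refine (norm_clm_le_sum _).trans (Finset.sum_le_sum fun k _ => ?_)
  have hp : 0 < δ ^ 2 + ‖Φ x‖ ^ 2 := by positivity
  have hd := (((hΦ.differentiable (by simp) x).hasFDerivAt.norm_sq.const_add (δ ^ 2)).sqrt
    hp.ne').sub_const δ
  have e : fderiv ℝ (regNorm δ Φ) x (unitVec k) =
      (1 / Real.sqrt (δ ^ 2 + ‖Φ x‖ ^ 2)) * inner ℝ (Φ x) (covDeriv A k Φ x) := by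
    rw [show fderiv ℝ (regNorm δ Φ) x = _ from hd.fderiv, covDeriv, inner_add_right,
      inner_bracket_self, add_zero]
    simp
    ring
  have hs : ‖Φ x‖ ≤ Real.sqrt (δ ^ 2 + ‖Φ x‖ ^ 2) :=
    Real.le_sqrt_of_sq_le (by nlinarith [sq_nonneg δ])
  rw [e, abs_mul, abs_of_pos (by positivity), one_div, inv_mul_le_iff₀ (by positivity)]
  exact (abs_real_inner_le_norm _ _).trans (by gcongr)

lemma tendsto_regNorm (Φ : E3 → 𝒢) (x : E3) :
    Tendsto (fun j : ℕ => regNorm (1 / ((j : ℝ) + 1)) Φ x) atTop (𝓝 ‖Φ x‖) := by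
  have hc : Continuous fun δ : ℝ => regNorm δ Φ x := by unfold regNorm; fun_prop
  have := (hc.tendsto 0).comp tendsto_one_div_add_atTop_nhds_zero_nat
  simpa [regNorm, Function.comp_def] using this

/-- The constant of the Sobolev inequality `‖u‖₆ ≤ C ‖∇u‖₂` on `ℝ³`. -/
noncomputable def sobConst : ℝ≥0 := SNormLESNormFDerivOfEqConst ℝ (volume : Measure E3) 2

lemma eLpNorm_six_le_of_contDiff (A : Fin 3 → E3 → 𝒢) {Φ : E3 → 𝒢} (hΦ : ContDiff ℝ 1 Φ)
    (hc : HasCompactSupport Φ) : eLpNorm Φ 6 ≤ sobConst * eLpNorm (covGrad A Φ) 2 := by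
  have hpos (j : ℕ) : (0 : ℝ) < 1 / ((j : ℝ) + 1) := by positivity
  have hj (j : ℕ) : eLpNorm (regNorm (1 / ((j : ℝ) + 1)) Φ) 6 ≤
      sobConst * eLpNorm (covGrad A Φ) 2 := by
    have h := eLpNorm_le_eLpNorm_fderiv_of_eq (volume : Measure E3) (p := 2) (p' := 6)
      (contDiff_regNorm (hpos j) hΦ) (hasCompactSupport_regNorm (hpos j) hc) (by norm_num)
      (by simp) (by simp; norm_num)
    refine h.trans ?_
    rw [sobConst]
    refine mul_le_mul_right ?_ _
    exact eLpNorm_mono_real fun x => norm_fderiv_regNorm_le (hpos j) A hΦ x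
  rw [← eLpNorm_norm]
  refine (Lp.eLpNorm_lim_le_liminf_eLpNorm (fun j =>
    (contDiff_regNorm (hpos j) hΦ).continuous.aestronglyMeasurable) _
    (Eventually.of_forall fun x => tendsto_regNorm Φ x)).trans ?_
  exact (liminf_le_liminf (Eventually.of_forall hj)).trans (by simp)

lemma ballVolume_mul_enorm_le_of_contDiff (A : Fin 3 → E3 → 𝒢) {Φ : E3 → 𝒢}
    (hΦ : ContDiff ℝ 1 Φ) (hc : HasCompactSupport Φ) (x : E3) :
    ballVolume * ‖Φ x‖ₑ ≤ rayIntegral (fun y => ‖covGrad A Φ y‖ₑ) x := by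
  have hpos (j : ℕ) : (0 : ℝ) < 1 / ((j : ℝ) + 1) := by positivity
  have h1 : Tendsto (fun j : ℕ => ballVolume * ‖regNorm (1 / ((j : ℝ) + 1)) Φ x‖ₑ) atTop
      (𝓝 (ballVolume * ‖‖Φ x‖‖ₑ)) :=
    ENNReal.Tendsto.const_mul ((continuous_enorm.tendsto _).comp (tendsto_regNorm Φ x))
      (Or.inr ballVolume_ne_top)
  rw [enorm_norm] at h1
  refine le_of_tendsto h1 (Eventually.of_forall fun j => ?_)
  refine (ballVolume_mul_enorm_le (contDiff_regNorm (hpos j) hΦ)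
    (hasCompactSupport_regNorm (hpos j) hc) x).trans (rayIntegral_mono (fun y => ?_) x)
  rw [← ofReal_norm, ← ofReal_norm]
  exact ENNReal.ofReal_le_ofReal ((norm_fderiv_regNorm_le (hpos j) A hΦ y).trans
    (Real.le_norm_self _))

/-! ### Passage to weak derivatives -/

section Weak

variable {A : Fin 3 → E3 → 𝒢} {u : E3 → 𝒢} {H : Fin 3 → E3 → 𝒢}

lemma exists_eLpNorm_bracket_le_of_continuous {a : E3 → 𝒢} (ha : Continuous a) {K : Set E3}
    (hK : IsCompact K) : ∃ M : ℝ, ∀ (f : E3 → 𝒢), Function.support f ⊆ K →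
      ∀ p : ℝ≥0∞, eLpNorm (fun x => ⁅a x, f x⁆) p ≤ ENNReal.ofReal M * eLpNorm f p := by
  obtain ⟨C, hC⟩ := hK.exists_bound_of_continuousOn ha.continuousOn
  refine ⟨‖(bracketL : 𝒢 →L[ℝ] 𝒢 →L[ℝ] 𝒢)‖ * C, fun f hf p => ?_⟩
  refine eLpNorm_le_mul_eLpNorm_of_ae_le_mul (Eventually.of_forall fun x => ?_) p
  by_cases hx : x ∈ K
  · refine (bracketL.le_opNorm₂ (a x) (f x)).trans ?_
    gcongr
    exact hC x hx
  · have : f x = 0 := by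
      by_contra h
      exact hx (hf h)
    simp [this]

/-- Friedrichs' lemma: mollification approximates the weak covariant derivative in `L^p`. -/
lemma tendsto_covDeriv_mollify {k : Fin 3} {h : E3 → 𝒢} (hA : Continuous (A k))
    (hc : HasCompactSupport u) {p : ℝ≥0∞} (hp : 1 ≤ p) (hp' : p ≠ ⊤) (hu : MemLp u p)
    (hh : MemLp h p) (hw : IsWeakCovDeriv A k u h) :
    Tendsto (fun j => eLpNorm (covDeriv A k (mollify (stdBump j) u) - h) p) atTop (𝓝 0) := by
  set K := Metric.cthickening 1 (tsupport u)
  have hK : IsCompact K := hc.isCompact.cthickening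
  obtain ⟨M, hM⟩ := exists_eLpNorm_bracket_le_of_continuous hA hK
  have hsu : Function.support u ⊆ K :=
    (subset_tsupport u).trans (Metric.self_subset_cthickening _)
  have hb : MemLp (fun x => ⁅A k x, u x⁆) p :=
    ⟨hw.bracket.aestronglyMeasurable,
      (hM u hsu p).trans_lt (ENNReal.mul_lt_top ENNReal.ofReal_lt_top hu.2)⟩
  have hd : MemLp (fun x => h x - ⁅A k x, u x⁆) p := hh.sub hb
  have t1 := tendsto_eLpNorm_mollify_sub hp hp' hd
  have t2 : Tendsto (fun j => ENNReal.ofReal M * eLpNorm (mollify (stdBump j) u - u) p) atTop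
      (𝓝 0) := by
    simpa using ENNReal.Tendsto.const_mul (tendsto_eLpNorm_mollify_sub hp hp' hu)
      (Or.inr (ENNReal.ofReal_ne_top (r := M)))
  have t3 := t1.add t2
  rw [add_zero] at t3
  refine tendsto_of_tendsto_of_tendsto_of_le_of_le tendsto_const_nhds t3 (fun _ => zero_le)
    fun j => ?_
  have hmu := (contDiff_mollify (stdBump j) (hu.locallyIntegrable hp)).continuous
  have e : covDeriv A k (mollify (stdBump j) u) - h =
      (mollify (stdBump j) (fun x => h x - ⁅A k x, u x⁆) - fun x => h x - ⁅A k x, u x⁆) +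
        fun x => ⁅A k x, (mollify (stdBump j) u - u) x⁆ := by
    funext x
    simp only [Pi.sub_apply, Pi.add_apply, covDeriv, hw.weakDeriv.fderiv_mollify, lie_sub]
    abel
  have hs : Function.support (mollify (stdBump j) u - u) ⊆ K := by
    intro x hx
    by_contra hxK
    have h1 : mollify (stdBump j) u x = 0 := by
      by_contra h0
      exact hxK (support_mollify_subset _ (stdBump_rOut_le_one j) h0)
    have h2 : u x = 0 := by
      by_contra h0
      exact hxK (hsu h0)
    exact hx (by simp [h1, h2])
  rw [e]
  refine (eLpNorm_add_le ?_ ?_ hp).trans (by gcongr; exact hM _ hs p)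
  · exact (contDiff_mollify _ (hd.locallyIntegrable hp)).continuous.aestronglyMeasurable.sub hd.1
  · exact bracketL.aestronglyMeasurable_comp₂ hA.aestronglyMeasurable
      (hmu.aestronglyMeasurable.sub hu.1)

lemma contDiff_mollify_one (φ : ContDiffBump (0 : E3)) {p : ℝ≥0∞} (hp : 1 ≤ p) (hu : MemLp u p) :
    ContDiff ℝ 1 (mollify φ u) :=
  (contDiff_mollify φ (hu.locallyIntegrable hp)).of_le (by simp)

lemma continuous_covDeriv {k : Fin 3} (hA : Continuous (A k)) {v : E3 → 𝒢}
    (hv : ContDiff ℝ 1 v) : Continuous (covDeriv A k v) :=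
  (continuous_fderiv_apply hv _).add (bracketL.continuous₂.comp (hA.prodMk hv.continuous))

/-- `∑_k |H_k|`. -/
noncomputable def normSum (H : Fin 3 → E3 → 𝒢) (x : E3) : ℝ := ∑ k, ‖H k x‖

lemma covGrad_eq_normSum (A : Fin 3 → E3 → 𝒢) (v : E3 → 𝒢) :
    covGrad A v = normSum fun k => covDeriv A k v := rfl

lemma aestronglyMeasurable_normSum (h : ∀ k, AEStronglyMeasurable (H k)) :
    AEStronglyMeasurable (normSum H) := by
  have := Finset.aestronglyMeasurable_fun_sum Finset.univ fun k _ => (h k).norm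
  exact this

lemma eLpNorm_normSum_le {p : ℝ≥0∞} (hp : 1 ≤ p) {μ : Measure E3}
    (h : ∀ k, AEStronglyMeasurable (H k) μ) :
    eLpNorm (normSum H) p μ ≤ ∑ k, eLpNorm (H k) p μ := by
  have e : normSum H = ∑ k, fun x => ‖H k x‖ := by
    funext x
    simp [normSum]
  rw [e]
  refine (eLpNorm_sum_le (fun k _ => (h k).norm) hp).trans (le_of_eq ?_)
  simp only [eLpNorm_norm]

lemma tendsto_sum_eLpNorm_covDeriv_mollify (hA : ∀ k, Continuous (A k))
    (hc : HasCompactSupport u) {p : ℝ≥0∞} (hp : 1 ≤ p) (hp' : p ≠ ⊤) (hu : MemLp u p)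
    (hH : ∀ k, MemLp (H k) p) (hw : ∀ k, IsWeakCovDeriv A k u (H k)) :
    Tendsto (fun j => ∑ k, eLpNorm (covDeriv A k (mollify (stdBump j) u) - H k) p) atTop
      (𝓝 0) := by
  have := tendsto_finsetSum Finset.univ fun k _ =>
    tendsto_covDeriv_mollify (hA k) hc hp hp' hu (hH k) (hw k)
  simpa using this

/-- The covariant Sobolev inequality `‖u‖₆ ≤ C ‖∇u‖₂`. -/
lemma eLpNorm_six_le (hA : ∀ k, Continuous (A k)) (hc : HasCompactSupport u) (hu : MemLp u 2)
    (hH : ∀ k, MemLp (H k) 2) (hw : ∀ k, IsWeakCovDeriv A k u (H k)) :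
    eLpNorm u 6 ≤ sobConst * ∑ k, eLpNorm (H k) 2 := by
  have one2 : (1 : ℝ≥0∞) ≤ 2 := by norm_num
  have cd (j : ℕ) := contDiff_mollify_one (stdBump j) one2 hu
  have hj (j : ℕ) : eLpNorm (mollify (stdBump j) u) 6 ≤ sobConst * (∑ k, eLpNorm (H k) 2 +
      ∑ k, eLpNorm (covDeriv A k (mollify (stdBump j) u) - H k) 2) := by
    refine (eLpNorm_six_le_of_contDiff A (cd j) (hasCompactSupport_mollify _ hc)).trans ?_
    rw [covGrad_eq_normSum, ← Finset.sum_add_distrib]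
    refine mul_le_mul_right ((eLpNorm_normSum_le one2 fun k =>
      (continuous_covDeriv (hA k) (cd j)).aestronglyMeasurable).trans
        (Finset.sum_le_sum fun k _ => ?_)) _
    have h2 := eLpNorm_add_le (p := 2) (hH k).1
      ((continuous_covDeriv (hA k) (cd j)).aestronglyMeasurable.sub (hH k).1) one2
    rwa [add_sub_cancel] at h2
  have t : Tendsto (fun j => sobConst * (∑ k, eLpNorm (H k) 2 +
      ∑ k, eLpNorm (covDeriv A k (mollify (stdBump j) u) - H k) 2)) atTop
      (𝓝 (sobConst * (∑ k, eLpNorm (H k) 2 + 0))) :=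
    ENNReal.Tendsto.const_mul (tendsto_const_nhds.add
      (tendsto_sum_eLpNorm_covDeriv_mollify hA hc one2 (by norm_num) hu hH hw))
      (Or.inr ENNReal.coe_ne_top)
  rw [add_zero] at t
  refine (Lp.eLpNorm_lim_le_liminf_eLpNorm (fun j => (cd j).continuous.aestronglyMeasurable) _
    (ContDiffBump.ae_convolution_tendsto_right_of_locallyIntegrable (K := 2)
      tendsto_stdBump_rOut (Eventually.of_forall fun j => ?_) (hu.locallyIntegrable one2))).trans ?_
  · change 1 / ((j : ℝ) + 1) ≤ 2 * (1 / (2 * ((j : ℝ) + 1)))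
    exact le_of_eq (by field_simp)
  · exact (liminf_le_liminf (Eventually.of_forall hj)).trans t.liminf_eq.le

/-- A continuous compactly supported map is bounded by the ray integral of its weak covariant
gradient. -/
lemma ballVolume_mul_enorm_le_rayIntegral (hA : ∀ k, Continuous (A k))
    (hc : HasCompactSupport u) (hu : Continuous u) (hH2 : ∀ k, MemLp (H k) 2)
    (hH6 : ∀ k, MemLp (H k) 6) (hw : ∀ k, IsWeakCovDeriv A k u (H k)) (x : E3) :
    ballVolume * ‖u x‖ₑ ≤ rayIntegral (fun y => ‖normSum H y‖ₑ) x := by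
  have one2 : (1 : ℝ≥0∞) ≤ 2 := by norm_num
  have one6 : (1 : ℝ≥0∞) ≤ 6 := by norm_num
  have hup (p : ℝ≥0∞) : MemLp u p := hu.memLp_of_hasCompactSupport hc
  have cd (j : ℕ) := contDiff_mollify_one (stdBump j) one2 (hup 2)
  have cm (j : ℕ) (k : Fin 3) :=
    (continuous_covDeriv (hA k) (cd j)).aestronglyMeasurable (μ := volume)
  set d : ℕ → Fin 3 → E3 → 𝒢 := fun j k => covDeriv A k (mollify (stdBump j) u) - H k with hd
  have dm (j : ℕ) (k : Fin 3) : AEStronglyMeasurable (d j k) volume := (cm j k).sub (hH2 k).1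
  have hj (j : ℕ) : ballVolume * ‖mollify (stdBump j) u x‖ₑ ≤
      rayIntegral (fun y => ‖normSum H y‖ₑ) x +
        rayConst * (∑ k, eLpNorm (d j k) 6 + ∑ k, eLpNorm (d j k) 2) := by
    refine (ballVolume_mul_enorm_le_of_contDiff A (cd j) (hasCompactSupport_mollify _ hc) x).trans ?_
    have h1 (y : E3) : ‖covGrad A (mollify (stdBump j) u) y‖ₑ ≤
        ‖normSum H y‖ₑ + ‖normSum (d j) y‖ₑ := by
      have nn (G : Fin 3 → E3 → 𝒢) : 0 ≤ normSum G y := Finset.sum_nonneg fun _ _ => norm_nonneg _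
      rw [covGrad_eq_normSum, Real.enorm_of_nonneg (nn _), Real.enorm_of_nonneg (nn _),
        Real.enorm_of_nonneg (nn _), ← ENNReal.ofReal_add (nn _) (nn _)]
      refine ENNReal.ofReal_le_ofReal ?_
      simp only [normSum, ← Finset.sum_add_distrib]
      refine Finset.sum_le_sum fun k _ => ?_
      calc ‖covDeriv A k (mollify (stdBump j) u) y‖ = ‖H k y + d j k y‖ := by
            simp [hd]
        _ ≤ _ := norm_add_le _ _
    refine (rayIntegral_mono h1 x).trans ((rayIntegral_add_le
      (aestronglyMeasurable_normSum fun k => (hH2 k).1).enorm x).trans ?_)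
    gcongr
    refine (rayIntegral_le (aestronglyMeasurable_normSum (dm j)) x one_pos).trans ?_
    simp only [Real.one_rpow, ENNReal.ofReal_one, one_mul]
    gcongr
    · exact eLpNorm_normSum_le one6 (dm j)
    · exact eLpNorm_normSum_le one2 (dm j)
  have t1 : Tendsto (fun j => ballVolume * ‖mollify (stdBump j) u x‖ₑ) atTop
      (𝓝 (ballVolume * ‖u x‖ₑ)) :=
    ENNReal.Tendsto.const_mul ((continuous_enorm.tendsto _).comp
      (ContDiffBump.convolution_tendsto_right_of_continuous tendsto_stdBump_rOut hu x))
      (Or.inr ballVolume_ne_top)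
  have t2 : Tendsto (fun j => rayIntegral (fun y => ‖normSum H y‖ₑ) x +
      rayConst * (∑ k, eLpNorm (d j k) 6 + ∑ k, eLpNorm (d j k) 2)) atTop
      (𝓝 (rayIntegral (fun y => ‖normSum H y‖ₑ) x + rayConst * (0 + 0))) :=
    tendsto_const_nhds.add (ENNReal.Tendsto.const_mul
      ((tendsto_sum_eLpNorm_covDeriv_mollify hA hc one6 (by norm_num) (hup 6) hH6 hw).add
        (tendsto_sum_eLpNorm_covDeriv_mollify hA hc one2 (by norm_num) (hup 2) hH2 hw))
      (Or.inr rayConst_ne_top))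
  rw [add_zero, mul_zero, add_zero] at t2
  exact le_of_tendsto_of_tendsto' t1 t2 hj

end Weak

/-! ### Cutoff functions and the weight -/

lemma exists_scaled_cutoff : ∃ L : ℝ, 0 ≤ L ∧ ∀ (x₀ : E3) (R : ℝ), 0 < R → ∃ χ : E3 → ℝ,
    ContDiff ℝ ∞ χ ∧ (∀ y, |χ y| ≤ 1) ∧ (∀ y ∈ Metric.closedBall x₀ R, χ y = 1) ∧
    tsupport χ ⊆ Metric.closedBall x₀ (2 * R) ∧
    ∀ y k, |fderiv ℝ χ y (unitVec k)| ≤ L / R := by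
  let ψ : ContDiffBump (0 : E3) := ⟨1, 2, one_pos, one_lt_two⟩
  have hψ : ContDiff ℝ ∞ ψ := ψ.contDiff
  obtain ⟨L, hL⟩ := (ψ.hasCompactSupport.fderiv ℝ).exists_bound_of_continuous
    (hψ.continuous_fderiv (by simp))
  refine ⟨L, (norm_nonneg _).trans (hL 0), fun x₀ R hR => ?_⟩
  refine ⟨fun y => ψ (R⁻¹ • (y - x₀)), hψ.comp (by fun_prop), fun y => ?_, fun y hy => ?_, ?_,
    fun y k => ?_⟩
  · rw [abs_of_nonneg ψ.nonneg]
    exact ψ.le_one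
  · refine ψ.one_of_mem_closedBall ?_
    rw [mem_closedBall_zero_iff, norm_smul, norm_inv, Real.norm_of_nonneg hR.le,
      inv_mul_le_iff₀ hR]
    have hr : R * ψ.rIn = R := mul_one R
    rw [hr]
    simpa [dist_eq_norm] using hy
  · refine closure_minimal (fun y hy => ?_) Metric.isClosed_closedBall
    have h : R⁻¹ • (y - x₀) ∈ Function.support ψ := hy
    rw [ψ.support_eq, mem_ball_zero_iff, norm_smul, norm_inv, Real.norm_of_nonneg hR.le,
      inv_mul_lt_iff₀ hR] at h
    rw [Metric.mem_closedBall, dist_eq_norm, mul_comm]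
    exact h.le
  · have h1 : HasFDerivAt (fun y : E3 => R⁻¹ • (y - x₀)) (R⁻¹ • ContinuousLinearMap.id ℝ E3) y :=
      ((hasFDerivAt_id y).sub_const x₀).const_smul R⁻¹
    have h2 := ((hψ.differentiable (by simp)) (R⁻¹ • (y - x₀))).hasFDerivAt.comp y h1
    rw [show fderiv ℝ (fun y => ψ (R⁻¹ • (y - x₀))) y = _ from h2.fderiv]
    have h3 : ‖unitVec k‖ = 1 := by simp [unitVec]
    have h4 := (fderiv ℝ ψ (R⁻¹ • (y - x₀))).le_opNorm (unitVec k)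
    rw [h3, mul_one, Real.norm_eq_abs] at h4
    simp only [ContinuousLinearMap.comp_smul, ContinuousLinearMap.comp_id,
      smul_apply, smul_eq_mul, abs_mul, abs_inv, abs_of_pos hR]
    rw [div_eq_inv_mul]
    gcongr
    exact h4.trans (hL _)

lemma one_le_weight (x : E3) : 1 ≤ weight x := by
  unfold weight
  rw [Real.one_le_sqrt]
  nlinarith [sq_nonneg ‖x‖]

lemma weight_pos (x : E3) : 0 < weight x := one_pos.trans_le (one_le_weight x)

/-- The weight is Lipschitz with constant one. -/
lemma weight_le_add (x y : E3) : weight y ≤ weight x + dist y x := by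
  have hy : ‖y‖ ≤ ‖x‖ + dist y x := by
    rw [dist_eq_norm]
    calc ‖y‖ = ‖x + (y - x)‖ := by rw [add_sub_cancel]
      _ ≤ _ := norm_add_le _ _
  have h1 : ‖x‖ ≤ weight x := Real.le_sqrt_of_sq_le (by linarith)
  have h2 : weight x ^ 2 = 1 + ‖x‖ ^ 2 := Real.sq_sqrt (by positivity)
  refine Real.sqrt_le_iff.mpr ⟨by positivity [weight_pos x], ?_⟩
  have h3 : ‖y‖ ^ 2 ≤ (‖x‖ + dist y x) ^ 2 := by gcongr
  nlinarith [mul_le_mul_of_nonneg_right h1 (dist_nonneg (x := y) (y := x))]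

/-- The length scale `w(x)^{1-σ}` at the point `x`. -/
noncomputable def scale (σ : ℝ) (x : E3) : ℝ := weight x ^ (1 - σ)

lemma one_le_scale {σ : ℝ} (hσ : σ ≤ 1) (x : E3) : 1 ≤ scale σ x :=
  Real.one_le_rpow (one_le_weight x) (by linarith)

lemma scale_pos (σ : ℝ) (x : E3) : 0 < scale σ x := Real.rpow_pos_of_pos (weight_pos x) _

lemma scale_le_weight {σ : ℝ} (hσ : 0 < σ) (x : E3) : scale σ x ≤ weight x := by
  calc _ ≤ weight x ^ (1 : ℝ) := Real.rpow_le_rpow_of_exponent_le (one_le_weight x) (by linarith)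
    _ = _ := Real.rpow_one _

/-- On a ball whose radius is a fraction of the length scale the weight is comparable to its value
at the center. -/
lemma scale_rpow_le {σ : ℝ} (hσ₀ : 0 < σ) (hσ₁ : σ ≤ 1) {x y : E3}
    (hy : y ∈ Metric.closedBall x (scale σ x / 4)) {s : ℝ} {n : ℕ} (hs : |s| ≤ n) :
    scale σ x ^ s ≤ 2 ^ n * weight y ^ (s * (1 - σ)) := by
  have h0 := scale_le_weight hσ₀ x
  have hd : dist y x ≤ weight x / 4 := (Metric.mem_closedBall.mp hy).trans (by linarith)
  have h1 := weight_le_add x y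
  have h2 := weight_le_add y x
  rw [dist_comm x y] at h2
  have hx := weight_pos x
  have hy := weight_pos y
  have hq1 : weight x / weight y ≤ 2 := by rw [div_le_iff₀ hy]; linarith
  have hq2 : 1 / 2 ≤ weight x / weight y := by rw [le_div_iff₀ hy]; linarith
  have hq : 0 < weight x / weight y := by positivity
  have key : (weight x / weight y) ^ (s * (1 - σ)) ≤ 2 ^ n := by
    have ht : |s * (1 - σ)| ≤ n := by
      rw [abs_mul]
      have : |1 - σ| ≤ 1 := abs_le.mpr ⟨by linarith, by linarith⟩
      nlinarith [abs_nonneg s, abs_nonneg (1 - σ)]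
    have h3 : (2 : ℝ) ^ |s * (1 - σ)| ≤ 2 ^ n := by
      rw [← Real.rpow_natCast]
      exact Real.rpow_le_rpow_of_exponent_le one_le_two ht
    refine le_trans ?_ h3
    rcases le_or_gt 0 (s * (1 - σ)) with h | h
    · rw [abs_of_nonneg h]
      exact Real.rpow_le_rpow hq.le hq1 h
    · rw [abs_of_neg h, Real.rpow_neg zero_le_two, ← Real.inv_rpow zero_le_two]
      exact Real.rpow_le_rpow_of_nonpos (by norm_num) (by simpa using hq2) h.le
  rw [Real.div_rpow hx.le hy.le, div_le_iff₀ (Real.rpow_pos_of_pos hy _)] at key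
  rw [scale, ← Real.rpow_mul hx.le, mul_comm (1 - σ) s]
  exact key

lemma ofReal_rpow_mul {ρ : ℝ} (hρ : 0 < ρ) (a b : ℝ) :
    ENNReal.ofReal (ρ ^ a) * ENNReal.ofReal (ρ ^ b) = ENNReal.ofReal (ρ ^ (a + b)) := by
  rw [← ENNReal.ofReal_mul (by positivity), Real.rpow_add hρ]

lemma eLpNorm_smul_le_restrict {c : E3 → ℝ} {M : ℝ} (hc : ∀ y, |c y| ≤ M) {B : Set E3}
    (hB : MeasurableSet B) (hcB : Function.support c ⊆ B) (f : E3 → 𝒢) (p : ℝ≥0∞) :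
    eLpNorm (fun y => c y • f y) p ≤ ENNReal.ofReal M * eLpNorm f p (volume.restrict B) := by
  have h : B.indicator (fun y => c y • f y) = fun y => c y • f y :=
    Set.indicator_eq_self.mpr fun y hy => hcB fun h0 => hy (by simp [h0])
  rw [← h, eLpNorm_indicator_eq_eLpNorm_restrict hB]
  refine eLpNorm_le_mul_eLpNorm_of_ae_le_mul (Eventually.of_forall fun y => ?_) p
  rw [norm_smul, Real.norm_eq_abs]
  gcongr
  exact hc y

/-- The Leibniz rule for weak covariant derivatives. -/
lemma IsWeakCovDeriv.smooth_smul {A : Fin 3 → E3 → 𝒢} {k : Fin 3} {F G : E3 → 𝒢}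
    (h : IsWeakCovDeriv A k F G) {χ : E3 → ℝ} (hχ : ContDiff ℝ ∞ χ) :
    IsWeakCovDeriv A k (fun x => χ x • F x)
      (fun x => χ x • G x + fderiv ℝ χ x (unitVec k) • F x) := by
  refine ⟨by simpa using locallyIntegrable_smul hχ.continuous h.bracket, ?_⟩
  refine (h.weakDeriv.smooth_smul hχ).congr_ae EventuallyEq.rfl (Eventually.of_forall fun x => ?_)
  simp only [smul_sub, lie_smul]
  abel

/-! ### Local estimates -/

section Local

variable {A : Fin 3 → E3 → 𝒢} {σ : ℝ} {n : ℕ} {Φ : E3 → 𝒢} {D : List (Fin 3) → E3 → 𝒢}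

lemma eLpNorm_weight_smul_le_jetNorm (σ : ℝ) {α : List (Fin 3)} (h1 : 1 ≤ α.length)
    (hn : α.length ≤ n) :
    eLpNorm (fun x => weight x ^ (((α.length : ℝ) - 3 / 2) * (1 - σ)) • D α x) 2 ≤
      jetNorm σ n D := by
  unfold jetNorm
  rw [← ENNReal.rpow_le_rpow_iff (z := 2) (by norm_num), ← ENNReal.rpow_mul]
  norm_num
  refine le_trans ?_ (Finset.single_le_sum (f := fun p : ℕ => ∑ α : Fin p → Fin 3,
    eLpNorm (fun x => weight x ^ (((p : ℝ) - 3 / 2) * (1 - σ)) • D (List.ofFn α) x) 2 volume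
      ^ (2 : ℕ)) (fun _ _ => zero_le) (Finset.mem_Icc.mpr ⟨h1, hn⟩))
  refine le_trans ?_ (Finset.single_le_sum (f := fun β : Fin α.length → Fin 3 =>
    eLpNorm (fun x => weight x ^ (((α.length : ℝ) - 3 / 2) * (1 - σ)) • D (List.ofFn β) x) 2 volume
      ^ (2 : ℕ)) (fun _ _ => zero_le) (Finset.mem_univ α.get))
  rw [List.ofFn_get]

lemma IsCovJet.aesm (hD : IsCovJet A n Φ D) {α : List (Fin 3)} (h1 : 1 ≤ α.length)
    (hn : α.length ≤ n) : AEStronglyMeasurable (D α) volume :=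
  hD.aestronglyMeasurable (by rintro rfl; simp at h1) hn

/-- The scaled `L²` estimate on a ball of the size of the length scale. -/
lemma eLpNorm_two_closedBall_le (hσ₀ : 0 < σ) (hσ₁ : σ ≤ 1) (x : E3) {α : List (Fin 3)}
    (h1 : 1 ≤ α.length) (hn : α.length ≤ n) :
    eLpNorm (D α) 2 (volume.restrict (Metric.closedBall x (scale σ x / 4))) ≤
      2 ^ n * (ENNReal.ofReal (scale σ x ^ (3 / 2 - (α.length : ℝ))) * jetNorm σ n D) := by
  set s : ℝ := (α.length : ℝ) - 3 / 2 with hs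
  have h1' : (1 : ℝ) ≤ α.length := by exact_mod_cast h1
  have hn' : (α.length : ℝ) ≤ n := by exact_mod_cast hn
  have hsn : |s| ≤ n := abs_le.mpr ⟨by linarith, by linarith⟩
  have hρ := scale_pos σ x
  have h := eLpNorm_le_mul_eLpNorm_of_ae_le_mul
    (μ := volume.restrict (Metric.closedBall x (scale σ x / 4)))
    (f := D α) (g := fun y => weight y ^ (s * (1 - σ)) • D α y)
    (c := 2 ^ n * scale σ x ^ (-s))
    ((ae_restrict_iff' Metric.isClosed_closedBall.measurableSet).mpr
      (Eventually.of_forall fun y hy => ?_)) 2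
  · refine h.trans ?_
    rw [ENNReal.ofReal_mul (by positivity), ENNReal.ofReal_pow (by norm_num),
      ENNReal.ofReal_ofNat, mul_assoc, show -s = 3 / 2 - (α.length : ℝ) by rw [hs]; ring]
    gcongr
    exact (eLpNorm_mono_measure _ Measure.restrict_le_self).trans
      (eLpNorm_weight_smul_le_jetNorm σ h1 hn)
  · have hw := Real.rpow_pos_of_pos (weight_pos y) (s * (1 - σ))
    rw [norm_smul, Real.norm_of_nonneg hw.le, ← mul_assoc]
    refine le_mul_of_one_le_left (norm_nonneg _) ?_
    have := scale_rpow_le hσ₀ hσ₁ hy hsn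
    rw [Real.rpow_neg hρ.le, mul_right_comm, mul_comm (_ * _), ← div_eq_inv_mul,
      one_le_div (by positivity)]
    exact this

lemma eLpNorm_cutoff_le {k : Fin 3} {F G : E3 → 𝒢} {χ : E3 → ℝ} {x : E3} {r M : ℝ}
    (hF : AEStronglyMeasurable F) (hG : AEStronglyMeasurable G) (hχ : ContDiff ℝ ∞ χ)
    (h1 : ∀ y, |χ y| ≤ 1) (h2 : ∀ y, |fderiv ℝ χ y (unitVec k)| ≤ M)
    (hs : tsupport χ ⊆ Metric.closedBall x r) {p : ℝ≥0∞} (hp : 1 ≤ p) :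
    eLpNorm (fun y => χ y • G y + fderiv ℝ χ y (unitVec k) • F y) p ≤
      eLpNorm G p (volume.restrict (Metric.closedBall x r)) +
        ENNReal.ofReal M * eLpNorm F p (volume.restrict (Metric.closedBall x r)) := by
  have hd : Continuous fun y => fderiv ℝ χ y (unitVec k) :=
    continuous_fderiv_apply (hχ.of_le (by simp)) _
  refine (eLpNorm_add_le (hχ.continuous.aestronglyMeasurable.smul hG)
    (hd.aestronglyMeasurable.smul hF) hp).trans (add_le_add ?_ ?_)
  · have := eLpNorm_smul_le_restrict h1 Metric.isClosed_closedBall.measurableSet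
      ((subset_tsupport χ).trans hs) G p
    rw [ENNReal.ofReal_one, one_mul] at this
    exact this
  · refine eLpNorm_smul_le_restrict h2 Metric.isClosed_closedBall.measurableSet ?_ F p
    refine Set.Subset.trans (fun y hy => ?_) hs
    exact support_fderiv_subset ℝ fun h0 => hy (by simp [h0])

/-- The scaled `L⁶` estimate on a ball of the size of the length scale. -/
lemma exists_eLpNorm_six_closedBall_le (n : ℕ) : ∃ K : ℝ≥0∞, K ≠ ⊤ ∧
    ∀ (A : Fin 3 → E3 → 𝒢) (σ : ℝ) (Φ : E3 → 𝒢) (D : List (Fin 3) → E3 → 𝒢),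
    (∀ k, Continuous (A k)) → 0 < σ → σ ≤ 1 → IsCovJet A n Φ D → jetNorm σ n D ≠ ⊤ →
    ∀ (x : E3) (α : List (Fin 3)), 1 ≤ α.length → α.length < n →
    eLpNorm (D α) 6 (volume.restrict (Metric.closedBall x (scale σ x / 8))) ≤
      K * (ENNReal.ofReal (scale σ x ^ (1 / 2 - (α.length : ℝ))) * jetNorm σ n D) := by
  obtain ⟨L, hL0, hL⟩ := exists_scaled_cutoff
  refine ⟨sobConst * (3 * (2 ^ n + ENNReal.ofReal (8 * L) * 2 ^ n)), ?_, ?_⟩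
  · exact ENNReal.mul_ne_top ENNReal.coe_ne_top (ENNReal.mul_ne_top (by norm_num)
      (ENNReal.add_ne_top.mpr ⟨by simp, ENNReal.mul_ne_top ENNReal.ofReal_ne_top (by simp)⟩))
  intro A σ Φ D hA hσ₀ hσ₁ hD hN x α h1 hn
  set ρ := scale σ x
  have hρ : 0 < ρ := scale_pos σ x
  set N := jetNorm σ n D
  obtain ⟨χ, χs, χle, χ1, χsupp, χd⟩ := hL x (ρ / 8) (by positivity)
  rw [show 2 * (ρ / 8) = ρ / 4 by ring] at χsupp
  have χc : HasCompactSupport χ :=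
    (isCompact_closedBall x (ρ / 4)).of_isClosed_subset (isClosed_tsupport χ) χsupp
  have m0 := hD.aesm h1 hn.le
  have m1 (k : Fin 3) : AEStronglyMeasurable (D (k :: α)) volume :=
    hD.aesm (by simp) (by simpa using hn)
  have e0 : eLpNorm (D α) 2 (volume.restrict (Metric.closedBall x (ρ / 4))) ≤
      2 ^ n * (ENNReal.ofReal (ρ ^ (3 / 2 - (α.length : ℝ))) * N) :=
    eLpNorm_two_closedBall_le hσ₀ hσ₁ x h1 hn.le
  have e1 (k : Fin 3) : eLpNorm (D (k :: α)) 2 (volume.restrict (Metric.closedBall x (ρ / 4))) ≤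
      2 ^ n * (ENNReal.ofReal (ρ ^ (1 / 2 - (α.length : ℝ))) * N) := by
    refine (eLpNorm_two_closedBall_le hσ₀ hσ₁ x (by simp) (by simpa using hn)).trans (le_of_eq ?_)
    rw [List.length_cons, Nat.cast_add, Nat.cast_one,
      show (3 / 2 - ((α.length : ℝ) + 1)) = 1 / 2 - (α.length : ℝ) by ring]
  have eL : ENNReal.ofReal (L / (ρ / 8)) = ENNReal.ofReal (8 * L) * ENNReal.ofReal (ρ ^ (-1 : ℝ)) := by
    rw [← ENNReal.ofReal_mul (by positivity), Real.rpow_neg_one]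
    congr 1
    field_simp
  have eH (k : Fin 3) : eLpNorm (fun y => χ y • D (k :: α) y +
      fderiv ℝ χ y (unitVec k) • D α y) 2 ≤ (2 ^ n + ENNReal.ofReal (8 * L) * 2 ^ n) *
        (ENNReal.ofReal (ρ ^ (1 / 2 - (α.length : ℝ))) * N) := by
    refine (eLpNorm_cutoff_le m0 (m1 k) χs χle (fun y => χd y k) χsupp (by norm_num)).trans ?_
    refine (add_le_add (e1 k) (mul_le_mul_right e0 _)).trans (le_of_eq ?_)
    rw [eL, show (1 / 2 - (α.length : ℝ)) = -1 + (3 / 2 - (α.length : ℝ)) by ring,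
      ← ofReal_rpow_mul hρ]
    ring
  have fin (q : ℝ) : ENNReal.ofReal (ρ ^ q) * N ≠ ⊤ := ENNReal.mul_ne_top ENNReal.ofReal_ne_top hN
  have hu : MemLp (fun y => χ y • D α y) 2 := by
    refine ⟨χs.continuous.aestronglyMeasurable.smul m0, ?_⟩
    refine (eLpNorm_smul_le_restrict χle Metric.isClosed_closedBall.measurableSet
      ((subset_tsupport χ).trans χsupp) (D α) 2).trans_lt ?_
    refine ENNReal.mul_lt_top ENNReal.ofReal_lt_top (e0.trans_lt ?_)
    exact ENNReal.mul_lt_top (by simp) (fin _).lt_top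
  have hd (k : Fin 3) : Continuous fun y => fderiv ℝ χ y (unitVec k) :=
    continuous_fderiv_apply (χs.of_le (by simp)) _
  have hH (k : Fin 3) : MemLp (fun y => χ y • D (k :: α) y +
      fderiv ℝ χ y (unitVec k) • D α y) 2 := by
    refine ⟨(χs.continuous.aestronglyMeasurable.smul (m1 k)).add
      ((hd k).aestronglyMeasurable.smul m0), (eH k).trans_lt (ENNReal.mul_lt_top ?_ (fin _).lt_top)⟩
    exact ENNReal.add_lt_top.mpr ⟨by simp, ENNReal.mul_lt_top ENNReal.ofReal_lt_top (by simp)⟩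
  have key := eLpNorm_six_le hA (χc.smul_right (f' := D α)) hu hH
    fun k => (hD.cons k α hn).smooth_smul χs
  have hle : eLpNorm (D α) 6 (volume.restrict (Metric.closedBall x (ρ / 8))) ≤
      eLpNorm (fun y => χ y • D α y) 6 := by
    refine le_trans (eLpNorm_mono_ae ?_) (eLpNorm_mono_measure _ Measure.restrict_le_self)
    refine (ae_restrict_iff' Metric.isClosed_closedBall.measurableSet).mpr
      (Eventually.of_forall fun y hy => ?_)
    simp [χ1 y hy]
  refine hle.trans (key.trans ?_)
  refine (mul_le_mul_right (Finset.sum_le_sum fun k _ => eH k) _).trans (le_of_eq ?_)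
  simp only [Finset.sum_const, Finset.card_univ, Fintype.card_fin, nsmul_eq_mul]
  push_cast
  ring

/-- The pointwise estimate for covariant derivatives of positive order: the ray integral of the
gradient is estimated after multiplication with a cutoff at the length scale. -/
lemma exists_enorm_le_of_pos (n : ℕ) : ∃ K : ℝ≥0∞, K ≠ ⊤ ∧
    ∀ (A : Fin 3 → E3 → 𝒢) (σ : ℝ) (Φ : E3 → 𝒢) (D : List (Fin 3) → E3 → 𝒢),
    (∀ k, Continuous (A k)) → 0 < σ → σ ≤ 1 → IsCovJet A n Φ D → jetNorm σ n D ≠ ⊤ →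
    ∀ (x : E3) (α : List (Fin 3)), 1 ≤ α.length → α.length + 2 ≤ n → Continuous (D α) →
    ballVolume * ‖D α x‖ₑ ≤
      K * (ENNReal.ofReal (scale σ x ^ (-(α.length : ℝ))) * jetNorm σ n D) := by
  obtain ⟨K, hK, hK6⟩ := exists_eLpNorm_six_closedBall_le (𝒢 := 𝒢) n
  obtain ⟨L, hL0, hL⟩ := exists_scaled_cutoff
  set c : ℝ≥0∞ := ENNReal.ofReal (16 * L)
  refine ⟨rayConst * (3 * (K + c * K) + 3 * (2 ^ n + c * 2 ^ n)), ?_, ?_⟩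
  · have hc : c ≠ ⊤ := ENNReal.ofReal_ne_top
    have h2 : (2 : ℝ≥0∞) ^ n ≠ ⊤ := by simp
    have h3 : (3 : ℝ≥0∞) ≠ ⊤ := by simp
    have hr := rayConst_ne_top
    finiteness
  intro A σ Φ D hA hσ₀ hσ₁ hD hN x α h1 hn hcont
  set ρ := scale σ x
  have hρ : 0 < ρ := scale_pos σ x
  set N := jetNorm σ n D
  set p : ℝ := (α.length : ℝ) with hp
  obtain ⟨χ, χs, χle, χ1, χsupp, χd⟩ := hL x (ρ / 16) (by positivity)
  rw [show 2 * (ρ / 16) = ρ / 8 by ring] at χsupp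
  have χc : HasCompactSupport χ :=
    (isCompact_closedBall x (ρ / 8)).of_isClosed_subset (isClosed_tsupport χ) χsupp
  have m1 (k : Fin 3) : AEStronglyMeasurable (D (k :: α)) volume :=
    hD.aesm (by simp) (by simp; omega)
  have eL : ENNReal.ofReal (L / (ρ / 16)) = c * ENNReal.ofReal (ρ ^ (-1 : ℝ)) := by
    rw [← ENNReal.ofReal_mul (by positivity), Real.rpow_neg_one]
    congr 1
    field_simp
  have mono (f : E3 → 𝒢) (q : ℝ≥0∞) : eLpNorm f q (volume.restrict (Metric.closedBall x (ρ / 8))) ≤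
      eLpNorm f q (volume.restrict (Metric.closedBall x (ρ / 4))) :=
    eLpNorm_mono_measure f (Measure.restrict_mono (Metric.closedBall_subset_closedBall
      (by linarith)) le_rfl)
  have hlen (k : Fin 3) : ((k :: α).length : ℝ) = p + 1 := by simp [hp]
  have a2 : eLpNorm (D α) 2 (volume.restrict (Metric.closedBall x (ρ / 8))) ≤
      2 ^ n * (ENNReal.ofReal (ρ ^ (3 / 2 - p)) * N) :=
    (mono _ _).trans (eLpNorm_two_closedBall_le hσ₀ hσ₁ x h1 (by omega))
  have a6 : eLpNorm (D α) 6 (volume.restrict (Metric.closedBall x (ρ / 8))) ≤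
      K * (ENNReal.ofReal (ρ ^ (1 / 2 - p)) * N) := hK6 A σ Φ D hA hσ₀ hσ₁ hD hN x α h1 (by omega)
  have b2 (k : Fin 3) : eLpNorm (D (k :: α)) 2 (volume.restrict (Metric.closedBall x (ρ / 8))) ≤
      2 ^ n * (ENNReal.ofReal (ρ ^ (3 / 2 - (p + 1))) * N) := by
    rw [← hlen k]
    exact (mono _ _).trans (eLpNorm_two_closedBall_le hσ₀ hσ₁ x (by simp) (by simp; omega))
  have b6 (k : Fin 3) : eLpNorm (D (k :: α)) 6 (volume.restrict (Metric.closedBall x (ρ / 8))) ≤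
      K * (ENNReal.ofReal (ρ ^ (1 / 2 - (p + 1))) * N) := by
    rw [← hlen k]
    exact hK6 A σ Φ D hA hσ₀ hσ₁ hD hN x (k :: α) (by simp) (by simp; omega)
  set H : Fin 3 → E3 → 𝒢 := fun k y => χ y • D (k :: α) y + fderiv ℝ χ y (unitVec k) • D α y
  have eH2 (k : Fin 3) : eLpNorm (H k) 2 ≤
      (2 ^ n + c * 2 ^ n) * (ENNReal.ofReal (ρ ^ (1 / 2 - p)) * N) := by
    refine (eLpNorm_cutoff_le hcont.aestronglyMeasurable (m1 k) χs χle (fun y => χd y k) χsupp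
      (by norm_num)).trans ?_
    refine (add_le_add (b2 k) (mul_le_mul_right a2 _)).trans (le_of_eq ?_)
    rw [eL, show (3 / 2 - (p + 1)) = -1 + (3 / 2 - p) by ring,
      show (1 / 2 - p) = -1 + (3 / 2 - p) by ring, ← ofReal_rpow_mul hρ]
    ring
  have eH6 (k : Fin 3) : eLpNorm (H k) 6 ≤
      (K + c * K) * (ENNReal.ofReal (ρ ^ (-1 / 2 - p)) * N) := by
    refine (eLpNorm_cutoff_le hcont.aestronglyMeasurable (m1 k) χs χle (fun y => χd y k) χsupp
      (by norm_num)).trans ?_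
    refine (add_le_add (b6 k) (mul_le_mul_right a6 _)).trans (le_of_eq ?_)
    rw [eL, show (1 / 2 - (p + 1)) = -1 + (1 / 2 - p) by ring,
      show (-1 / 2 - p) = -1 + (1 / 2 - p) by ring, ← ofReal_rpow_mul hρ]
    ring
  have hd (k : Fin 3) : Continuous fun y => fderiv ℝ χ y (unitVec k) :=
    continuous_fderiv_apply (χs.of_le (by simp)) _
  have mH (k : Fin 3) : AEStronglyMeasurable (H k) volume :=
    (χs.continuous.aestronglyMeasurable.smul (m1 k)).add
      ((hd k).aestronglyMeasurable.smul hcont.aestronglyMeasurable)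
  have hH2 (k : Fin 3) : MemLp (H k) 2 := by
    refine ⟨mH k, (eH2 k).trans_lt ?_⟩
    have hc : c ≠ ⊤ := ENNReal.ofReal_ne_top
    have h2 : (2 : ℝ≥0∞) ^ n ≠ ⊤ := by simp
    finiteness
  have hH6 (k : Fin 3) : MemLp (H k) 6 := by
    refine ⟨mH k, (eH6 k).trans_lt ?_⟩
    have hc : c ≠ ⊤ := ENNReal.ofReal_ne_top
    finiteness
  have key := ballVolume_mul_enorm_le_rayIntegral hA (χc.smul_right (f' := D α))
    (χs.continuous.smul hcont) hH2 hH6 (fun k => (hD.cons k α (by omega)).smooth_smul χs) x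
  have hx1 : χ x = 1 := χ1 x (Metric.mem_closedBall_self (by positivity))
  simp only [hx1, one_smul, Pi.smul_apply'] at key
  refine key.trans ((rayIntegral_le (aestronglyMeasurable_normSum mH) x hρ).trans ?_)
  have s6 : eLpNorm (normSum H) 6 ≤
      3 * ((K + c * K) * (ENNReal.ofReal (ρ ^ (-1 / 2 - p)) * N)) := by
    refine ((eLpNorm_normSum_le (by norm_num) mH).trans
      (Finset.sum_le_sum fun k _ => eH6 k)).trans (le_of_eq ?_)
    simp
  have s2 : eLpNorm (normSum H) 2 ≤
      3 * ((2 ^ n + c * 2 ^ n) * (ENNReal.ofReal (ρ ^ (1 / 2 - p)) * N)) := by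
    refine ((eLpNorm_normSum_le (by norm_num) mH).trans
      (Finset.sum_le_sum fun k _ => eH2 k)).trans (le_of_eq ?_)
    simp
  have r1 : ENNReal.ofReal (ρ ^ (1 / 2 : ℝ)) * ENNReal.ofReal (ρ ^ (-1 / 2 - p)) =
      ENNReal.ofReal (ρ ^ (-p)) := by
    rw [ofReal_rpow_mul hρ]
    congr 2
    ring
  have r2 : ENNReal.ofReal (ρ ^ (-1 / 2 : ℝ)) * ENNReal.ofReal (ρ ^ (1 / 2 - p)) =
      ENNReal.ofReal (ρ ^ (-p)) := by
    rw [ofReal_rpow_mul hρ]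
    congr 2
    ring
  calc _ ≤ rayConst * (ENNReal.ofReal (ρ ^ (1 / 2 : ℝ)) *
          (3 * ((K + c * K) * (ENNReal.ofReal (ρ ^ (-1 / 2 - p)) * N))) +
        ENNReal.ofReal (ρ ^ (-1 / 2 : ℝ)) *
          (3 * ((2 ^ n + c * 2 ^ n) * (ENNReal.ofReal (ρ ^ (1 / 2 - p)) * N)))) := by
        gcongr
    _ = rayConst * (3 * (K + c * K) * (ENNReal.ofReal (ρ ^ (1 / 2 : ℝ)) *
          ENNReal.ofReal (ρ ^ (-1 / 2 - p)) * N) + 3 * (2 ^ n + c * 2 ^ n) *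
          (ENNReal.ofReal (ρ ^ (-1 / 2 : ℝ)) * ENNReal.ofReal (ρ ^ (1 / 2 - p)) * N)) := by
        ring
    _ = _ := by
        rw [r1, r2]
        ring

end Local

/-! ### The pointwise estimate without derivatives -/

lemma weight_rpow_half_le {σ : ℝ} (hσ₀ : 0 < σ) (hσ₁ : σ ≤ 1) {x y : E3} {t : ℝ}
    (hy : dist y x < t) :
    weight y ^ ((1 - σ) / 2) ≤ scale σ x ^ (1 / 2 : ℝ) + t ^ ((1 - σ) / 2) := by
  have ht : 0 ≤ t := dist_nonneg.trans hy.le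
  have h0 : 0 ≤ (1 - σ) / 2 := by linarith
  calc weight y ^ ((1 - σ) / 2) ≤ (weight x + t) ^ ((1 - σ) / 2) :=
        Real.rpow_le_rpow (weight_pos y).le ((weight_le_add x y).trans (by linarith)) h0
    _ ≤ weight x ^ ((1 - σ) / 2) + t ^ ((1 - σ) / 2) :=
        Real.rpow_add_le_add_rpow (weight_pos x).le ht h0 (by linarith)
    _ = _ := by
        rw [scale, ← Real.rpow_mul (weight_pos x).le]
        congr 2
        ring

/-- The weighted integral over the far part of the rays. It converges because `σ > 0`. -/
lemma lintegral_far_weight_le {σ : ℝ} (hσ₀ : 0 < σ) (hσ₁ : σ ≤ 1) {ρ : ℝ} (hρ : 1 ≤ ρ) :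
    ∫⁻ t in Set.Ioi (ρ / 8), ENNReal.ofReal (t ^ (-3 / 2 : ℝ)) *
      ENNReal.ofReal (ρ ^ (1 / 2 : ℝ) + t ^ ((1 - σ) / 2)) ≤ ENNReal.ofReal (16 + 16 / σ) := by
  have hR : 0 < ρ / 8 := by linarith
  have hρ0 : 0 < ρ := by linarith
  have e : ∫⁻ t in Set.Ioi (ρ / 8), ENNReal.ofReal (t ^ (-3 / 2 : ℝ)) *
      ENNReal.ofReal (ρ ^ (1 / 2 : ℝ) + t ^ ((1 - σ) / 2)) =
      ∫⁻ t in Set.Ioi (ρ / 8), (ENNReal.ofReal (ρ ^ (1 / 2 : ℝ)) * ENNReal.ofReal (t ^ (-3 / 2 : ℝ)) +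
        ENNReal.ofReal (t ^ (-1 - σ / 2))) := by
    refine setLIntegral_congr_fun measurableSet_Ioi fun t ht => ?_
    have ht0 : 0 < t := hR.trans ht
    rw [ENNReal.ofReal_add (by positivity) (by positivity), mul_add, ofReal_rpow_mul ht0, mul_comm,
      show (-3 / 2 + (1 - σ) / 2 : ℝ) = -1 - σ / 2 by ring]
  rw [e, lintegral_add_left (by fun_prop), lintegral_const_mul _ (by fun_prop),
    lintegral_Ioi_rpow (by norm_num) hR, lintegral_Ioi_rpow (by linarith) hR,
    ← ENNReal.ofReal_mul (by positivity)]
  have h8 : (8 : ℝ) ^ (1 / 2 : ℝ) ≤ 8 := by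
    calc _ ≤ (8 : ℝ) ^ (1 : ℝ) := Real.rpow_le_rpow_of_exponent_le (by norm_num) (by norm_num)
      _ = 8 := Real.rpow_one _
  have h1 : ρ ^ (1 / 2 : ℝ) * (-(ρ / 8) ^ (-3 / 2 + 1 : ℝ) / (-3 / 2 + 1)) ≤ 16 := by
    rw [show (-3 / 2 + 1 : ℝ) = -(1 / 2) by norm_num, Real.div_rpow hρ0.le (by norm_num),
      Real.rpow_neg hρ0.le, Real.rpow_neg (by norm_num)]
    have : 0 < ρ ^ (1 / 2 : ℝ) := by positivity
    field_simp
    linarith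
  have h2 : -(ρ / 8) ^ (-1 - σ / 2 + 1) / (-1 - σ / 2 + 1) ≤ 16 / σ := by
    have h3 : (ρ / 8) ^ (-(σ / 2)) ≤ 8 := by
      calc (ρ / 8) ^ (-(σ / 2)) ≤ (1 / 8 : ℝ) ^ (-(σ / 2)) :=
            Real.rpow_le_rpow_of_nonpos (by norm_num) (by linarith) (by linarith)
        _ = (8 : ℝ) ^ (σ / 2) := by
            rw [one_div, Real.inv_rpow (by norm_num), Real.rpow_neg (by norm_num), inv_inv]
        _ ≤ (8 : ℝ) ^ (1 : ℝ) := Real.rpow_le_rpow_of_exponent_le (by norm_num) (by linarith)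
        _ = 8 := Real.rpow_one _
    rw [show (-1 - σ / 2 + 1 : ℝ) = -(σ / 2) by ring, neg_div_neg_eq,
      div_le_div_iff₀ (by linarith) hσ₀]
    nlinarith
  have hp2 : 0 ≤ -(ρ / 8) ^ (-1 - σ / 2 + 1) / (-1 - σ / 2 + 1) := by
    rw [show (-1 - σ / 2 + 1 : ℝ) = -(σ / 2) by ring, neg_div_neg_eq]
    positivity
  exact (add_le_add (ENNReal.ofReal_le_ofReal h1) (ENNReal.ofReal_le_ofReal h2)).trans
    (ENNReal.ofReal_add (by norm_num) (by positivity)).ge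

/-- The pointwise estimate of `Φ` itself. No local `L²` norm of `Φ` is at hand, so no cutoff can be
used; the part of the ray integral beyond the length scale is estimated with the weight. -/
lemma exists_enorm_le_zero {n : ℕ} (hn : 2 ≤ n) {σ : ℝ} (hσ₀ : 0 < σ) (hσ₁ : σ ≤ 1) :
    ∃ K : ℝ≥0∞, K ≠ ⊤ ∧
    ∀ (A : Fin 3 → E3 → 𝒢) (Φ : E3 → 𝒢) (D : List (Fin 3) → E3 → 𝒢),
    (∀ k, Continuous (A k)) → IsCovJet A n Φ D → jetNorm σ n D ≠ ⊤ →
    Continuous Φ → HasCompactSupport Φ → (∀ k, MemLp (D [k]) 2) → (∀ k, MemLp (D [k]) 6) →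
    ∀ x, ballVolume * ‖Φ x‖ₑ ≤ K * jetNorm σ n D := by
  obtain ⟨K, hK, hK6⟩ := exists_eLpNorm_six_closedBall_le (𝒢 := 𝒢) n
  refine ⟨ballVolume ^ (5 / 6 : ℝ) * (2 * (3 * K)) +
    ballVolume ^ (1 / 2 : ℝ) * (3 * ENNReal.ofReal (16 + 16 / σ)), ?_, ?_⟩
  · have h1 := ENNReal.rpow_ne_top_of_nonneg (y := 5 / 6) (by norm_num) ballVolume_ne_top
    have h2 := ENNReal.rpow_ne_top_of_nonneg (y := 1 / 2) (by norm_num) ballVolume_ne_top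
    have h3 : (3 : ℝ≥0∞) ≠ ⊤ := by simp
    finiteness
  intro A Φ D hA hD hN hΦ hc hH2 hH6 x
  set ρ := scale σ x
  have hρ1 : 1 ≤ ρ := one_le_scale hσ₁ x
  have hρ : 0 < ρ := scale_pos σ x
  set N := jetNorm σ n D
  set H : Fin 3 → E3 → 𝒢 := fun k => D [k]
  have mH : AEStronglyMeasurable (normSum H) volume :=
    aestronglyMeasurable_normSum fun k => (hH2 k).1
  have key := ballVolume_mul_enorm_le_rayIntegral hA hc hΦ hH2 hH6
    (fun k => by simpa [hD.nil] using hD.cons k [] (by simp; omega)) x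
  rw [rayIntegral_eq_add _ x (R := ρ / 8) (by positivity)] at key
  have six : eLpNorm (normSum H) 6 (volume.restrict (Metric.ball x (ρ / 8))) ≤
      3 * (K * (ENNReal.ofReal (ρ ^ (-1 / 2 : ℝ)) * N)) := by
    refine (eLpNorm_normSum_le (by norm_num) fun k => (hH2 k).1.restrict).trans
      ((Finset.sum_le_sum (g := fun _ => K * (ENNReal.ofReal (ρ ^ (-1 / 2 : ℝ)) * N))
        fun k _ => ?_).trans (le_of_eq (by simp)))
    · refine (eLpNorm_mono_measure _ (Measure.restrict_mono Metric.ball_subset_closedBall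
        le_rfl)).trans ((hK6 A σ Φ D hA hσ₀ hσ₁ hD hN x [k] (by simp) (by simp; omega)).trans
        (le_of_eq ?_))
      norm_num
      rfl
  have near := (lintegral_near_le mH x (R := ρ / 8) (by positivity)).trans
    (mul_le_mul_right (mul_le_mul_right six _) _)
  have two (t : ℝ) (ht : ρ / 8 < t) :
      eLpNorm (normSum H) 2 (volume.restrict (Metric.ball x t)) ≤
        ENNReal.ofReal (ρ ^ (1 / 2 : ℝ) + t ^ ((1 - σ) / 2)) * (3 * N) := by
    have ht0 : 0 < t := lt_trans (by positivity) ht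
    refine (eLpNorm_normSum_le (by norm_num) fun k => (hH2 k).1.restrict).trans
      ((Finset.sum_le_sum
        (g := fun _ => ENNReal.ofReal (ρ ^ (1 / 2 : ℝ) + t ^ ((1 - σ) / 2)) * N)
        fun k _ => ?_).trans (le_of_eq ?_))
    · have hw := eLpNorm_weight_smul_le_jetNorm (n := n) (D := D) σ (α := [k]) (by simp)
        (by simp; omega)
      refine (eLpNorm_le_mul_eLpNorm_of_ae_le_mul
        (g := fun y => weight y ^ ((([k].length : ℝ) - 3 / 2) * (1 - σ)) • D [k] y)
        ((ae_restrict_iff' Metric.isOpen_ball.measurableSet).mpr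
          (Eventually.of_forall fun y hy => ?_)) 2).trans (mul_le_mul_right
          ((eLpNorm_mono_measure _ Measure.restrict_le_self).trans hw) _)
      have hy' := weight_rpow_half_le hσ₀ hσ₁ (Metric.mem_ball.mp hy)
      have e : ((([k].length : ℝ) - 3 / 2) * (1 - σ)) = -((1 - σ) / 2) := by
        simp
        ring
      have hwy := Real.rpow_pos_of_pos (weight_pos y) ((1 - σ) / 2)
      rw [e, norm_smul, Real.rpow_neg (weight_pos y).le, norm_inv, Real.norm_of_nonneg hwy.le,
        ← mul_assoc]
      refine le_mul_of_one_le_left (norm_nonneg _) ?_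
      rw [← div_eq_mul_inv, one_le_div hwy]
      exact hy'
    · simp
      ring
  have far := lintegral_far_le mH x (R := ρ / 8) (by positivity) two
  simp only [← mul_assoc _ _ ((3 : ℝ≥0∞) * N)] at far
  rw [lintegral_mul_const _ (by fun_prop)] at far
  have far' := far.trans (mul_le_mul_right (mul_le_mul_left (lintegral_far_weight_le hσ₀ hσ₁ hρ1) _) _)
  refine key.trans ((add_le_add near far').trans ?_)
  have r : ENNReal.ofReal (2 * (ρ / 8) ^ (1 / 2 : ℝ)) * ENNReal.ofReal (ρ ^ (-1 / 2 : ℝ)) ≤ 2 := by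
    rw [← ENNReal.ofReal_mul (by positivity)]
    refine (ENNReal.ofReal_le_ofReal ?_).trans (ENNReal.ofReal_ofNat 2).le
    have h1 : (ρ / 8) ^ (1 / 2 : ℝ) ≤ ρ ^ (1 / 2 : ℝ) :=
      Real.rpow_le_rpow (by positivity) (by linarith) (by norm_num)
    have h2 : ρ ^ (1 / 2 : ℝ) * ρ ^ (-1 / 2 : ℝ) = 1 := by
      rw [← Real.rpow_add hρ]
      norm_num
    have h3 : 0 < ρ ^ (-1 / 2 : ℝ) := by positivity
    nlinarith
  calc _ = ballVolume ^ (5 / 6 : ℝ) * ((ENNReal.ofReal (2 * (ρ / 8) ^ (1 / 2 : ℝ)) *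
          ENNReal.ofReal (ρ ^ (-1 / 2 : ℝ))) * (3 * K * N)) +
        ballVolume ^ (1 / 2 : ℝ) * (3 * ENNReal.ofReal (16 + 16 / σ)) * N := by ring
    _ ≤ ballVolume ^ (5 / 6 : ℝ) * (2 * (3 * K * N)) +
        ballVolume ^ (1 / 2 : ℝ) * (3 * ENNReal.ofReal (16 + 16 / σ)) * N := by gcongr
    _ = _ := by ring

/-! ### The supremum norm -/

lemma covDerivNorm_le_sum (A : Fin 3 → E3 → 𝒢) (p : ℕ) (Φ : E3 → 𝒢) (x : E3) :
    covDerivNorm A p Φ x ≤ ∑ α : Fin p → Fin 3, ‖covDerivs A (List.ofFn α) Φ x‖ := by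
  unfold covDerivNorm
  rw [Real.sqrt_le_left (Finset.sum_nonneg fun _ _ => norm_nonneg _)]
  exact Finset.sum_sq_le_sq_sum_of_nonneg fun _ _ => norm_nonneg _

lemma cbNorm_le {A : Fin 3 → E3 → 𝒢} {σ : ℝ} {m : ℕ} {Φ : E3 → 𝒢} {B : ℝ≥0∞}
    (h : ∀ α : List (Fin 3), α.length ≤ m → ∀ x,
      ENNReal.ofReal (scale σ x ^ (α.length : ℝ)) * ‖covDerivs A α Φ x‖ₑ ≤ B) :
    cbNorm A σ m Φ ≤ 3 ^ m * B := by
  refine iSup₂_le fun p hp => iSup_le fun x => ?_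
  have hw : weight x ^ ((p : ℝ) * (1 - σ)) = scale σ x ^ (p : ℝ) := by
    rw [scale, ← Real.rpow_mul (weight_pos x).le, mul_comm]
  have hs : 0 ≤ scale σ x ^ (p : ℝ) := Real.rpow_nonneg (scale_pos σ x).le _
  rw [hw]
  calc ENNReal.ofReal (scale σ x ^ (p : ℝ) * covDerivNorm A p Φ x)
      ≤ ENNReal.ofReal (∑ α : Fin p → Fin 3,
          scale σ x ^ (p : ℝ) * ‖covDerivs A (List.ofFn α) Φ x‖) := by
        rw [← Finset.mul_sum]
        exact ENNReal.ofReal_le_ofReal (mul_le_mul_of_nonneg_left (covDerivNorm_le_sum _ _ _ _) hs)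
    _ = ∑ α : Fin p → Fin 3, ENNReal.ofReal (scale σ x ^ (p : ℝ)) *
          ‖covDerivs A (List.ofFn α) Φ x‖ₑ := by
        rw [ENNReal.ofReal_sum_of_nonneg fun _ _ => by positivity]
        simp only [ENNReal.ofReal_mul hs, ofReal_norm]
    _ ≤ ∑ _α : Fin p → Fin 3, B := by
        refine Finset.sum_le_sum fun α _ => ?_
        have := h (List.ofFn α) (by simpa using hp) x
        rwa [List.length_ofFn] at this
    _ = 3 ^ p * B := by simp
    _ ≤ 3 ^ m * B := by
        gcongr
        norm_num

/-- The Sobolev inequality on `C^n_c`. -/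
lemma exists_enorm_covDerivs_le {n : ℕ} (hn : 2 ≤ n) {σ : ℝ} (hσ₀ : 0 < σ) (hσ₁ : σ ≤ 1)
    {A : Fin 3 → E3 → 𝒢} (hA : LocalAssumptions A n) : ∃ C : ℝ≥0, ∀ Φ : E3 → 𝒢,
    ContDiff ℝ n Φ → HasCompactSupport Φ → ∀ α : List (Fin 3), α.length ≤ n - 2 → ∀ x,
      ENNReal.ofReal (scale σ x ^ (α.length : ℝ)) * ‖covDerivs A α Φ x‖ₑ ≤
        C * sobNorm A σ n Φ := by
  obtain ⟨K₀, hK₀, h₀⟩ := exists_enorm_le_zero (𝒢 := 𝒢) hn hσ₀ hσ₁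
  obtain ⟨K₁, hK₁, h₁⟩ := exists_enorm_le_of_pos (𝒢 := 𝒢) n
  have hb0 := ballVolume_ne_zero
  have hb := ballVolume_ne_top
  have hC : ballVolume⁻¹ * (K₀ + K₁) ≠ ⊤ :=
    ENNReal.mul_ne_top (ENNReal.inv_ne_top.mpr hb0) (ENNReal.add_ne_top.mpr ⟨hK₀, hK₁⟩)
  refine ⟨(ballVolume⁻¹ * (K₀ + K₁)).toNNReal, fun Φ hΦ hc α hα x => ?_⟩
  rw [ENNReal.coe_toNNReal hC]
  have hcA := hA.continuous hn
  obtain ⟨hD, -⟩ := weakCovJet_spec hn hA hΦ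
  have hΦ2 : ContDiff ℝ (n - 2 : ℕ) Φ := hΦ.of_le (by exact_mod_cast Nat.sub_le n 2)
  have hfin := (sobNorm_lt_top hn hA σ hΦ hc).ne
  rw [sobNorm_eq hD] at hfin ⊢
  set N := jetNorm σ n (weakCovJet A Φ)
  suffices h : ballVolume * (ENNReal.ofReal (scale σ x ^ (α.length : ℝ)) * ‖covDerivs A α Φ x‖ₑ) ≤
      (K₀ + K₁) * N by
    rw [mul_assoc]
    exact (ENNReal.mul_le_iff_le_inv hb0 hb).mp h
  have e := weakCovJet_eq_covDerivs hn hA hΦ2 α hα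
  have hcont : Continuous (covDerivs A α Φ) := (contDiff_covDerivs hn hA hΦ2 α hα).continuous
  rcases Nat.eq_zero_or_pos α.length with h0 | hpos
  · obtain rfl := List.length_eq_zero_iff.mp h0
    have hΦ1 : ContDiff ℝ 1 Φ := hΦ.of_le (by exact_mod_cast (by omega : 1 ≤ n))
    have hae (k : Fin 3) : covDeriv A k Φ =ᵐ[volume] weakCovJet A Φ [k] :=
      (isWeakCovDeriv_covDeriv (hcA k) hΦ1).ae_eq (hD.cons k [] (by simp; omega))
    have hmem (k : Fin 3) (q : ℝ≥0∞) : MemLp (weakCovJet A Φ [k]) q := by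
      refine ((continuous_covDeriv (hcA k) hΦ1).memLp_of_hasCompactSupport ?_).ae_eq (hae k)
      refine (hc.fderiv_apply ℝ (unitVec k)).add (hc.mono fun y hy => ?_)
      intro h
      exact hy (by simp [h])
    have h := h₀ A Φ _ hcA hD hfin hΦ.continuous hc (fun k => hmem k 2) (fun k => hmem k 6) x
    simp only [List.length_nil, Nat.cast_zero, Real.rpow_zero, ENNReal.ofReal_one, one_mul]
    exact h.trans (by gcongr; exact le_self_add)
  · have h := h₁ A σ Φ _ hcA hσ₀ hσ₁ hD hfin x α hpos (by omega) (by rw [e]; exact hcont)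
    rw [e] at h
    have hs := scale_pos σ x
    calc _ = ENNReal.ofReal (scale σ x ^ (α.length : ℝ)) *
          (ballVolume * ‖covDerivs A α Φ x‖ₑ) := by ring
      _ ≤ ENNReal.ofReal (scale σ x ^ (α.length : ℝ)) *
          (K₁ * (ENNReal.ofReal (scale σ x ^ (-(α.length : ℝ))) * N)) := by gcongr
      _ = K₁ * ((ENNReal.ofReal (scale σ x ^ (α.length : ℝ)) *
          ENNReal.ofReal (scale σ x ^ (-(α.length : ℝ)))) * N) := by ring
      _ = K₁ * N := by
          rw [ofReal_rpow_mul hs, add_neg_cancel, Real.rpow_zero, ENNReal.ofReal_one, one_mul]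
      _ ≤ _ := by
          gcongr
          exact le_add_self

/-! ### Extension of the covariant derivatives to the completion -/

lemma covDeriv_add (A : Fin 3 → E3 → 𝒢) (k : Fin 3) {F G : E3 → 𝒢} (hF : Differentiable ℝ F)
    (hG : Differentiable ℝ G) : covDeriv A k (F + G) = covDeriv A k F + covDeriv A k G := by
  funext x
  simp only [covDeriv, Pi.add_apply, fderiv_add (hF x) (hG x), lie_add,
    add_apply]
  abel

lemma covDeriv_smul (A : Fin 3 → E3 → 𝒢) (k : Fin 3) (c : ℝ) (F : E3 → 𝒢) :
    covDeriv A k (c • F) = c • covDeriv A k F := by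
  funext x
  simp only [covDeriv, Pi.smul_apply, fderiv_const_smul_field, lie_smul, smul_add,
    smul_apply]

lemma covDerivs_smul (A : Fin 3 → E3 → 𝒢) (c : ℝ) (F : E3 → 𝒢) (α : List (Fin 3)) :
    covDerivs A α (c • F) = c • covDerivs A α F := by
  induction α with
  | nil => rfl
  | cons k α ih => simp only [covDerivs, ih, covDeriv_smul]

section Completion

variable {A : Fin 3 → E3 → 𝒢} {σ : ℝ} {n : ℕ}

lemma differentiable_covDerivs (hn : 2 ≤ n) (hA : LocalAssumptions A n) {Φ : E3 → 𝒢}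
    (hΦ : ContDiff ℝ (n - 2 : ℕ) Φ) (α : List (Fin 3)) (hα : α.length < n - 2) :
    Differentiable ℝ (covDerivs A α Φ) := by
  refine (contDiff_covDerivs hn hA hΦ α hα.le).differentiable ?_
  have : n - 2 - α.length ≠ 0 := by omega
  exact_mod_cast this

lemma covDerivs_add (hn : 2 ≤ n) (hA : LocalAssumptions A n) {Φ Ψ : E3 → 𝒢}
    (hΦ : ContDiff ℝ (n - 2 : ℕ) Φ) (hΨ : ContDiff ℝ (n - 2 : ℕ) Ψ) (α : List (Fin 3))
    (hα : α.length ≤ n - 2) :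
    covDerivs A α (Φ + Ψ) = covDerivs A α Φ + covDerivs A α Ψ := by
  induction α with
  | nil => rfl
  | cons k α ih =>
    have hα' : α.length < n - 2 := by simpa using hα
    simp only [covDerivs, ih hα'.le]
    exact covDeriv_add A k (differentiable_covDerivs hn hA hΦ α hα')
      (differentiable_covDerivs hn hA hΨ α hα')

lemma CcSpace.contDiff (Φ : CcSpace A σ n) : ContDiff ℝ n Φ.toFun := (Subtype.prop Φ).1

lemma CcSpace.contDiff_sub_two (Φ : CcSpace A σ n) : ContDiff ℝ (n - 2 : ℕ) Φ.toFun :=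
  Φ.contDiff.of_le (by exact_mod_cast Nat.sub_le n 2)

lemma CcSpace.hasCompactSupport (Φ : CcSpace A σ n) : HasCompactSupport Φ.toFun :=
  (Subtype.prop Φ).2.1

lemma CcSpace.enorm_eq (Φ : CcSpace A σ n) : ‖Φ‖ₑ = sobNorm A σ n Φ.toFun := by
  rw [← ofReal_norm]
  exact ENNReal.ofReal_toReal (Subtype.prop Φ).2.2.ne

/-- The covariant derivatives of order at most `n - 2` at a point extend to the completion, and so
does the Sobolev inequality. -/
lemma exists_extension (hn : 2 ≤ n) (hσ₀ : 0 < σ) (hσ₁ : σ ≤ 1) (hA : LocalAssumptions A n) :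
    ∃ (C : ℝ≥0) (E : List (Fin 3) → E3 → HSpace A σ n →ₗ[ℝ] 𝒢),
      (∀ α, α.length ≤ n - 2 → ∀ x (Φ : CcSpace A σ n), E α x Φ = covDerivs A α Φ.toFun x) ∧
      ∀ α, α.length ≤ n - 2 → ∀ x Z,
        ENNReal.ofReal (scale σ x ^ (α.length : ℝ)) * ‖E α x Z‖ₑ ≤ C * ‖Z‖ₑ := by
  obtain ⟨C, hC⟩ := exists_enorm_covDerivs_le hn hσ₀ hσ₁ hA
  have key (α : List (Fin 3)) (x : E3) : ∃ L : HSpace A σ n →ₗ[ℝ] 𝒢, α.length ≤ n - 2 →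
      (∀ Φ : CcSpace A σ n, L Φ = covDerivs A α Φ.toFun x) ∧
      ∀ Z, ENNReal.ofReal (scale σ x ^ (α.length : ℝ)) * ‖L Z‖ₑ ≤ C * ‖Z‖ₑ := by
    by_cases hα : α.length ≤ n - 2
    swap
    · exact ⟨0, fun h => absurd h hα⟩
    have hb (Φ : CcSpace A σ n) :
        ENNReal.ofReal (scale σ x ^ (α.length : ℝ)) * ‖covDerivs A α Φ.toFun x‖ₑ ≤ C * ‖Φ‖ₑ := by
      rw [Φ.enorm_eq]
      exact hC _ Φ.contDiff Φ.hasCompactSupport α hα x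
    let f₀ : CcSpace A σ n →ₗ[ℝ] 𝒢 :=
      { toFun := fun Φ => covDerivs A α Φ.toFun x
        map_add' := fun Φ Ψ => congrFun
          (covDerivs_add hn hA Φ.contDiff_sub_two Ψ.contDiff_sub_two α hα) x
        map_smul' := fun c Φ => congrFun (covDerivs_smul A c Φ.toFun α) x }
    let f : CcSpace A σ n →L[ℝ] 𝒢 := f₀.mkContinuous C fun Φ => by
      have h1 : ‖covDerivs A α Φ.toFun x‖ₑ ≤ C * ‖Φ‖ₑ := by
        refine le_trans ?_ (hb Φ)
        refine le_mul_of_one_le_left zero_le ?_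
        rw [ENNReal.one_le_ofReal]
        exact Real.one_le_rpow (one_le_scale hσ₁ x) (Nat.cast_nonneg _)
      have h2 := ENNReal.toReal_mono (by finiteness) h1
      rw [ENNReal.toReal_mul, toReal_enorm, toReal_enorm] at h2
      exact h2
    have hd : DenseRange (UniformSpace.Completion.toComplL : CcSpace A σ n →L[ℝ] HSpace A σ n) :=
      UniformSpace.Completion.denseRange_coe
    have hi : IsUniformInducing
        (UniformSpace.Completion.toComplL : CcSpace A σ n →L[ℝ] HSpace A σ n) :=
      UniformSpace.Completion.isUniformInducing_coe _
    have he (Φ : CcSpace A σ n) :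
        f.extend (UniformSpace.Completion.toComplL : CcSpace A σ n →L[ℝ] HSpace A σ n) Φ = f Φ :=
      f.extend_eq hd hi Φ
    refine ⟨(f.extend UniformSpace.Completion.toComplL).toLinearMap, fun _ => ⟨he, fun Z => ?_⟩⟩
    induction Z using UniformSpace.Completion.induction_on with
    | hp =>
      refine isClosed_le ?_ ?_
      · exact (ENNReal.continuous_const_mul ENNReal.ofReal_ne_top).comp
          (ContinuousLinearMap.continuous _).enorm
      · exact (ENNReal.continuous_const_mul ENNReal.coe_ne_top).comp continuous_enorm
    | ih Φ =>
      rw [UniformSpace.Completion.enorm_coe]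
      exact (congrArg _ (congrArg _ (he Φ))).trans_le (hb Φ)
  choose E hE using key
  exact ⟨C, E, fun α hα x => (hE α x hα).1, fun α hα x => (hE α x hα).2⟩

/-! ### Uniform limits of covariant derivatives -/

lemma fderiv_eq_sum (f : E3 → 𝒢) (x : E3) :
    fderiv ℝ f x = ∑ k, (EuclideanSpace.proj k : E3 →L[ℝ] ℝ).smulRight (fderiv ℝ f x (unitVec k)) := by
  ext v
  simp only [sum_apply, ContinuousLinearMap.smulRight_apply]
  have hv : v = ∑ k, v k • unitVec k := by
    ext i
    fin_cases i <;> simp [unitVec, Fin.sum_univ_three]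
  conv_lhs => rw [hv]
  simp

lemma tendstoUniformlyOn_bracket {a : E3 → 𝒢} {s : Set E3} {M : ℝ} (hM : ∀ x ∈ s, ‖a x‖ ≤ M)
    {u : ℕ → E3 → 𝒢} {v : E3 → 𝒢} (h : TendstoUniformlyOn u v atTop s) :
    TendstoUniformlyOn (fun j x => ⁅a x, u j x⁆) (fun x => ⁅a x, v x⁆) atTop s := by
  rw [Metric.tendstoUniformlyOn_iff] at h ⊢
  intro ε hε
  set c := ‖(bracketL : 𝒢 →L[ℝ] 𝒢 →L[ℝ] 𝒢)‖ * |M| + 1 with hc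
  have hc0 : 0 < c := by positivity
  filter_upwards [h (ε / c) (by positivity)] with j hj x hx
  have h1 := hj x hx
  rw [dist_eq_norm] at h1 ⊢
  rw [← lie_sub]
  calc ‖⁅a x, v x - u j x⁆‖ ≤ ‖(bracketL : 𝒢 →L[ℝ] 𝒢 →L[ℝ] 𝒢)‖ * ‖a x‖ * ‖v x - u j x‖ :=
        bracketL.le_opNorm₂ _ _
    _ ≤ ‖(bracketL : 𝒢 →L[ℝ] 𝒢 →L[ℝ] 𝒢)‖ * |M| * ‖v x - u j x‖ := by
        gcongr
        exact (hM x hx).trans (le_abs_self M)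
    _ ≤ c * ‖v x - u j x‖ := by
        gcongr
        linarith
    _ < c * (ε / c) := by gcongr
    _ = ε := by field_simp

/-- If a sequence and its covariant derivatives converge uniformly, then the limit is
differentiable and the limits of the covariant derivatives determine its derivative. -/
lemma hasFDerivAt_of_tendstoUniformly_covDeriv (hA : ∀ k, Continuous (A k)) {u : ℕ → E3 → 𝒢}
    {v : E3 → 𝒢} {w : Fin 3 → E3 → 𝒢} (hd : ∀ j, Differentiable ℝ (u j))
    (hu : TendstoUniformly u v atTop)
    (hw : ∀ k, TendstoUniformly (fun j => covDeriv A k (u j)) (w k) atTop) (x : E3) :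
    HasFDerivAt v (∑ k, (EuclideanSpace.proj k : E3 →L[ℝ] ℝ).smulRight (w k x - ⁅A k x, v x⁆)) x := by
  refine hasFDerivAt_of_tendstoUniformlyOn (𝕜 := ℝ) (s := Metric.ball x 1) (l := atTop) (f := u)
    (f' := fun j y => ∑ k, (EuclideanSpace.proj k : E3 →L[ℝ] ℝ).smulRight
      (covDeriv A k (u j) y - ⁅A k y, u j y⁆))
    (g' := fun y => ∑ k, (EuclideanSpace.proj k : E3 →L[ℝ] ℝ).smulRight (w k y - ⁅A k y, v y⁆))
    Metric.isOpen_ball ?_ (fun j y _ => ?_) (fun y _ => ?_) (Metric.mem_ball_self one_pos)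
  · have h (k : Fin 3) : TendstoUniformlyOn
        (fun j y => (EuclideanSpace.proj k : E3 →L[ℝ] ℝ).smulRight
          (covDeriv A k (u j) y - ⁅A k y, u j y⁆))
        (fun y => (EuclideanSpace.proj k : E3 →L[ℝ] ℝ).smulRight (w k y - ⁅A k y, v y⁆)) atTop
        (Metric.ball x 1) := by
      obtain ⟨M, hM⟩ := (isCompact_closedBall x 1).exists_bound_of_continuousOn
        (hA k).continuousOn
      have h1 := tendstoUniformlyOn_bracket
        (fun y hy => hM y (Metric.ball_subset_closedBall hy))
        (hu.tendstoUniformlyOn (s := Metric.ball x 1))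
      have h2 := ((hw k).tendstoUniformlyOn (s := Metric.ball x 1)).sub h1
      exact (ContinuousLinearMap.smulRightL ℝ E3 𝒢
        (EuclideanSpace.proj k : E3 →L[ℝ] ℝ)).uniformContinuous.comp_tendstoUniformlyOn h2
    simp only [Fin.sum_univ_three]
    exact ((h 0).add (h 1)).add (h 2)
  · have h := (hd j y).hasFDerivAt
    rw [fderiv_eq_sum] at h
    simpa [covDeriv] using h
  · exact hu.tendsto_at y

lemma covDeriv_of_hasFDerivAt {v : E3 → 𝒢} {w : Fin 3 → E3 → 𝒢}
    (h : ∀ x, HasFDerivAt v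
      (∑ k, (EuclideanSpace.proj k : E3 →L[ℝ] ℝ).smulRight (w k x - ⁅A k x, v x⁆)) x) (k : Fin 3) :
    covDeriv A k v = w k := by
  funext x
  rw [covDeriv, (h x).fderiv]
  fin_cases k <;> simp [unitVec, Fin.sum_univ_three]

/-- A uniform limit, with all covariant derivatives of order at most `n - 2`, is of class `C^{n-2}`,
and its covariant derivatives are the limits. -/
lemma contDiff_and_covDerivs_of_tendstoUniformly (hn : 2 ≤ n) (hA : LocalAssumptions A n)
    {Φ : ℕ → E3 → 𝒢} {Ψ : List (Fin 3) → E3 → 𝒢} (hΦ : ∀ j, ContDiff ℝ (n - 2 : ℕ) (Φ j))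
    (h : ∀ α, α.length ≤ n - 2 → TendstoUniformly (fun j => covDerivs A α (Φ j)) (Ψ α) atTop) :
    ContDiff ℝ (n - 2 : ℕ) (Ψ []) ∧ ∀ α, α.length ≤ n - 2 → covDerivs A α (Ψ []) = Ψ α := by
  have hcA := hA.continuous hn
  have hcont (α : List (Fin 3)) (hα : α.length ≤ n - 2) : Continuous (Ψ α) :=
    (h α hα).continuous (Frequently.of_forall fun j =>
      (contDiff_covDerivs hn hA (hΦ j) α hα).continuous)
  have hder (α : List (Fin 3)) (hα : α.length < n - 2) := hasFDerivAt_of_tendstoUniformly_covDeriv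
    hcA (fun j => differentiable_covDerivs hn hA (hΦ j) α hα) (h α hα.le)
    (fun k => h (k :: α) (by simpa using hα))
  have hdiff (m : ℕ) : ∀ α : List (Fin 3), α.length + m ≤ n - 2 → ContDiff ℝ m (Ψ α) := by
    induction m with
    | zero => exact fun α hα => contDiff_zero.mpr (hcont α hα)
    | succ m ih =>
      intro α hα
      push_cast
      refine contDiff_succ_iff_hasFDerivAt.mpr ⟨_, ?_, hder α (by omega)⟩
      refine ContDiff.sum fun k _ => ?_
      refine (ContinuousLinearMap.smulRightL ℝ E3 𝒢
        (EuclideanSpace.proj k : E3 →L[ℝ] ℝ)).contDiff.comp ?_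
      refine (ih (k :: α) (by simp; omega)).sub ?_
      have h1 : ContDiff ℝ m (A k) :=
        (hA.contDiff hn k).of_le (by exact_mod_cast (by omega : m ≤ n - 3))
      exact bracketL.isBoundedBilinearMap.contDiff.comp (h1.prodMk (ih α (by omega)))
  refine ⟨hdiff (n - 2) [] (by simp), fun α => ?_⟩
  induction α with
  | nil => exact fun _ => rfl
  | cons k α ih =>
    intro hα
    have hα' : α.length < n - 2 := by simpa using hα
    rw [covDerivs, ih hα'.le]
    exact covDeriv_of_hasFDerivAt (w := fun k => Ψ (k :: α)) (hder α hα') k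

lemma tendstoUniformly_of_enorm_le {u : ℕ → E3 → 𝒢} {v : E3 → 𝒢} {ε : ℕ → ℝ≥0∞}
    (h : ∀ j x, ‖u j x - v x‖ₑ ≤ ε j) (hε : Tendsto ε atTop (𝓝 0)) :
    TendstoUniformly u v atTop := by
  rw [EMetric.tendstoUniformly_iff]
  intro δ hδ
  filter_upwards [hε.eventually (gt_mem_nhds hδ)] with j hj x
  rw [edist_comm, edist_eq_enorm_sub]
  exact (h j x).trans_lt hj

/-- Elements of the completion are limits of rapidly converging sequences in `C^n_c`. -/
lemma exists_seq_enorm_sub_lt (Z : HSpace A σ n) : ∃ Φ : ℕ → CcSpace A σ n,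
    ∀ j, ‖(Φ j : HSpace A σ n) - Z‖ₑ < (1 / 2) ^ (j + 1) := by
  have h (j : ℕ) : ∃ Φ : CcSpace A σ n, ‖(Φ : HSpace A σ n) - Z‖ₑ < (1 / 2) ^ (j + 1) := by
    obtain ⟨Φ, hΦ⟩ := UniformSpace.Completion.denseRange_coe.exists_mem_open
      (s := Metric.eball Z ((1 / 2) ^ (j + 1))) Metric.isOpen_eball
      ⟨Z, Metric.mem_eball_self (ENNReal.pow_pos (by simp) _)⟩
    exact ⟨Φ, by rwa [← edist_eq_enorm_sub]⟩
  choose Φ hΦ using h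
  exact ⟨Φ, hΦ⟩

end Completion

/-! ### Injectivity on the completion -/

lemma tendsto_eLpNorm_one_bracket {a : E3 → 𝒢} (ha : Continuous a) {u : ℕ → E3 → 𝒢} {K : Set E3}
    (hK : IsCompact K)
    (h : Tendsto (fun j => eLpNorm (u j) 1 (volume.restrict K)) atTop (𝓝 0)) :
    Tendsto (fun j => eLpNorm (fun x => ⁅a x, u j x⁆) 1 (volume.restrict K)) atTop (𝓝 0) := by
  obtain ⟨M, hM⟩ := exists_eLpNorm_bracket_le_of_continuous ha hK
  have h2 := ENNReal.Tendsto.const_mul h (Or.inr (ENNReal.ofReal_ne_top (r := M)))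
  rw [mul_zero] at h2
  refine tendsto_of_tendsto_of_tendsto_of_le_of_le tendsto_const_nhds h2 (fun _ => zero_le)
    fun j => ?_
  have h3 := hM (K.indicator (u j)) Set.support_indicator_subset 1
  have e : (fun x => ⁅a x, K.indicator (u j) x⁆) = K.indicator fun x => ⁅a x, u j x⁆ := by
    funext x
    by_cases hx : x ∈ K <;> simp [hx]
  rwa [e, eLpNorm_indicator_eq_eLpNorm_restrict hK.measurableSet,
    eLpNorm_indicator_eq_eLpNorm_restrict hK.measurableSet] at h3

/-- Convergence in `L²` implies convergence in `L¹_loc`, also after multiplication by a continuous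
function. -/
lemma tendsto_eLpNorm_one_smul {c : E3 → ℝ} (hc : Continuous c) {u : ℕ → E3 → 𝒢}
    (hu : ∀ j, AEStronglyMeasurable (u j)) (h : Tendsto (fun j => eLpNorm (u j) 2) atTop (𝓝 0))
    {K : Set E3} (hK : IsCompact K) :
    Tendsto (fun j => eLpNorm (fun x => c x • u j x) 1 (volume.restrict K)) atTop (𝓝 0) := by
  have hcK : MemLp c 2 (volume.restrict K) := by
    obtain ⟨C, hC⟩ := hK.exists_bound_of_continuousOn hc.continuousOn
    have : IsFiniteMeasure (volume.restrict K) := ⟨by simpa using hK.measure_lt_top⟩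
    exact MemLp.of_bound hc.aestronglyMeasurable C
      ((ae_restrict_iff' hK.measurableSet).mpr (Eventually.of_forall hC))
  have h2 := ENNReal.Tendsto.const_mul (tendsto_eLpNorm_restrict h K) (Or.inr hcK.2.ne)
  rw [mul_zero] at h2
  refine tendsto_of_tendsto_of_tendsto_of_le_of_le tendsto_const_nhds h2 (fun _ => zero_le)
    fun j => ?_
  exact eLpNorm_smul_le_mul_eLpNorm (p := 2) (q := 2) (r := 1) (hu j).restrict hcK.1

lemma tendsto_eLpNorm_restrict_of_enorm_le {u : ℕ → E3 → 𝒢}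
    {ε : ℕ → ℝ≥0∞} (h : ∀ j x, ‖u j x‖ₑ ≤ ε j) (hε : Tendsto ε atTop (𝓝 0)) {K : Set E3}
    (hK : IsCompact K) :
    Tendsto (fun j => eLpNorm (u j) 1 (volume.restrict K)) atTop (𝓝 0) := by
  have h2 := ENNReal.Tendsto.mul_const hε (Or.inr (hK.measure_lt_top (μ := volume)).ne)
  rw [zero_mul] at h2
  refine tendsto_of_tendsto_of_tendsto_of_le_of_le tendsto_const_nhds h2 (fun _ => zero_le)
    fun j => ?_
  rw [eLpNorm_one_eq_lintegral_enorm]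
  calc ∫⁻ x in K, ‖u j x‖ₑ ≤ ∫⁻ _ in K, ε j := lintegral_mono (h j)
    _ = ε j * volume K := by simp

section Completion

variable {A : Fin 3 → E3 → 𝒢} {σ : ℝ} {n : ℕ}

lemma IsCovJet.sub {Φ Φ' : E3 → 𝒢} {D D' : List (Fin 3) → E3 → 𝒢} (h : IsCovJet A n Φ D)
    (h' : IsCovJet A n Φ' D') : IsCovJet A n (Φ - Φ') (D - D') := by
  have := h.add (h'.smul (-1))
  simpa only [neg_smul, one_smul, ← sub_eq_add_neg] using this

/-- The weighted covariant derivative that enters the norm `‖·‖_{n,2}`. -/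
noncomputable def weighted (σ : ℝ) (D : List (Fin 3) → E3 → 𝒢) (α : List (Fin 3)) : E3 → 𝒢 :=
  fun x => weight x ^ (((α.length : ℝ) - 3 / 2) * (1 - σ)) • D α x

lemma weighted_sub (σ : ℝ) (D D' : List (Fin 3) → E3 → 𝒢) (α : List (Fin 3)) :
    weighted σ (D - D') α = weighted σ D α - weighted σ D' α := by
  funext x
  simp [weighted, smul_sub]

lemma tendsto_jetNorm {D : ℕ → List (Fin 3) → E3 → 𝒢}
    (h : ∀ α : List (Fin 3), 1 ≤ α.length → α.length ≤ n →
      Tendsto (fun j => eLpNorm (weighted σ (D j) α) 2) atTop (𝓝 0)) :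
    Tendsto (fun j => jetNorm σ n (D j)) atTop (𝓝 0) := by
  unfold jetNorm
  have z (r : ℝ) (hr : 0 < r) {f : ℕ → ℝ≥0∞} (hf : Tendsto f atTop (𝓝 0)) :
      Tendsto (fun j => f j ^ r) atTop (𝓝 0) := by
    have := (ENNReal.continuous_rpow_const (y := r)).tendsto 0 |>.comp hf
    rwa [ENNReal.zero_rpow_of_pos hr] at this
  refine z _ (by norm_num) ?_
  rw [show (0 : ℝ≥0∞) = ∑ p ∈ Finset.Icc 1 n, ∑ _α : Fin p → Fin 3, 0 by simp]
  refine tendsto_finsetSum _ fun p hp => tendsto_finsetSum _ fun α _ => z _ (by norm_num) ?_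
  have hp := Finset.mem_Icc.mp hp
  have := h (List.ofFn α) (by simpa using hp.1) (by simpa using hp.2)
  unfold weighted at this
  simpa only [List.length_ofFn] using this

/-- A sequence of jets that converges to zero in `L¹_loc`, and whose weighted derivatives converge
in `L²`, converges to zero in `‖·‖_{n,2}`: the limits of the derivatives are the weak covariant
derivatives of the limit. -/
lemma tendsto_weighted_zero (hA : ∀ k, Continuous (A k)) {Φ : ℕ → E3 → 𝒢}
    {D : ℕ → List (Fin 3) → E3 → 𝒢} (hD : ∀ j, IsCovJet A n (Φ j) (D j))
    (h0 : ∀ K : Set E3, IsCompact K →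
      Tendsto (fun j => eLpNorm (Φ j) 1 (volume.restrict K)) atTop (𝓝 0))
    (hlim : ∀ α : List (Fin 3), 1 ≤ α.length → α.length ≤ n → ∃ G : E3 → 𝒢, MemLp G 2 ∧
      Tendsto (fun j => eLpNorm (weighted σ (D j) α - G) 2) atTop (𝓝 0))
    (α : List (Fin 3)) (hα : α.length ≤ n) :
    (∀ K : Set E3, IsCompact K →
      Tendsto (fun j => eLpNorm (D j α) 1 (volume.restrict K)) atTop (𝓝 0)) ∧
    (1 ≤ α.length → Tendsto (fun j => eLpNorm (weighted σ (D j) α) 2) atTop (𝓝 0)) := by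
  induction α with
  | nil => exact ⟨fun K hK => by simpa only [(hD _).nil] using h0 K hK, fun h => by simp at h⟩
  | cons k α ih =>
    have hα' : α.length < n := by simpa using hα
    obtain ⟨ih1, -⟩ := ih hα'.le
    obtain ⟨G, hG, hlimG⟩ := hlim (k :: α) (by simp) hα
    set s : ℝ := (((k :: α).length : ℝ) - 3 / 2) * (1 - σ) with hs
    have hsm (j : ℕ) : AEStronglyMeasurable (weighted σ (D j) (k :: α)) :=
      (continuous_weight_rpow s).aestronglyMeasurable.smul ((hD j).aesm (by simp) hα)
    have hinv (x : E3) (X : 𝒢) : weight x ^ (-s) • weight x ^ s • X = X := by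
      rw [smul_smul, ← Real.rpow_add (weight_pos x), neg_add_cancel, Real.rpow_zero, one_smul]
    have hconv (K : Set E3) (hK : IsCompact K) :
        Tendsto (fun j => eLpNorm (D j (k :: α) - fun x => weight x ^ (-s) • G x) 1
          (volume.restrict K)) atTop (𝓝 0) := by
      refine (tendsto_eLpNorm_one_smul (continuous_weight_rpow (-s))
        (fun j => (hsm j).sub hG.1) hlimG hK).congr fun j => ?_
      congr 1
      funext x
      simp only [Pi.sub_apply, smul_sub, weighted, hinv, ← hs]
    have hGloc : LocallyIntegrable fun x => weight x ^ (-s) • G x :=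
      locallyIntegrable_smul (continuous_weight_rpow (-s)) (hG.locallyIntegrable (by norm_num))
    have hweak : IsWeakDeriv k (0 : E3 → 𝒢) fun x => weight x ^ (-s) • G x := by
      refine isWeakDeriv_of_tendsto (fun j => ((hD j).cons k α hα').weakDeriv)
        locallyIntegrable_zero hGloc (fun K hK => by simpa using ih1 K hK) fun K hK => ?_
      have hb := (hconv K hK).add (tendsto_eLpNorm_one_bracket (hA k) hK (ih1 K hK))
      rw [add_zero] at hb
      refine tendsto_of_tendsto_of_tendsto_of_le_of_le tendsto_const_nhds hb (fun _ => zero_le)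
        fun j => ?_
      have m1 := (((hD j).aesm (by simp) hα).sub hGloc.aestronglyMeasurable).restrict (s := K)
      have m2 := ((hD j).cons k α hα').bracket.aestronglyMeasurable.restrict (s := K)
      refine le_trans (le_of_eq ?_) (eLpNorm_sub_le m1 m2 le_rfl)
      congr 1
      funext x
      simp only [Pi.sub_apply]
      abel
    have hzero : ∀ᵐ x, weight x ^ (-s) • G x = 0 := by
      simpa using hweak.ae_eq_zero isOpen_univ (by simp)
    have hG0 : G =ᵐ[volume] 0 := hzero.mono fun x hx =>
      (smul_eq_zero.mp hx).resolve_left (Real.rpow_pos_of_pos (weight_pos x) _).ne'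
    refine ⟨fun K hK => (hconv K hK).congr fun j => eLpNorm_congr_ae ?_,
      fun _ => hlimG.congr fun j => eLpNorm_congr_ae ?_⟩
    · filter_upwards [ae_restrict_of_ae hzero] with x hx
      simp only [Pi.sub_apply, hx, sub_zero]
    · filter_upwards [hG0] with x hx
      simp only [Pi.sub_apply, hx, Pi.zero_apply, sub_zero]

/-- An element of the completion vanishes if it is the limit of a rapidly converging sequence that
tends to zero uniformly. -/
lemma eq_zero_of_tendsto (hn : 2 ≤ n) (hA : LocalAssumptions A n) {Z : HSpace A σ n}
    {Φ : ℕ → CcSpace A σ n} (hΦ : ∀ j, ‖(Φ j : HSpace A σ n) - Z‖ₑ < (1 / 2) ^ (j + 1))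
    {ε : ℕ → ℝ≥0∞} (h0 : ∀ j x, ‖(Φ j).toFun x‖ₑ ≤ ε j) (hε : Tendsto ε atTop (𝓝 0)) :
    Z = 0 := by
  set D : ℕ → List (Fin 3) → E3 → 𝒢 := fun j => weakCovJet A (Φ j).toFun
  have hD (j : ℕ) : IsCovJet A n (Φ j).toFun (D j) := (weakCovJet_spec hn hA (Φ j).contDiff).1
  have hN (j : ℕ) : jetNorm σ n (D j) = ‖Φ j‖ₑ := by rw [(Φ j).enorm_eq, sobNorm_eq (hD j)]
  have hlim (α : List (Fin 3)) (h1 : 1 ≤ α.length) (hα : α.length ≤ n) : ∃ G : E3 → 𝒢,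
      MemLp G 2 ∧ Tendsto (fun j => eLpNorm (weighted σ (D j) α - G) 2) atTop (𝓝 0) := by
    refine Lp.cauchy_complete_eLpNorm (by norm_num) (B := fun N => (1 / 2) ^ N) (fun j => ⟨?_, ?_⟩)
      ?_ fun N i j hi hj => ?_
    · exact (continuous_weight_rpow _).aestronglyMeasurable.smul ((hD j).aesm h1 hα)
    · exact (eLpNorm_weight_smul_le_jetNorm σ h1 hα).trans_lt (by rw [hN]; exact enorm_lt_top)
    · simp [ENNReal.tsum_geometric]
    · rw [← weighted_sub]
      refine (eLpNorm_weight_smul_le_jetNorm σ h1 hα).trans_lt ?_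
      have e : jetNorm σ n (D i - D j) = ‖Φ i - Φ j‖ₑ := by
        rw [CcSpace.enorm_eq, ← sobNorm_eq ((hD i).sub (hD j))]
        rfl
      have hle (m : ℕ) (hm : N ≤ m) : ((1 / 2 : ℝ≥0∞)) ^ (m + 1) ≤ (1 / 2) ^ (N + 1) :=
        pow_le_pow_right_of_le_one' (by simp) (by omega)
      calc jetNorm σ n (D i - D j) = ‖(Φ i : HSpace A σ n) - Z - (Φ j - Z)‖ₑ := by
            rw [e, ← UniformSpace.Completion.enorm_coe, UniformSpace.Completion.coe_sub,
              sub_sub_sub_cancel_right]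
        _ ≤ ‖(Φ i : HSpace A σ n) - Z‖ₑ + ‖(Φ j : HSpace A σ n) - Z‖ₑ := enorm_sub_le
        _ < (1 / 2) ^ (N + 1) + (1 / 2) ^ (N + 1) :=
            ENNReal.add_lt_add ((hΦ i).trans_le (hle i hi)) ((hΦ j).trans_le (hle j hj))
        _ = (1 / 2) ^ N := by
            rw [← mul_two, pow_succ, mul_assoc, one_div, ENNReal.inv_mul_cancel (by simp) (by simp),
              mul_one]
  have h1 := tendsto_jetNorm fun α h1 hα => (tendsto_weighted_zero (hA.continuous hn) hD
    (fun K hK => tendsto_eLpNorm_restrict_of_enorm_le h0 hε hK) hlim α hα).2 h1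
  have h2 : Tendsto (fun j => (Φ j : HSpace A σ n)) atTop (𝓝 0) := by
    rw [tendsto_iff_edist_tendsto_0]
    refine h1.congr fun j => ?_
    rw [hN, edist_zero_right, UniformSpace.Completion.enorm_coe]
  refine tendsto_nhds_unique ?_ h2
  rw [tendsto_iff_edist_tendsto_0]
  refine tendsto_of_tendsto_of_tendsto_of_le_of_le tendsto_const_nhds
    ((ENNReal.tendsto_pow_atTop_nhds_zero_of_lt_one (r := 1 / 2) (by simp)).comp
      (tendsto_add_atTop_nat 1)) (fun _ => zero_le) fun j => ?_
  rw [edist_eq_enorm_sub]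
  exact (hΦ j).le

end Completion

end CovSobolev

open CovSobolev Filter Topology

theorem theorem3p1 {𝒢 : Type*} [CovSobolev.LieRingWithNorm 𝒢] [CovSobolev.CompactLieAlgebra 𝒢]
    (σ : ℝ) (hσ₀ : 0 < σ) (hσ₁ : σ ≤ 1) (n : ℕ) (hn : 2 ≤ n)
    (A : Fin 3 → CovSobolev.E3 → 𝒢) (hA : CovSobolev.LocalAssumptions A n) :
    (∀ Φ : CovSobolev.E3 → 𝒢, ContDiff ℝ n Φ → HasCompactSupport Φ →
      Φ ∈ CovSobolev.ccSubmodule A σ n) ∧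
    ∃ J : CovSobolev.HSpace A σ n →ₗ[ℝ] (CovSobolev.E3 → 𝒢),
      (∀ Φ : CovSobolev.CcSpace A σ n, J (Φ : CovSobolev.HSpace A σ n) = Φ.toFun) ∧
      Function.Injective J ∧
      (∀ Z : CovSobolev.HSpace A σ n, CovSobolev.MemCB A σ (n - 2) (J Z)) ∧
      ∃ C : ℝ≥0, ∀ Z : CovSobolev.HSpace A σ n,
        CovSobolev.cbNorm A σ (n - 2) (J Z) ≤ C * ‖Z‖ₑ := by
  refine ⟨fun Φ hΦ hc => ⟨hΦ, hc, sobNorm_lt_top hn hA σ hΦ hc⟩, ?_⟩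
  obtain ⟨C, E, hE, hb⟩ := exists_extension hn hσ₀ hσ₁ hA
  -- The extended derivatives of an approximating sequence converge uniformly.
  have hunif (Z : HSpace A σ n) (α : List (Fin 3)) (hα : α.length ≤ n - 2) (Φ : CcSpace A σ n)
      (x : E3) : ‖covDerivs A α Φ.toFun x - E α x Z‖ₑ ≤ C * ‖(Φ : HSpace A σ n) - Z‖ₑ := by
    rw [← hE α hα, ← map_sub]
    refine le_trans (le_mul_of_one_le_left zero_le ?_) (hb α hα x _)
    rw [ENNReal.one_le_ofReal]
    exact Real.one_le_rpow (one_le_scale hσ₁ x) (Nat.cast_nonneg _)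
  have htends {Z : HSpace A σ n} {Φ : ℕ → CcSpace A σ n}
      (hΦ : ∀ j, ‖(Φ j : HSpace A σ n) - Z‖ₑ < (1 / 2) ^ (j + 1)) :
      Tendsto (fun j => C * ‖(Φ j : HSpace A σ n) - Z‖ₑ) atTop (𝓝 0) := by
    rw [← mul_zero (C : ℝ≥0∞)]
    refine ENNReal.Tendsto.const_mul ?_ (Or.inr ENNReal.coe_ne_top)
    exact tendsto_of_tendsto_of_tendsto_of_le_of_le tendsto_const_nhds
      ((ENNReal.tendsto_pow_atTop_nhds_zero_of_lt_one (r := 1 / 2) (by simp)).comp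
        (tendsto_add_atTop_nat 1)) (fun _ => zero_le) fun j => (hΦ j).le
  have hreg (Z : HSpace A σ n) : ContDiff ℝ (n - 2 : ℕ) (fun x => E [] x Z) ∧
      ∀ α, α.length ≤ n - 2 → covDerivs A α (fun x => E [] x Z) = fun x => E α x Z := by
    obtain ⟨Φ, hΦ⟩ := exists_seq_enorm_sub_lt Z
    exact contDiff_and_covDerivs_of_tendstoUniformly (Ψ := fun α x => E α x Z) hn hA
      (fun j => (Φ j).contDiff_sub_two) fun α hα =>
        tendstoUniformly_of_enorm_le (fun j => hunif Z α hα (Φ j)) (htends hΦ)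
  have hcb (Z : HSpace A σ n) : cbNorm A σ (n - 2) (fun x => E [] x Z) ≤
      (3 ^ (n - 2) * C : ℝ≥0) * ‖Z‖ₑ := by
    refine (cbNorm_le (B := C * ‖Z‖ₑ) fun α hα x => ?_).trans (le_of_eq ?_)
    · rw [(hreg Z).2 α hα]
      exact hb α hα x Z
    · push_cast
      rw [mul_assoc]
  refine ⟨LinearMap.pi (E []), fun Φ => funext fun x => hE [] (by simp) x Φ, ?_,
    fun Z => ⟨(hreg Z).1, (hcb Z).trans_lt (by finiteness)⟩, 3 ^ (n - 2) * C, hcb⟩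
  refine (injective_iff_map_eq_zero _).mpr fun Z hZ => ?_
  obtain ⟨Φ, hΦ⟩ := exists_seq_enorm_sub_lt Z
  refine eq_zero_of_tendsto hn hA hΦ (fun j x => ?_) (htends hΦ)
  have h := hunif Z [] (by simp) (Φ j) x
  rw [show E [] x Z = 0 from congrFun hZ x, sub_zero] at h
  exact h
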